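/- Let $G$ be a torus (a compact connected abelian Lie group) with Lie algebra $\mathfrak g$ and integral lattice $\ker(\exp:\mathfrak g\to G)$. A *unimodular cone* in $\mathfrak g^*$ is a set $\{\eta : \langle\eta-\epsilon,v_i\rangle\ge 0,\ 1\le i\le k\}$, where $\epsilon\in\mathfrak g^*$ and $v_1,\dots,v_k$ is a $\mathbb Z$-basis of the integral lattice of a subtorus of $G$ ($k=0$ is allowed). Let $W$ be a manifold with corners (Hausdorff, second countable) and let $\psi:W\to\mathfrak g^*$ be a *unimodular local embedding*: a smooth map such that every point of $W$ has an open neighbourhood which $\psi$ maps diffeomorphically onto $C\cap O$, with $C$ a unimodular cone and $O\subset\mathfrak g^*$ open. For $U\subset W$ open, a *symplectic toric principal $G$-bundle* over $U$ is a smooth principal $G$-bundle $\pi:P\to U$ (with left action, $P$ a manifold with corners) together with a symplectic form $\sigma$ on $P$ such that the action of $G$ on $(P,\sigma)$ is Hamiltonian with moment map $\psi\circ\pi$, i.e. $\sigma$ is $G$-invariant and $d\langle\psi\circ\pi,\xi\rangle=-\sigma(\xi_P,\cdot)$ for all $\xi\in\mathfrak g$, where $\xi_P$ is the vector field on $P$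 induced by $\xi$. **Proposition.** Let $U\subset W$ be open and let $\pi:(P,\sigma)\to U$ and $\pi':(P',\sigma')\to U$ be symplectic toric principal $G$-bundles. Let $G$ act on $P\times P'$ and on $P\times_U P'=\{(p,p'):\pi(p)=\pi'(p')\}$ by $g\cdot(p,p')=(g\cdot p,g^{-1}\cdot p')$. Let $P\otimes P'=(P\times_U P')/G$ be the quotient space, with the projection $[p,p']\mapsto\pi(p)$ to $U$ and the $G$-action $a\cdot[p,p']=[a\cdot p,p']$. Then: 1. The anti-diagonal action of $G$ on $P\times P'$ with the form $\sigma+\sigma'=\mathrm{pr}_1^*\sigma+\mathrm{pr}_2^*\sigma'$ is Hamiltonian with moment map $\mu(p,p')=\psi(\pi(p))-\psi(\pi'(p'))$. The fibre product $P\times_U P'$ is an open and closed subset of $\mu^{-1}(0)$, and it equals $\mu^{-1}(0)$ if $\psi|_U$ is injective. 2. There are smooth structures of manifolds with corners on $P\times_U P'$ and on $P\otimes P'$, and a 2-form $\sigma\otimes\sigma'$ on $P\otimes P'$, such that - the inclusion $\iota:P\times_U P'\to P\times P'$ is a smooth immersion, and $P\times_U P'\to U$ is a principal $G\times G$-bundle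 for the action $(g,g')\cdot(p,p')=(g\cdot p,g'\cdot p')$; - the orbit map $q:P\times_U P'\to P\otimes P'$ is a principal $G$-bundle for the anti-diagonal action; - $q^*(\sigma\otimes\sigma')=\iota^*(\sigma+\sigma')$. These smooth structures and the form $\sigma\otimes\sigma'$ are uniquely determined by these properties. 3. With this structure, $(P\otimes P',\sigma\otimes\sigma')\to U$ is a symplectic toric principal $G$-bundle over $U$. -/

import Mathlib

open Set Topology Manifold
open scoped ContDiff

noncomputable section

/-! ### Differential forms on manifolds (possibly with corners) -/

section Forms

variable {E H M E' H' M' : Type*}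
  [NormedAddCommGroup E] [NormedSpace ℝ E] [TopologicalSpace H]
  [TopologicalSpace M] [ChartedSpace H M]
  [NormedAddCommGroup E'] [NormedSpace ℝ E'] [TopologicalSpace H']
  [TopologicalSpace M'] [ChartedSpace H' M']

/-- A (not necessarily smooth) differential `k`-form: an alternating `k`-linear form on every
tangent space. -/
abbrev DiffForm (I : ModelWithCorners ℝ E H) (M : Type*) [TopologicalSpace M] [ChartedSpace H M]
    (k : ℕ) : Type _ :=
  ∀ x : M, TangentSpace I x [⋀^Fin k]→L[ℝ] ℝ

/-- The pullback `f^* α`. -/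
def DiffForm.pullback (I : ModelWithCorners ℝ E H) (I' : ModelWithCorners ℝ E' H') {k : ℕ}
    (f : M → M') (α : DiffForm I' M' k) : DiffForm I M k :=
  fun x => (α (f x)).compContinuousLinearMap (mfderiv I I' f x)

/-- The expression of a form in the preferred chart around `x₀`: its pullback under the inverse of
the chart, a form on the subset `(extChartAt I x₀).target` of the model vector space. -/
def DiffForm.inChart {I : ModelWithCorners ℝ E H} {k : ℕ} (α : DiffForm I M k) (x₀ : M) :
    E → E [⋀^Fin k]→L[ℝ] ℝ :=
  fun y => (α ((extChartAt I x₀).symm y)).compContinuousLinearMap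
    (mfderivWithin 𝓘(ℝ, E) I (extChartAt I x₀).symm (range I) y)

/-- A form is smooth if its expressions in charts are. -/
def DiffForm.IsSmooth {I : ModelWithCorners ℝ E H} {k : ℕ} (α : DiffForm I M k) : Prop :=
  ∀ x₀ : M, ContDiffOn ℝ ∞ (α.inChart x₀) (extChartAt I x₀).target

/-- A form is closed if the exterior derivatives of its expressions in charts vanish. -/
def DiffForm.IsClosed {I : ModelWithCorners ℝ E H} {k : ℕ} (α : DiffForm I M k) : Prop :=
  ∀ x₀ : M, ∀ y ∈ (extChartAt I x₀).target,
    extDerivWithin (α.inChart x₀) (extChartAt I x₀).target y = 0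

/-- A symplectic form: a smooth closed nondegenerate 2-form. -/
structure DiffForm.IsSymplectic {I : ModelWithCorners ℝ E H} (α : DiffForm I M 2) : Prop where
  smooth : α.IsSmooth
  closed : α.IsClosed
  nondegenerate : ∀ (x : M) (v : TangentSpace I x),
    (∀ w : TangentSpace I x, α x ![v, w] = 0) → v = 0

/-- The form `pr₁^* α + pr₂^* α'` on the product. -/
def DiffForm.boxSum {I : ModelWithCorners ℝ E H} {I' : ModelWithCorners ℝ E' H'} {k : ℕ}
    (α : DiffForm I M k) (α' : DiffForm I' M' k) : DiffForm (I.prod I') (M × M') k :=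
  fun x => DiffForm.pullback (I.prod I') I Prod.fst α x +
    DiffForm.pullback (I.prod I') I' Prod.snd α' x

/-- A smooth manifold in the usual sense: smooth, Hausdorff, second countable. -/
structure IsSmoothManifold (I : ModelWithCorners ℝ E H) (M : Type*) [TopologicalSpace M]
    [ChartedSpace H M] : Prop where
  isManifold : IsManifold I ∞ M
  t2 : T2Space M
  secondCountable : SecondCountableTopology M

/-- Two atlases (with the same model) on a space define the same smooth structure: the identity is
a diffeomorphism. -/
def SameSmoothStructure (I : ModelWithCorners ℝ E H) {M : Type*} [TopologicalSpace M]
    (c₁ c₂ : ChartedSpace H M) : Prop :=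
  @ContMDiff ℝ _ E _ _ H _ I M _ c₁ E _ _ H _ I M _ c₂ ∞ id ∧
  @ContMDiff ℝ _ E _ _ H _ I M _ c₂ E _ _ H _ I M _ c₁ ∞ id

end Forms

/-! ### Torus actions, moment maps, principal bundles

`G` is a Lie group modelled on the vector space `EG`. Its Lie algebra `𝔤`, the tangent space at `1`,
is by definition the space `EG` itself, and `𝔤*` is `EG →L[ℝ] ℝ`. -/

section Actions

variable {EG G : Type*} [NormedAddCommGroup EG] [NormedSpace ℝ EG]
  [TopologicalSpace G] [ChartedSpace EG G] [CommGroup G]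
  {E H M : Type*} [NormedAddCommGroup E] [NormedSpace ℝ E] [TopologicalSpace H]
  [TopologicalSpace M] [ChartedSpace H M]

/-- The vector field `ξ_M` on `M` induced by `ξ ∈ 𝔤 = T_1 G`: the value at `x` is the derivative at
`1` of the orbit map `g ↦ g • x` in the direction `ξ` (that is, the velocity at time `0` of
`exp (t ξ) • x`). -/
def inducedVectorField (I : ModelWithCorners ℝ E H) (G : Type*) [TopologicalSpace G]
    [ChartedSpace EG G] [CommGroup G] [MulAction G M] (ξ : EG) (x : M) : TangentSpace I x :=
  (mfderiv 𝓘(ℝ, EG) I (fun g : G => g • x) 1 : EG →L[ℝ] E) ξ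

/-- The action of `G` on `M` preserves the 2-form `α`, and it is Hamiltonian with the (smooth,
invariant) moment map `μ : M → 𝔤*`, with the sign convention `d⟨μ, ξ⟩ = - α(ξ_M, ·)`. -/
structure IsMomentMap {I : ModelWithCorners ℝ E H} (G : Type*) [TopologicalSpace G]
    [ChartedSpace EG G] [CommGroup G] [MulAction G M] (α : DiffForm I M 2)
    (μ : M → (EG →L[ℝ] ℝ)) : Prop where
  form_invariant : ∀ g : G, DiffForm.pullback I I (fun x : M => g • x) α = α
  smooth : ContMDiff I 𝓘(ℝ, EG →L[ℝ] ℝ) ∞ μ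
  invariant : ∀ (g : G) (x : M), μ (g • x) = μ x
  deriv_eq : ∀ (ξ : EG) (x : M) (v : TangentSpace I x),
    (mfderiv I 𝓘(ℝ, ℝ) (fun y : M => μ y ξ) x v : ℝ) =
      - α x ![inducedVectorField I G ξ x, v]

end Actions

section Principal

variable {EB HB B EP HP P EG HG : Type*}
  [NormedAddCommGroup EB] [NormedSpace ℝ EB] [TopologicalSpace HB]
  [TopologicalSpace B] [ChartedSpace HB B]
  [NormedAddCommGroup EP] [NormedSpace ℝ EP] [TopologicalSpace HP]
  [TopologicalSpace P] [ChartedSpace HP P]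
  [NormedAddCommGroup EG] [NormedSpace ℝ EG] [TopologicalSpace HG]

/-- `π : P → B` is a smooth principal `G`-bundle (`G` acting from the left): `G` acts smoothly on
`P`, preserving the fibres of the smooth map `π`, and around every point of `B` there is a smooth
equivariant local trivialization `π⁻¹(V) ≅ V × G` over `V`. -/
structure IsPrincipalBundle (IG : ModelWithCorners ℝ EG HG) (IB : ModelWithCorners ℝ EB HB)
    (IP : ModelWithCorners ℝ EP HP) (G : Type*) [TopologicalSpace G] [ChartedSpace HG G]
    [CommGroup G] [MulAction G P] (π : P → B) : Prop where
  smul_smooth : ContMDiff (IG.prod IP) IP ∞ (fun x : G × P => x.1 • x.2)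
  proj_smul : ∀ (g : G) (p : P), π (g • p) = π p
  proj_smooth : ContMDiff IP IB ∞ π
  locally_trivial : ∀ b : B, ∃ e : Bundle.Trivialization G π, b ∈ e.baseSet ∧
    ContMDiffOn IP (IB.prod IG) ∞ e e.source ∧
    ContMDiffOn (IB.prod IG) IP ∞ e.toOpenPartialHomeomorph.symm e.target ∧
    ∀ (g : G), ∀ p ∈ e.source, (e (g • p)).2 = g * (e p).2

end Principal

section SymplecticToric

variable {EB HB B EP HP P EG : Type*}
  [NormedAddCommGroup EB] [NormedSpace ℝ EB] [TopologicalSpace HB]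
  [TopologicalSpace B] [ChartedSpace HB B]
  [NormedAddCommGroup EP] [NormedSpace ℝ EP] [TopologicalSpace HP]
  [TopologicalSpace P] [ChartedSpace HP P]
  [NormedAddCommGroup EG] [NormedSpace ℝ EG]

/-- A symplectic toric principal `G`-bundle over `ψ : B → 𝔤*`: a principal `G`-bundle `π : P → B`
with a symplectic form `σ` on `P` such that `ψ ∘ π` is a moment map for the action of `G` on
`(P, σ)`. -/
structure IsSymplecticToricBundle (IB : ModelWithCorners ℝ EB HB) {IP : ModelWithCorners ℝ EP HP}
    (G : Type*) [TopologicalSpace G] [ChartedSpace EG G] [CommGroup G] [MulAction G P]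
    (ψ : B → (EG →L[ℝ] ℝ)) (π : P → B) (σ : DiffForm IP P 2) : Prop where
  manifold : IsSmoothManifold IP P
  principal : IsPrincipalBundle 𝓘(ℝ, EG) IB IP G π
  symplectic : σ.IsSymplectic
  moment : IsMomentMap G σ (ψ ∘ π)

end SymplecticToric

/-! ### Unimodular local embeddings -/

section Unimodular

variable {EG : Type*} [NormedAddCommGroup EG] [NormedSpace ℝ EG]

/-- `γ` is the one-parameter subgroup `t ↦ exp (t ξ)` of `G`, i.e. the smooth homomorphism `ℝ → G`
with velocity `ξ` at `0`. -/
structure IsOneParameterSubgroup {G : Type*} [TopologicalSpace G] [ChartedSpace EG G]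
    [CommGroup G] (γ : ℝ → G) (ξ : EG) : Prop where
  map_add : ∀ s t : ℝ, γ (s + t) = γ s * γ t
  smooth : ContMDiff 𝓘(ℝ, ℝ) 𝓘(ℝ, EG) ∞ γ
  velocity : (mfderiv 𝓘(ℝ, ℝ) 𝓘(ℝ, EG) γ 0 : ℝ →L[ℝ] EG) 1 = ξ

/-- The integral lattice `ker (exp : 𝔨 → K)` of a closed connected subgroup `K` of `G`, as a subset
of `𝔤`: the `ξ` whose one-parameter subgroup stays in `K` and has value `1` at time `1`. -/
def integralLattice {G : Type*} [TopologicalSpace G] [ChartedSpace EG G] [CommGroup G]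
    (K : Subgroup G) : Set EG :=
  {ξ | ∃ γ : ℝ → G, IsOneParameterSubgroup γ ξ ∧ (∀ t, γ t ∈ K) ∧ γ 1 = 1}

/-- Unimodular cones in `𝔤*`: the sets `{η | ⟨η - ε, vᵢ⟩ ≥ 0, 1 ≤ i ≤ k}`, where `v₁, …, v_k` is a
`ℤ`-basis of the integral lattice of a subtorus `K` of `G`. -/
def IsUnimodularCone (G : Type*) [TopologicalSpace G] [ChartedSpace EG G] [CommGroup G]
    (C : Set (EG →L[ℝ] ℝ)) : Prop :=
  ∃ (K : Subgroup G) (k : ℕ) (v : Fin k → EG) (ε : EG →L[ℝ] ℝ),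
    _root_.IsClosed (K : Set G) ∧ IsConnected (K : Set G) ∧
    LinearIndependent ℤ v ∧ (Submodule.span ℤ (range v) : Set EG) = integralLattice K ∧
    C = {η | ∀ i, 0 ≤ (η - ε) (v i)}

variable {EW HW W : Type*} [NormedAddCommGroup EW] [NormedSpace ℝ EW] [TopologicalSpace HW]
  [TopologicalSpace W] [ChartedSpace HW W]

/-- A unimodular local embedding `ψ : W → 𝔤*`: a smooth map which around every point restricts to a
diffeomorphism from an open set `T` onto a (relatively) open subset `C ∩ O` of a unimodular cone;
`φ` is the smooth inverse of `ψ|_T`. -/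
structure IsUnimodularLocalEmbedding (IW : ModelWithCorners ℝ EW HW) (G : Type*)
    [TopologicalSpace G] [ChartedSpace EG G] [CommGroup G] (ψ : W → (EG →L[ℝ] ℝ)) : Prop where
  smooth : ContMDiff IW 𝓘(ℝ, EG →L[ℝ] ℝ) ∞ ψ
  locally_cone : ∀ x : W, ∃ (C : Set (EG →L[ℝ] ℝ)) (T : Set W) (O : Set (EG →L[ℝ] ℝ))
    (φ : (EG →L[ℝ] ℝ) → W),
    IsUnimodularCone G C ∧ IsOpen T ∧ x ∈ T ∧ IsOpen O ∧ ψ '' T = C ∩ O ∧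
    (∀ t ∈ T, φ (ψ t) = t) ∧ ContMDiffOn 𝓘(ℝ, EG →L[ℝ] ℝ) IW ∞ φ (C ∩ O)

end Unimodular

/-! ### The tensor product of principal bundles -/

section Tensor

variable {G P P' B : Type*} [CommGroup G] [MulAction G P] [MulAction G P']

/-- The fibre product `P ×_B P'`, with the topology of a subspace of `P × P'`. -/
abbrev FiberProduct (π : P → B) (π' : P' → B) : Type _ := {x : P × P' // π x.1 = π' x.2}

/-- The anti-diagonal action `g · (p, p') = (g p, g⁻¹ p')` of `G` on `P × P'`. -/
abbrev antidiagonalAction (G P P' : Type*) [CommGroup G] [MulAction G P] [MulAction G P'] :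
    MulAction G (P × P') where
  smul g x := (g • x.1, g⁻¹ • x.2)
  one_smul x := by
    change ((1 : G) • x.1, (1 : G)⁻¹ • x.2) = x
    simp
  mul_smul g h x := by
    change ((g * h) • x.1, (g * h)⁻¹ • x.2) = (g • h • x.1, g⁻¹ • h⁻¹ • x.2)
    rw [mul_smul, mul_inv, mul_smul]

variable {π : P → B} {π' : P' → B}

/-- The action `(g, g') · (p, p') = (g p, g' p')` of `G × G` on `P ×_B P'`. -/
abbrev fiberProductAction (hπ : ∀ (g : G) (p : P), π (g • p) = π p)
    (hπ' : ∀ (g : G) (p : P'), π' (g • p) = π' p) : MulAction (G × G) (FiberProduct π π') where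
  smul a x := ⟨(a.1 • x.1.1, a.2 • x.1.2), by simpa [hπ, hπ'] using x.2⟩
  one_smul x := Subtype.ext (Prod.ext (one_smul G x.1.1) (one_smul G x.1.2))
  mul_smul a b x := Subtype.ext (Prod.ext (mul_smul a.1 b.1 x.1.1) (mul_smul a.2 b.2 x.1.2))

/-- The anti-diagonal action `g · (p, p') = (g p, g⁻¹ p')` of `G` on `P ×_B P'`. -/
abbrev fiberProductAntidiagonalAction (hπ : ∀ (g : G) (p : P), π (g • p) = π p)
    (hπ' : ∀ (g : G) (p : P'), π' (g • p) = π' p) : MulAction G (FiberProduct π π') where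
  smul g x := ⟨(g • x.1.1, g⁻¹ • x.1.2), by simpa [hπ, hπ'] using x.2⟩
  one_smul x := Subtype.ext ((antidiagonalAction G P P').one_smul x.1)
  mul_smul g h x := Subtype.ext ((antidiagonalAction G P P').mul_smul g h x.1)

/-- The tensor product `P ⊗ P' = (P ×_B P') / G`, the space of orbits of the anti-diagonal action,
with the quotient topology. -/
abbrev BundleTensor (hπ : ∀ (g : G) (p : P), π (g • p) = π p)
    (hπ' : ∀ (g : G) (p : P'), π' (g • p) = π' p) : Type _ :=
  Quotient (@MulAction.orbitRel G (FiberProduct π π') _ (fiberProductAntidiagonalAction hπ hπ'))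

/-- The orbit map `(p, p') ↦ [p, p']`. -/
def BundleTensor.mk (hπ : ∀ (g : G) (p : P), π (g • p) = π p)
    (hπ' : ∀ (g : G) (p : P'), π' (g • p) = π' p) (x : FiberProduct π π') :
    BundleTensor hπ hπ' :=
  Quotient.mk _ x

/-- The projection `P ⊗ P' → B`, `[p, p'] ↦ π p = π' p'`. -/
def BundleTensor.proj (hπ : ∀ (g : G) (p : P), π (g • p) = π p)
    (hπ' : ∀ (g : G) (p : P'), π' (g • p) = π' p) : BundleTensor hπ hπ' → B :=
  Quotient.lift (fun x : FiberProduct π π' => π x.1.1) (by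
    rintro x y ⟨g, rfl⟩
    exact hπ g y.1.1)

/-- The action `a · [p, p'] = [a p, p']` of `G` on `P ⊗ P'`. -/
abbrev BundleTensor.action (hπ : ∀ (g : G) (p : P), π (g • p) = π p)
    (hπ' : ∀ (g : G) (p : P'), π' (g • p) = π' p) : MulAction G (BundleTensor hπ hπ') where
  smul a := Quotient.map
    (fun x : FiberProduct π π' => ⟨(a • x.1.1, x.1.2), by simpa [hπ] using x.2⟩) (by
      rintro x y ⟨g, rfl⟩
      exact ⟨g, Subtype.ext (Prod.ext (smul_comm g a y.1.1) rfl)⟩)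
  one_smul := by
    rintro ⟨x⟩
    exact congrArg (Quotient.mk _) (Subtype.ext (Prod.ext (one_smul G x.1.1) rfl))
  mul_smul a b := by
    rintro ⟨x⟩
    exact congrArg (Quotient.mk _) (Subtype.ext (Prod.ext (mul_smul a b x.1.1) rfl))

variable {EB HB EP HP EP' HP' EG : Type*}
  [NormedAddCommGroup EB] [NormedSpace ℝ EB] [TopologicalSpace HB]
  [TopologicalSpace B] [ChartedSpace HB B]
  [NormedAddCommGroup EP] [NormedSpace ℝ EP] [TopologicalSpace HP]
  [TopologicalSpace P] [ChartedSpace HP P]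
  [NormedAddCommGroup EP'] [NormedSpace ℝ EP'] [TopologicalSpace HP']
  [TopologicalSpace P'] [ChartedSpace HP' P']
  [NormedAddCommGroup EG] [NormedSpace ℝ EG] [TopologicalSpace G] [ChartedSpace EG G]

/-- `cF`, `cT` are smooth structures on `P ×_B P'` and `P ⊗ P'`, and `τ` is a 2-form on `P ⊗ P'`,
obtained by reduction from `(P × P', σ + σ')`:
* `P ×_B P'` is a submanifold of `P × P'`, and is a principal `G × G`-bundle over `B`;
* the orbit map `P ×_B P' → P ⊗ P'` is a principal `G`-bundle for the anti-diagonal action;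
* the pullback of `τ` by the orbit map is the restriction of `σ + σ'` to `P ×_B P'`.
The manifolds `P ×_B P'` and `P ⊗ P'` are modelled on the products of the model of `B` with
`𝔤 × 𝔤` and with `𝔤`. -/
structure IsReduction (IB : ModelWithCorners ℝ EB HB) {IP : ModelWithCorners ℝ EP HP}
    {IP' : ModelWithCorners ℝ EP' HP'} (σ : DiffForm IP P 2) (σ' : DiffForm IP' P' 2)
    (hπ : ∀ (g : G) (p : P), π (g • p) = π p) (hπ' : ∀ (g : G) (p : P'), π' (g • p) = π' p)
    (cF : ChartedSpace (ModelProd HB (ModelProd EG EG)) (FiberProduct π π'))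
    (cT : ChartedSpace (ModelProd HB EG) (BundleTensor hπ hπ'))
    (τ : DiffForm (IB.prod 𝓘(ℝ, EG)) (BundleTensor hπ hπ') 2) : Prop where
  fiber_manifold :
    IsSmoothManifold (IB.prod (𝓘(ℝ, EG).prod 𝓘(ℝ, EG))) (FiberProduct π π')
  incl_smooth : ContMDiff (IB.prod (𝓘(ℝ, EG).prod 𝓘(ℝ, EG))) (IP.prod IP') ∞
    (Subtype.val : FiberProduct π π' → P × P')
  incl_immersion : ∀ x : FiberProduct π π', Function.Injective
    (mfderiv (IB.prod (𝓘(ℝ, EG).prod 𝓘(ℝ, EG))) (IP.prod IP')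
      (Subtype.val : FiberProduct π π' → P × P') x)
  fiber_principal :
    letI := fiberProductAction hπ hπ'
    IsPrincipalBundle (𝓘(ℝ, EG).prod 𝓘(ℝ, EG)) IB (IB.prod (𝓘(ℝ, EG).prod 𝓘(ℝ, EG))) (G × G)
      (fun x : FiberProduct π π' => π x.1.1)
  tensor_manifold : IsSmoothManifold (IB.prod 𝓘(ℝ, EG)) (BundleTensor hπ hπ')
  orbit_principal :
    letI := fiberProductAntidiagonalAction hπ hπ'
    IsPrincipalBundle 𝓘(ℝ, EG) (IB.prod 𝓘(ℝ, EG)) (IB.prod (𝓘(ℝ, EG).prod 𝓘(ℝ, EG))) G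
      (BundleTensor.mk hπ hπ')
  form_reduced :
    DiffForm.pullback (IB.prod (𝓘(ℝ, EG).prod 𝓘(ℝ, EG))) (IB.prod 𝓘(ℝ, EG))
        (BundleTensor.mk hπ hπ') τ =
      DiffForm.pullback (IB.prod (𝓘(ℝ, EG).prod 𝓘(ℝ, EG))) (IP.prod IP')
        (Subtype.val : FiberProduct π π' → P × P') (σ.boxSum σ')

end Tensor

end

/-! Write q for the orbit map, F for the fibre product and T for the tensor product. If e and e'
trivialize P and P' over the same open set, then (p, p') ↦ (π p, e p, e' p') trivializes F with
fibre G × G. The product e p * e' p' is unchanged by the antidiagonal action, because G is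
commutative, so [p, p'] ↦ (π p, e p * e' p') trivializes T with fibre G. The transition maps are
built from those of P and P', hence smooth. In these coordinates q is (b, g, g') ↦ (b, g g'), a
principal G-bundle. This gives both smooth structures (`PrincipalAtlas.isPrincipalBundle`,
`BundleTensor.orbit_isPrincipalBundle`).

The form descends as in symplectic reduction. Contracting σ + σ' with an antidiagonal vector field
gives -d⟨μ, ξ⟩, and μ vanishes on F. The restriction to F is therefore horizontal as well as
invariant, so it equals q^*τ for some τ (`FiberProduct.restrictedForm_horizontal`,
`IsPrincipalBundle.exists_pullback_eq`). Since q has local sections, τ is smooth and closed because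
q^*τ is. The action of a on T lifts to the action of (a, 1) on F, and there the moment map equation
for τ becomes the one for σ.

Nondegeneracy is read off from the moment map, with no dimension count
(`IsMomentMap.nondegenerate`). If v is in the radical of τ, pairing it with the vertical fields
gives dψ(dπ v) = 0. As ψ is an immersion, v is vertical, say generated by ξ. Then d⟨ψ, ξ⟩ = 0 at the
base point, and over that point of U the vector ξ_P lies in the radical of σ. Since σ is
nondegenerate and the infinitesimal action is free, ξ = 0.

For uniqueness, F is locally a smooth retract of P × P', so a map into the constructed F is smooth
as soon as it is smooth into P × P'. Hence the identity from any other admissible structure on F to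
the constructed one is smooth. It is a bijective map of principal G × G-bundles over U, so its
inverse is smooth too. Smoothness of maps out of T, and equality of forms on T, are tested after
composing with the submersion q.

The topological statements in the first part use that ψ is locally injective and that U is
Hausdorff. -/

noncomputable section

/-! ### Smooth dependence of a pulled back alternating form on the form and on the linear map. -/

section Alternatization

variable {E F : Type*} [NormedAddCommGroup E] [NormedSpace ℝ E] [NormedAddCommGroup F]
  [NormedSpace ℝ F] {k : ℕ}

/-- Permuting the vectors leaves the product of their norms unchanged, so all k! signed terms obey
the same bound. Its role is to make alternatization continuous. -/
lemma norm_alternatization_le (m : ContinuousMultilinearMap ℝ (fun _ : Fin k => E) ℝ) :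
    ‖ContinuousMultilinearMap.alternatization m‖ ≤ k.factorial * ‖m‖ := by
  refine ContinuousAlternatingMap.opNorm_le_bound _ (by positivity) fun v => ?_
  rw [ContinuousMultilinearMap.alternatization_apply_apply]
  calc ‖∑ s : Equiv.Perm (Fin k), Equiv.Perm.sign s • m (v ∘ s)‖
      ≤ ∑ s : Equiv.Perm (Fin k), ‖m‖ * ∏ i, ‖v i‖ := by
        refine norm_sum_le_of_le _ fun s _ => ?_
        have h1 : ‖Equiv.Perm.sign s • m (v ∘ s)‖ = ‖m (v ∘ s)‖ := by
          rcases Int.units_eq_one_or (Equiv.Perm.sign s) with h | h <;> simp [h]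
        rw [h1]
        refine (m.le_opNorm _).trans (le_of_eq ?_)
        congr 1
        exact Equiv.prod_comp s fun i => ‖v i‖
    _ = k.factorial * ‖m‖ * ∏ i, ‖v i‖ := by
        rw [Finset.sum_const, Finset.card_univ, Fintype.card_perm, Fintype.card_fin, nsmul_eq_mul,
          mul_assoc]

/-- Alternatization of continuous multilinear forms, as a continuous linear map. -/
def alternatizationCLM (E : Type*) [NormedAddCommGroup E] [NormedSpace ℝ E] (k : ℕ) :
    ContinuousMultilinearMap ℝ (fun _ : Fin k => E) ℝ →L[ℝ] E [⋀^Fin k]→L[ℝ] ℝ :=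
  LinearMap.mkContinuous
    { toFun := ContinuousMultilinearMap.alternatization
      map_add' := map_add _
      map_smul' := fun c m => by
        ext v
        simp only [ContinuousMultilinearMap.alternatization_apply_apply, RingHom.id_apply,
          smul_apply, ContinuousAlternatingMap.smul_apply,
          Finset.smul_sum]
        exact Finset.sum_congr rfl fun s _ => smul_comm _ _ _ }
    k.factorial norm_alternatization_le

/-- On a form that is already alternating the two signs cancel in each of the k! terms. Thus
alternatization divided by k! is a continuous linear left inverse of the inclusion of alternating
forms into multilinear ones. -/
lemma alternatizationCLM_toContinuousMultilinearMap (α : E [⋀^Fin k]→L[ℝ] ℝ) :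
    alternatizationCLM E k α.toContinuousMultilinearMap = (k.factorial : ℝ) • α := by
  ext v
  change ContinuousMultilinearMap.alternatization α.toContinuousMultilinearMap v = _
  rw [ContinuousMultilinearMap.alternatization_apply_apply]
  have h : ∀ s : Equiv.Perm (Fin k),
      Equiv.Perm.sign s • α.toContinuousMultilinearMap (v ∘ s) = α v := by
    intro s
    have h1 : α.toContinuousMultilinearMap (v ∘ s) = Equiv.Perm.sign s • α v :=
      α.toAlternatingMap.map_perm v s
    rw [h1, smul_smul, Int.units_mul_self, one_smul]
  simp only [h, Finset.sum_const, Finset.card_univ, Fintype.card_perm, Fintype.card_fin,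
    ContinuousAlternatingMap.smul_apply, nsmul_eq_mul, smul_eq_mul]

/-- Pulling back alternating forms along linear maps is a smooth operation. -/
lemma contDiffWithinAt_compContinuousLinearMap {X : Type*} [NormedAddCommGroup X]
    [NormedSpace ℝ X] {a : X → F [⋀^Fin k]→L[ℝ] ℝ} {b : X → E →L[ℝ] F} {s : Set X} {x : X}
    {r : WithTop ℕ∞} (ha : ContDiffWithinAt ℝ r a s x) (hb : ContDiffWithinAt ℝ r b s x) :
    ContDiffWithinAt ℝ r (fun y => (a y).compContinuousLinearMap (b y)) s x := by
  -- The composition is formed among multilinear forms, where it is multilinear in the linear maps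
  -- and linear in the form. Alternatization divided by k! then returns to alternating forms.
  have h1 : ContDiffWithinAt ℝ r (fun y =>
      ContinuousMultilinearMap.compContinuousLinearMapContinuousMultilinear ℝ
        (fun _ : Fin k => E) (fun _ : Fin k => F) ℝ (fun _ => b y)
        ((ContinuousAlternatingMap.toContinuousMultilinearMapCLM ℝ) (a y))) s x :=
    ((ContinuousMultilinearMap.contDiff _).comp_contDiffWithinAt
      (contDiffWithinAt_pi.2 fun _ => hb)).clm_apply
      ((ContinuousLinearMap.contDiff _).comp_contDiffWithinAt ha)
  have h2 := ((alternatizationCLM E k).contDiff.comp_contDiffWithinAt h1).const_smul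
    (k.factorial : ℝ)⁻¹
  refine h2.congr_of_eventuallyEq (Filter.Eventually.of_forall fun y => ?_) ?_
  all_goals
    refine Eq.symm (Eq.trans (congrArg ((k.factorial : ℝ)⁻¹ • ·)
      (alternatizationCLM_toContinuousMultilinearMap ((a _).compContinuousLinearMap (b _)))) ?_)
    rw [smul_smul, inv_mul_cancel₀ (by positivity), one_smul]

end Alternatization

/-! ### Pullbacks of forms, and smoothness and closedness in charts. -/

section FormLemmas

variable {E H M E' H' M' E'' H'' M'' : Type*}
  [NormedAddCommGroup E] [NormedSpace ℝ E] [TopologicalSpace H]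
  [TopologicalSpace M] [ChartedSpace H M]
  [NormedAddCommGroup E'] [NormedSpace ℝ E'] [TopologicalSpace H']
  [TopologicalSpace M'] [ChartedSpace H' M']
  [NormedAddCommGroup E''] [NormedSpace ℝ E''] [TopologicalSpace H'']
  [TopologicalSpace M''] [ChartedSpace H'' M'']
  {I : ModelWithCorners ℝ E H} {I' : ModelWithCorners ℝ E' H'} {I'' : ModelWithCorners ℝ E'' H''}
  {k : ℕ}

/-- The derivative of a map of manifolds, as a linear map between the model vector spaces. -/
def modelDeriv (I : ModelWithCorners ℝ E H) (I' : ModelWithCorners ℝ E' H') (f : M → M') (x : M) :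
    E →L[ℝ] E' :=
  mfderiv I I' f x

/-- The base point y is a separate variable with a proof of f x = y. Points that are only provably
equal, such as 1 • p and p, then need no transport between tangent spaces. -/
lemma modelDeriv_comp_apply {g : M' → M''} {f : M → M'} {x : M} {y : M'}
    (hg : MDifferentiableAt I' I'' g y) (hf : MDifferentiableAt I I' f x) (hy : f x = y) (v : E) :
    modelDeriv I I'' (g ∘ f) x v = modelDeriv I' I'' g y (modelDeriv I I' f x v) := by
  subst hy
  change mfderiv I I'' (g ∘ f) x v = _
  rw [mfderiv_comp x hg hf]
  rfl

lemma modelDeriv_congr {f g : M → M'} {x : M} (h : f =ᶠ[𝓝 x] g) :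
    modelDeriv I I' f x = modelDeriv I I' g x :=
  h.mfderiv_eq

lemma modelDeriv_id (x : M) (v : E) : modelDeriv I I id x v = v := by
  change mfderiv I I id x v = v
  rw [mfderiv_id]
  rfl

lemma modelDeriv_const (y : M') (x : M) (v : E) : modelDeriv I I' (fun _ => y) x v = 0 := by
  change mfderiv I I' (fun _ => y) x v = 0
  rw [mfderiv_const]
  rfl

lemma modelDeriv_prodMk {f : M → M'} {g : M → M''} {x : M} (hf : MDifferentiableAt I I' f x)
    (hg : MDifferentiableAt I I'' g x) (v : E) :
    modelDeriv I (I'.prod I'') (fun y => (f y, g y)) x v =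
      (modelDeriv I I' f x v, modelDeriv I I'' g x v) := by
  change mfderiv I (I'.prod I'') (fun y => (f y, g y)) x v = _
  rw [mfderiv_prodMk hf hg]
  rfl

/-- The chain rule for a map of two variables. -/
lemma modelDeriv_comp₂_apply {E₁ H₁ M₁ : Type*} [NormedAddCommGroup E₁] [NormedSpace ℝ E₁]
    [TopologicalSpace H₁] [TopologicalSpace M₁] [ChartedSpace H₁ M₁] {I₁ : ModelWithCorners ℝ E₁ H₁}
    {f : M' × M'' → M₁} {a : M → M'} {b : M → M''} {x : M} {y : M'} {z : M''}
    (hf : MDifferentiableAt (I'.prod I'') I₁ f (y, z)) (ha : MDifferentiableAt I I' a x)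
    (hb : MDifferentiableAt I I'' b x) (hy : a x = y) (hz : b x = z) (v : E) :
    modelDeriv I I₁ (fun w => f (a w, b w)) x v =
      modelDeriv I' I₁ (fun w => f (w, z)) y (modelDeriv I I' a x v) +
      modelDeriv I'' I₁ (fun w => f (y, w)) z (modelDeriv I I'' b x v) := by
  have h1 := modelDeriv_comp_apply (x := x) (g := f) hf (ha.prodMk hb) (Prod.ext hy hz) v
  rw [modelDeriv_prodMk ha hb] at h1
  exact h1.trans (mfderiv_prod_eq_add_apply hf)

namespace DiffForm

/-- The value of a form at a point, as a form on the model vector space. -/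
def toModel (α : DiffForm I M k) (x : M) : E [⋀^Fin k]→L[ℝ] ℝ := α x

/-- Values of a form at equal points agree, up to the identification of tangent spaces. -/
lemma apply_congr (α : DiffForm I M k) {x y : M} (h : x = y) {v w : Fin k → E}
    (hvw : ∀ i, v i = w i) : α.toModel x v = α.toModel y w := by
  subst h
  rw [funext hvw]

lemma pullback_apply (f : M → M') (α : DiffForm I' M' k) (x : M) (v : Fin k → TangentSpace I x) :
    pullback I I' f α x v = α (f x) (fun i => mfderiv I I' f x (v i)) := rfl

lemma toModel_pullback (f : M → M') (α : DiffForm I' M' k) (x : M) (v : Fin k → E) :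
    (pullback I I' f α).toModel x v = α.toModel (f x) (fun i => modelDeriv I I' f x (v i)) := rfl

lemma toModel_pullback_two (f : M → M') (α : DiffForm I' M' 2) (x : M) (v w : E) :
    (pullback I I' f α).toModel x ![v, w] =
      α.toModel (f x) ![modelDeriv I I' f x v, modelDeriv I I' f x w] := by
  rw [toModel_pullback]
  congr 1
  ext i
  fin_cases i <;> rfl

lemma pullback_comp_apply {f : M → M'} {g : M' → M''} {x : M}
    (hg : MDifferentiableAt I' I'' g (f x)) (hf : MDifferentiableAt I I' f x)
    (α : DiffForm I'' M'' k) :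
    pullback I I'' (g ∘ f) α x = pullback I I' f (pullback I' I'' g α) x := by
  ext v
  simp only [pullback_apply, mfderiv_comp x hg hf]
  rfl

lemma pullback_congr_map {f g : M → M'} {x : M} (h : f =ᶠ[𝓝 x] g) (α : DiffForm I' M' k) :
    pullback I I' f α x = pullback I I' g α x := by
  have h1 : ∀ v : Fin k → E,
      (pullback I I' f α).toModel x v = (pullback I I' g α).toModel x v := fun v =>
    apply_congr α h.eq_of_nhds fun i => DFunLike.congr_fun (modelDeriv_congr h) (v i)
  ext v
  exact h1 v

lemma pullback_congr_form (f : M → M') {α β : DiffForm I' M' k} {x : M} (h : α (f x) = β (f x)) :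
    pullback I I' f α x = pullback I I' f β x := by
  simp only [pullback, h]

lemma pullback_id (α : DiffForm I M k) : pullback I I id α = α := by
  funext x
  ext v
  simp only [pullback_apply, mfderiv_id]
  rfl

/-- Pullback by a map with surjective derivative is injective on forms. -/
lemma eq_of_pullback_eq {f : M → M'} {α β : DiffForm I' M' k} {x : M}
    (hf : Function.Surjective (mfderiv I I' f x))
    (h : pullback I I' f α x = pullback I I' f β x) : α (f x) = β (f x) := by
  ext v
  choose w hw using fun i => hf (v i)
  have := DFunLike.congr_fun h w
  simpa only [pullback_apply, hw] using this

lemma inChart_congr {α β : DiffForm I M k} {x₀ : M} {y : E}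
    (h : α ((extChartAt I x₀).symm y) = β ((extChartAt I x₀).symm y)) :
    α.inChart x₀ y = β.inChart x₀ y := by
  simp only [inChart, h]

/-- A form is smooth and closed near a point, as seen in all charts around the point. -/
def IsSmoothClosedAt (α : DiffForm I M k) (x : M) : Prop :=
  ∀ x₀ : M, x ∈ (extChartAt I x₀).source →
    ContDiffWithinAt ℝ ∞ (α.inChart x₀) (extChartAt I x₀).target (extChartAt I x₀ x) ∧
    extDerivWithin (α.inChart x₀) (extChartAt I x₀).target (extChartAt I x₀ x) = 0

/-- Every point of a chart target comes from a point of the chart source. This trades a condition on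
whole charts for one at single points, which depends only on the germ of the form and can be checked
on small open sets. -/
lemma isSmooth_and_isClosed_iff {α : DiffForm I M k} :
    (α.IsSmooth ∧ α.IsClosed) ↔ ∀ x, α.IsSmoothClosedAt x := by
  constructor
  · intro h x x₀ hx
    exact ⟨h.1 x₀ _ ((extChartAt I x₀).map_source hx), h.2 x₀ _ ((extChartAt I x₀).map_source hx)⟩
  · intro h
    have key : ∀ x₀ : M, ∀ y ∈ (extChartAt I x₀).target, _ := fun x₀ y hy =>
      h ((extChartAt I x₀).symm y) x₀ ((extChartAt I x₀).map_target hy)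
    refine ⟨fun x₀ y hy => ?_, fun x₀ y hy => ?_⟩
    · simpa only [(extChartAt I x₀).right_inv hy] using (key x₀ y hy).1
    · simpa only [(extChartAt I x₀).right_inv hy] using (key x₀ y hy).2

lemma tendsto_extChartAt_symm {x₀ x : M} (hx : x ∈ (extChartAt I x₀).source) :
    Filter.Tendsto (extChartAt I x₀).symm
      (𝓝[(extChartAt I x₀).target] (extChartAt I x₀ x)) (𝓝 x) := by
  have := (continuousOn_extChartAt_symm (I := I) x₀) _ ((extChartAt I x₀).map_source hx)
  simpa only [ContinuousWithinAt, (extChartAt I x₀).left_inv hx] using this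

lemma IsSmoothClosedAt.congr {α β : DiffForm I M k} {x : M} (h : α.IsSmoothClosedAt x)
    (hαβ : ∀ᶠ z in 𝓝 x, β z = α z) : β.IsSmoothClosedAt x := by
  intro x₀ hx
  have hy := (extChartAt I x₀).map_source hx
  have hev : β.inChart x₀ =ᶠ[𝓝[(extChartAt I x₀).target] (extChartAt I x₀ x)] α.inChart x₀ := by
    filter_upwards [(tendsto_extChartAt_symm hx).eventually hαβ] with y hy
    exact inChart_congr hy
  refine ⟨(h x₀ hx).1.congr_of_eventuallyEq_of_mem hev hy, ?_⟩
  rw [hev.extDerivWithin_eq_of_mem hy]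
  exact (h x₀ hx).2

lemma IsSmoothClosedAt.add {α β : DiffForm I M k} {x : M} (hα : α.IsSmoothClosedAt x)
    (hβ : β.IsSmoothClosedAt x) : IsSmoothClosedAt (fun z => α z + β z) x := by
  intro x₀ hx
  have hy := (extChartAt I x₀).map_source hx
  have hadd : inChart (fun z => α z + β z) x₀ = α.inChart x₀ + β.inChart x₀ := by
    funext y
    ext v
    rfl
  rw [hadd]
  refine ⟨(hα x₀ hx).1.add (hβ x₀ hx).1, ?_⟩
  have hne : (∞ : WithTop ℕ∞) ≠ 0 := by simp
  rw [extDerivWithin_add (uniqueDiffOn_extChartAt_target x₀ _ hy)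
    ((hα x₀ hx).1.differentiableWithinAt hne) ((hβ x₀ hx).1.differentiableWithinAt hne),
    (hα x₀ hx).2, (hβ x₀ hx).2, add_zero]

/-- In charts, the pullback of a form along a map is the pullback along the coordinate expression
of the map. -/
lemma inChart_pullback [IsManifold I ∞ M] [IsManifold I' ∞ M'] {f : M → M'} (α : DiffForm I' M' k)
    {x₀ : M} {y₀ : M'} {s : Set E} (hs : UniqueDiffOn ℝ s) (hst : s ⊆ (extChartAt I x₀).target)
    {z : E} (hz : z ∈ s) (hf : MDifferentiableAt I I' f ((extChartAt I x₀).symm z))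
    (hfs : MapsTo (f ∘ (extChartAt I x₀).symm) s (extChartAt I' y₀).source) :
    (pullback I I' f α).inChart x₀ z =
      (α.inChart y₀ ((extChartAt I' y₀ ∘ f ∘ (extChartAt I x₀).symm) z)).compContinuousLinearMap
        (fderivWithin ℝ (extChartAt I' y₀ ∘ f ∘ (extChartAt I x₀).symm) s z) := by
  have hinv : (extChartAt I' y₀).symm ((extChartAt I' y₀ ∘ f ∘ (extChartAt I x₀).symm) z) =
      f ((extChartAt I x₀).symm z) := (extChartAt I' y₀).left_inv (hfs hz)
  have hu : UniqueMDiffWithinAt 𝓘(ℝ, E) s z := (hs z hz).uniqueMDiffWithinAt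
  have hφr : MDifferentiableWithinAt 𝓘(ℝ, E) I (extChartAt I x₀).symm (range I) z :=
    mdifferentiableWithinAt_extChartAt_symm (hst hz)
  have hsr : s ⊆ range I := hst.trans (extChartAt_target_subset_range x₀)
  have hφ : MDifferentiableWithinAt 𝓘(ℝ, E) I (extChartAt I x₀).symm s z := hφr.mono hsr
  -- The derivative of f ∘ (chart)⁻¹ is computed twice: here through M, and in `h2` through the
  -- coordinate expression `F`. Equating the two gives the formula.
  have h1 : mfderivWithin 𝓘(ℝ, E) I' (f ∘ (extChartAt I x₀).symm) s z =
      (mfderiv I I' f ((extChartAt I x₀).symm z)).comp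
        (mfderivWithin 𝓘(ℝ, E) I (extChartAt I x₀).symm (range I) z) := by
    rw [mfderiv_comp_mfderivWithin z hf hφ hu, hφr.mfderivWithin_mono hu hsr]
  set F := extChartAt I' y₀ ∘ f ∘ (extChartAt I x₀).symm with hF
  have hFt : F z ∈ (extChartAt I' y₀).target := (extChartAt I' y₀).map_source (hfs hz)
  have hFd : MDifferentiableWithinAt 𝓘(ℝ, E) 𝓘(ℝ, E') F s z := by
    refine MDifferentiableAt.comp_mdifferentiableWithinAt z ?_
      (hf.comp_mdifferentiableWithinAt z hφ)
    exact mdifferentiableAt_extChartAt (by simpa using hfs hz)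
  have hmaps : MapsTo F s (range I') := fun w hw =>
    extChartAt_target_subset_range y₀ ((extChartAt I' y₀).map_source (hfs hw))
  have h2 : (mfderivWithin 𝓘(ℝ, E) I' (f ∘ (extChartAt I x₀).symm) s z : E →L[ℝ] E') =
      (mfderivWithin 𝓘(ℝ, E') I' (extChartAt I' y₀).symm (range I') (F z) : E' →L[ℝ] E').comp
        (fderivWithin ℝ F s z) := by
    have h3 : mfderivWithin 𝓘(ℝ, E) I' ((extChartAt I' y₀).symm ∘ F) s z =
      (mfderivWithin 𝓘(ℝ, E') I' (extChartAt I' y₀).symm (range I') (F z)).comp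
        (mfderivWithin 𝓘(ℝ, E) 𝓘(ℝ, E') F s z) :=
      mfderivWithin_comp z (mdifferentiableWithinAt_extChartAt_symm hFt) hFd hmaps hu
    rw [mfderivWithin_eq_fderivWithin] at h3
    refine Eq.trans ?_ h3
    refine mfderivWithin_congr (fun w hw => ?_) ?_
    · exact ((extChartAt I' y₀).left_inv (hfs hw)).symm
    · exact ((extChartAt I' y₀).left_inv (hfs hz)).symm
  ext v
  exact apply_congr α hinv.symm fun i => DFunLike.congr_fun (h1.symm.trans h2) (v i)

/-- The pullback of a smooth closed form under a smooth map is smooth and closed. -/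
lemma isSmoothClosedAt_pullback [IsManifold I ∞ M] [IsManifold I' ∞ M'] {f : M → M'}
    {α : DiffForm I' M' k} (hα : α.IsSmooth) (hα' : α.IsClosed) {V : Set M} (hV : IsOpen V)
    (hf : ContMDiffOn I I' ∞ f V) {x : M} (hx : x ∈ V) :
    (pullback I I' f α).IsSmoothClosedAt x := by
  intro x₀ hx₀
  set y := extChartAt I x₀ x with hy
  have hyt : y ∈ (extChartAt I x₀).target := (extChartAt I x₀).map_source hx₀
  set y₀ := f x with hy₀
  -- The chart target is cut down to a relatively open `s` whose points stay in V and are sent by f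
  -- into the chart domain around f x, so that `F` is smooth on `s`.
  have hV' : V ∩ f ⁻¹' (extChartAt I' y₀).source ∈ 𝓝 x :=
    Filter.inter_mem (hV.mem_nhds hx)
      ((hf.continuousOn.continuousAt (hV.mem_nhds hx)).preimage_mem_nhds
        (extChartAt_source_mem_nhds y₀))
  obtain ⟨O, hO, hyO, hOsub⟩ := mem_nhdsWithin.1 (tendsto_extChartAt_symm hx₀ hV')
  set s := (extChartAt I x₀).target ∩ O with hs
  have hys : y ∈ s := ⟨hyt, hyO⟩
  have hsu : UniqueDiffOn ℝ s := (uniqueDiffOn_extChartAt_target x₀).inter hO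
  have hsub : s ⊆ (extChartAt I x₀).target := inter_subset_left
  have hfs : MapsTo (f ∘ (extChartAt I x₀).symm) s (extChartAt I' y₀).source :=
    fun w hw => (hOsub ⟨hw.2, hw.1⟩).2
  have hsV : MapsTo (extChartAt I x₀).symm s V := fun w hw => (hOsub ⟨hw.2, hw.1⟩).1
  set F := extChartAt I' y₀ ∘ f ∘ (extChartAt I x₀).symm with hF
  have hFsm : ContDiffOn ℝ ∞ F s := by
    rw [← contMDiffOn_iff_contDiffOn]
    refine (contMDiffOn_extChartAt (I := I') (x := y₀)).comp
      (hf.comp ((contMDiffOn_extChartAt_symm x₀).mono hsub) hsV) ?_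
    intro w hw
    simpa using hfs hw
  have hFmaps : MapsTo F s (extChartAt I' y₀).target := fun w hw =>
    (extChartAt I' y₀).map_source (hfs hw)
  have heq : ∀ z ∈ s, (pullback I I' f α).inChart x₀ z =
      (α.inChart y₀ (F z)).compContinuousLinearMap (fderivWithin ℝ F s z) := by
    intro z hz
    refine inChart_pullback α hsu hsub hz ?_ hfs
    exact ((hf _ (hsV hz)).contMDiffAt (hV.mem_nhds (hsV hz))).mdifferentiableAt (by simp)
  have hnhds : 𝓝[s] y = 𝓝[(extChartAt I x₀).target] y :=
    nhdsWithin_inter_of_mem' (mem_nhdsWithin_of_mem_nhds (hO.mem_nhds hyO))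
  constructor
  · have h1 : ContDiffWithinAt ℝ ∞
        (fun z => (α.inChart y₀ (F z)).compContinuousLinearMap (fderivWithin ℝ F s z)) s y := by
      have ha : ContDiffWithinAt ℝ ∞ (fun z => α.inChart y₀ (F z)) s y :=
        ((hα y₀).comp hFsm hFmaps) y hys
      have hb : ContDiffWithinAt ℝ ∞ (fderivWithin ℝ F s) s y :=
        (hFsm.fderivWithin hsu (by simp)) y hys
      exact contDiffWithinAt_compContinuousLinearMap ha hb
    have h2 : ContDiffWithinAt ℝ ∞ ((pullback I I' f α).inChart x₀) s y :=
      h1.congr heq (heq y hys)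
    exact h2.mono_of_mem_nhdsWithin (hnhds ▸ self_mem_nhdsWithin)
  · have h1 : extDerivWithin ((pullback I I' f α).inChart x₀) s y = 0 := by
      rw [extDerivWithin_congr heq (heq y hys),
        extDerivWithin_pullback (t := (extChartAt I' y₀).target) (r := ∞)
          ((hα y₀ _ (hFmaps hys)).differentiableWithinAt (by simp)) (hFsm y hys)
          (by simpa using (WithTop.coe_le_coe.2 (le_top : (2 : ℕ∞) ≤ ⊤)))
          hsu ?_ hys hFmaps, hα' y₀ _ (hFmaps hys)]
      · ext v; rfl
      -- That d commutes with pullback rests on symmetry of the second derivative of `F`. At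
      -- boundary and corner points this comes from nearby interior points, so y must lie in the
      -- closure of the interior of `s`.
      · have hc := extChartAt_target_subset_closure_interior hyt
        rw [hs, interior_inter, hO.interior_eq]
        exact IsOpen.closure_inter hO ⟨hc, hyO⟩
    rw [extDerivWithin, ← h1, extDerivWithin]
    congr 1
    exact (fderivWithin_inter (hO.mem_nhds hyO)).symm

end DiffForm

end FormLemmas

/-! ### Components of smooth maps into products. -/

section Projections

variable {E H M E₁ H₁ M₁ E₂ H₂ M₂ : Type*}
  [NormedAddCommGroup E] [NormedSpace ℝ E] [TopologicalSpace H]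
  [TopologicalSpace M] [ChartedSpace H M]
  [NormedAddCommGroup E₁] [NormedSpace ℝ E₁] [TopologicalSpace H₁]
  [TopologicalSpace M₁] [ChartedSpace H₁ M₁]
  [NormedAddCommGroup E₂] [NormedSpace ℝ E₂] [TopologicalSpace H₂]
  [TopologicalSpace M₂] [ChartedSpace H₂ M₂]
  {I : ModelWithCorners ℝ E H} {I₁ : ModelWithCorners ℝ E₁ H₁} {I₂ : ModelWithCorners ℝ E₂ H₂}
  {n : WithTop ℕ∞} {f : M → M₁ × M₂} {s : Set M}

lemma ContMDiffOn.fst (hf : ContMDiffOn I (I₁.prod I₂) n f s) :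
    ContMDiffOn I I₁ n (fun x => (f x).1) s := fun x hx => (hf x hx).fst

lemma ContMDiffOn.snd (hf : ContMDiffOn I (I₁.prod I₂) n f s) :
    ContMDiffOn I I₂ n (fun x => (f x).2) s := fun x hx => (hf x hx).snd

end Projections

/-! ### Smooth atlases glued from local homeomorphisms with smooth transition maps. -/

section Gluing

variable {E H M Q ι : Type*} [NormedAddCommGroup E] [NormedSpace ℝ E] [TopologicalSpace H]
  {I : ModelWithCorners ℝ E H} [TopologicalSpace M] [ChartedSpace H M] [TopologicalSpace Q]

/-- The charted space structure on `Q` obtained from a covering family of local homeomorphisms to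
a charted space `M`. -/
abbrev gluedChartedSpace (H : Type*) [TopologicalSpace H] [ChartedSpace H M]
    (e : ι → OpenPartialHomeomorph Q M) (idx : Q → ι)
    (hidx : ∀ q, q ∈ (e (idx q)).source) : ChartedSpace H Q :=
  letI : ChartedSpace M Q :=
    { atlas := range e
      chartAt := fun q => e (idx q)
      mem_chart_source := hidx
      chart_mem_atlas := fun _ => mem_range_self _ }
  ChartedSpace.comp H M Q

variable (e : ι → OpenPartialHomeomorph Q M) (idx : Q → ι) (hidx : ∀ q, q ∈ (e (idx q)).source)

lemma mem_atlas_gluedChartedSpace {i : ι} {c : OpenPartialHomeomorph M H} (hc : c ∈ atlas H M) :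
    letI := gluedChartedSpace H e idx hidx
    (e i) ≫ₕ c ∈ atlas H Q :=
  ⟨e i, mem_range_self i, c, hc, rfl⟩

/-- If the transition maps are smooth, the glued charts form a smooth atlas. -/
lemma isManifold_gluedChartedSpace [IsManifold I ∞ M]
    (htrans : ∀ i j, ContMDiffOn I I ∞ (e j ∘ (e i).symm)
      ((e i).target ∩ (e i).symm ⁻¹' (e j).source)) :
    letI := gluedChartedSpace H e idx hidx
    IsManifold I ∞ Q := by
  let := gluedChartedSpace H e idx hidx
  refine isManifold_of_contDiffOn I ∞ Q ?_
  rintro _ _ ⟨_, ⟨i, rfl⟩, c, hc, rfl⟩ ⟨_, ⟨j, rfl⟩, c', hc', rfl⟩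
  set φ := (e i ≫ₕ c).symm ≫ₕ (e j ≫ₕ c') with hφ
  have hcs : ContMDiffOn I I ∞ c.symm c.target :=
    contMDiffOn_symm_of_mem_maximalAtlas (IsManifold.subset_maximalAtlas hc)
  have hcs' : ContMDiffOn I I ∞ c' c'.source :=
    contMDiffOn_of_mem_maximalAtlas (IsManifold.subset_maximalAtlas hc')
  have hsm : ContMDiffOn I I ∞ φ φ.source := by
    refine hcs'.comp ((htrans i j).comp (hcs.mono ?_) ?_) ?_
    · intro x hx
      simp only [hφ, mfld_simps] at hx
      exact hx.1.1
    · intro x hx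
      simp only [hφ, mfld_simps] at hx
      exact ⟨hx.1.2, hx.2.1⟩
    · intro x hx
      simp only [hφ, mfld_simps] at hx
      exact hx.2.2
  rw [contMDiffOn_iff] at hsm
  -- The coordinate criterion for smoothness is indexed by points of H, all with the identity as
  -- chart. If H is empty, so is E through `I.symm`, and the claim is vacuous.
  by_cases hne : Nonempty H
  · obtain ⟨x⟩ := hne
    have := hsm.2 x x
    simp only [chartAt_self_eq, mfld_simps] at this
    simpa only [hφ, mfld_simps, inter_comm] using this
  · have : IsEmpty E := ⟨fun v => hne ⟨I.symm v⟩⟩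
    intro v
    exact this.elim v

/-- Near a point, e i is c⁻¹ ∘ (e i followed by c) for a chart c of M, and e i followed by c is a
chart of Q by construction. -/
lemma contMDiffOn_gluedChartedSpace [IsManifold I ∞ M]
    (htrans : ∀ i j, ContMDiffOn I I ∞ (e j ∘ (e i).symm)
      ((e i).target ∩ (e i).symm ⁻¹' (e j).source)) (i : ι) :
    letI := gluedChartedSpace H e idx hidx
    ContMDiffOn I I ∞ (e i) (e i).source := by
  let := gluedChartedSpace H e idx hidx
  have := isManifold_gluedChartedSpace (I := I) e idx hidx htrans
  intro q hq
  set c := chartAt H (e i q) with hc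
  have hcq : e i q ∈ c.source := mem_chart_source H (e i q)
  have h1 : ContMDiffOn I I ∞ (e i ≫ₕ c) (e i ≫ₕ c).source :=
    contMDiffOn_of_mem_maximalAtlas (IsManifold.subset_maximalAtlas
      (mem_atlas_gluedChartedSpace e idx hidx (chart_mem_atlas H _)))
  have h2 : ContMDiffOn I I ∞ c.symm c.target := contMDiffOn_chart_symm
  have h3 : ContMDiffOn I I ∞ (c.symm ∘ (e i ≫ₕ c)) (e i ≫ₕ c).source :=
    h2.comp h1 fun x hx => by
      simp only [mfld_simps] at hx
      exact c.map_source hx.2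
  have hq' : q ∈ (e i ≫ₕ c).source := by simp only [mfld_simps]; exact ⟨hq, hcq⟩
  have h4 : ContMDiffOn I I ∞ (e i) (e i ≫ₕ c).source := h3.congr fun x hx => by
    simp only [mfld_simps] at hx
    simp [c.left_inv hx.2]
  exact (h4.contMDiffAt ((e i ≫ₕ c).open_source.mem_nhds hq')).contMDiffWithinAt

lemma contMDiffOn_symm_gluedChartedSpace [IsManifold I ∞ M]
    (htrans : ∀ i j, ContMDiffOn I I ∞ (e j ∘ (e i).symm)
      ((e i).target ∩ (e i).symm ⁻¹' (e j).source)) (i : ι) :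
    letI := gluedChartedSpace H e idx hidx
    ContMDiffOn I I ∞ (e i).symm (e i).target := by
  let := gluedChartedSpace H e idx hidx
  have := isManifold_gluedChartedSpace (I := I) e idx hidx htrans
  intro m hm
  set c := chartAt H m with hc
  have hcq : m ∈ c.source := mem_chart_source H m
  have h1 : ContMDiffOn I I ∞ (e i ≫ₕ c).symm (e i ≫ₕ c).target :=
    contMDiffOn_symm_of_mem_maximalAtlas (IsManifold.subset_maximalAtlas
      (mem_atlas_gluedChartedSpace e idx hidx (chart_mem_atlas H _)))
  have h2 : ContMDiffOn I I ∞ c c.source := contMDiffOn_chart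
  have h3 : ContMDiffOn I I ∞ ((e i ≫ₕ c).symm ∘ c) (c.source ∩ (e i).target) :=
    h1.comp (h2.mono inter_subset_left) fun x hx => by
      simp only [mfld_simps]
      exact ⟨c.map_source hx.1, by simpa [c.left_inv hx.1] using hx.2⟩
  have h4 : ContMDiffOn I I ∞ (e i).symm (c.source ∩ (e i).target) := h3.congr fun x hx => by
    simp [c.left_inv hx.1]
  exact (h4.contMDiffAt ((c.open_source.inter (e i).open_target).mem_nhds
    ⟨hcq, hm⟩)).contMDiffWithinAt

end Gluing

/-! ### Principal bundles built from trivializations with smooth transition maps. -/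

section PrincipalAtlas

variable {EB HB B EG HG G Q : Type*}
  [NormedAddCommGroup EB] [NormedSpace ℝ EB] [TopologicalSpace HB]
  [TopologicalSpace B] [ChartedSpace HB B]
  [NormedAddCommGroup EG] [NormedSpace ℝ EG] [TopologicalSpace HG]
  [TopologicalSpace G] [ChartedSpace HG G] [CommGroup G]
  [TopologicalSpace Q] [MulAction G Q]

/-- A smooth principal bundle atlas on `ρ : Q → B`: equivariant local trivializations around all
points of `B` whose transition maps are smooth. -/
structure PrincipalAtlas (IB : ModelWithCorners ℝ EB HB) (IG : ModelWithCorners ℝ EG HG)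
    (G : Type*) [TopologicalSpace G] [ChartedSpace HG G] [CommGroup G] [MulAction G Q]
    (ρ : Q → B) where
  triv : B → Bundle.Trivialization G ρ
  mem_baseSet : ∀ b, b ∈ (triv b).baseSet
  proj_smul : ∀ (g : G) (q : Q), ρ (g • q) = ρ q
  smul_snd : ∀ (b : B) (g : G), ∀ q ∈ (triv b).source, (triv b (g • q)).2 = g * (triv b q).2
  transition : ∀ b b', ContMDiffOn (IB.prod IG) (IB.prod IG) ∞
    (triv b' ∘ (triv b).toOpenPartialHomeomorph.symm)
    ((triv b).target ∩ (triv b).toOpenPartialHomeomorph.symm ⁻¹' (triv b').source)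

namespace PrincipalAtlas

variable {IB : ModelWithCorners ℝ EB HB} {IG : ModelWithCorners ℝ EG HG} {ρ : Q → B}
  (A : PrincipalAtlas IB IG G ρ)

/-- The smooth structure on the total space defined by a principal bundle atlas. -/
abbrev chartedSpace : ChartedSpace (ModelProd HB HG) Q :=
  gluedChartedSpace (ModelProd HB HG) (fun b => (A.triv b).toOpenPartialHomeomorph) ρ
    (fun q => (A.triv (ρ q)).mem_source.2 (A.mem_baseSet (ρ q)))

variable [IsManifold IB ∞ B] [LieGroup IG ∞ G]

lemma isManifold : letI := A.chartedSpace; IsManifold (IB.prod IG) ∞ Q :=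
  isManifold_gluedChartedSpace _ _ _ A.transition

lemma contMDiffOn_triv (b : B) : letI := A.chartedSpace
    ContMDiffOn (IB.prod IG) (IB.prod IG) ∞ (A.triv b) (A.triv b).source :=
  contMDiffOn_gluedChartedSpace (fun b => (A.triv b).toOpenPartialHomeomorph) _ _ A.transition b

lemma contMDiffOn_triv_symm (b : B) : letI := A.chartedSpace
    ContMDiffOn (IB.prod IG) (IB.prod IG) ∞ (A.triv b).toOpenPartialHomeomorph.symm
      (A.triv b).target :=
  contMDiffOn_symm_gluedChartedSpace (fun b => (A.triv b).toOpenPartialHomeomorph) _ _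
    A.transition b

/-- In a trivialization the action is left multiplication on the fibre coordinate and the projection
is the first component. Both are therefore smooth in the glued structure. -/
lemma isPrincipalBundle : letI := A.chartedSpace
    IsPrincipalBundle IG IB (IB.prod IG) G ρ := by
  let := A.chartedSpace
  refine ⟨?_, A.proj_smul, ?_, fun b => ⟨A.triv b, A.mem_baseSet b, A.contMDiffOn_triv b,
    A.contMDiffOn_triv_symm b, A.smul_snd b⟩⟩
  · rintro ⟨g₀, q₀⟩
    set t := A.triv (ρ q₀) with ht
    have hq₀ : q₀ ∈ t.source := t.mem_source.2 (A.mem_baseSet _)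
    have hN : IsOpen {x : G × Q | x.2 ∈ t.source} := t.open_source.preimage continuous_snd
    have h1 : ContMDiffOn (IG.prod (IB.prod IG)) (IB.prod IG) ∞ (fun x : G × Q => t x.2)
        {x : G × Q | x.2 ∈ t.source} :=
      (A.contMDiffOn_triv _).comp contMDiffOn_snd fun x hx => hx
    have h2 : ContMDiffOn (IG.prod (IB.prod IG)) (IB.prod IG) ∞
        (fun x : G × Q => ((t x.2).1, x.1 * (t x.2).2)) {x : G × Q | x.2 ∈ t.source} :=
      h1.fst.prodMk (contMDiffOn_fst.mul h1.snd)
    have h3 : ContMDiffOn (IG.prod (IB.prod IG)) (IB.prod IG) ∞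
        (fun x : G × Q => x.1 • x.2) {x : G × Q | x.2 ∈ t.source} := by
      refine ((A.contMDiffOn_triv_symm (ρ q₀)).comp h2 fun x hx => ?_).congr fun x hx => ?_
      · exact t.mem_target.2 (t.proj_toFun _ hx ▸ t.mem_source.1 hx)
      · have hx' : x.1 • x.2 ∈ t.source :=
          t.mem_source.2 (by rw [A.proj_smul]; exact t.mem_source.1 hx)
        have : ((t x.2).1, x.1 * (t x.2).2) = t (x.1 • x.2) := by
          refine Prod.ext ?_ (A.smul_snd _ _ _ hx).symm
          rw [t.coe_fst hx, t.coe_fst hx', A.proj_smul]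
        change x.1 • x.2 = t.toOpenPartialHomeomorph.symm ((t x.2).1, x.1 * (t x.2).2)
        rw [this]
        exact (t.toOpenPartialHomeomorph.left_inv hx').symm
    exact h3.contMDiffAt (hN.mem_nhds hq₀)
  · intro q₀
    set t := A.triv (ρ q₀) with ht
    have hq₀ : q₀ ∈ t.source := t.mem_source.2 (A.mem_baseSet _)
    have h1 : ContMDiffOn (IB.prod IG) IB ∞ ρ t.source :=
      (A.contMDiffOn_triv (ρ q₀)).fst.congr fun x hx => (t.coe_fst hx).symm
    exact h1.contMDiffAt (t.open_source.mem_nhds hq₀)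

end PrincipalAtlas

end PrincipalAtlas

/-! ### Bilinearity and antisymmetry of 2-forms. -/

section TwoForms

variable {E : Type*} [NormedAddCommGroup E] [NormedSpace ℝ E] (α : E [⋀^Fin 2]→L[ℝ] ℝ)

lemma two_form_add_left (u v w : E) : α ![u + v, w] = α ![u, w] + α ![v, w] :=
  α.toAlternatingMap.map_vecCons_add ![w] u v

lemma two_form_smul_left (c : ℝ) (u w : E) : α ![c • u, w] = c * α ![u, w] :=
  α.toAlternatingMap.map_vecCons_smul ![w] c u

lemma two_form_swap (u v : E) : α ![u, v] = -α ![v, u] := by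
  have h := α.toAlternatingMap.map_swap ![v, u] (i := 0) (j := 1) (by decide)
  have h1 : (![v, u] : Fin 2 → E) ∘ Equiv.swap (0 : Fin 2) 1 = ![u, v] := by
    ext i; fin_cases i <;> rfl
  rw [h1] at h
  exact h

lemma two_form_add_right (u v w : E) : α ![u, v + w] = α ![u, v] + α ![u, w] := by
  rw [two_form_swap, two_form_add_left, two_form_swap α v u, two_form_swap α w u]
  ring

lemma two_form_neg_left (u w : E) : α ![-u, w] = -α ![u, w] := by
  have := two_form_smul_left α (-1) u w
  simpa using this

end TwoForms

/-! ### Local slices, vertical vectors and bundle isomorphisms. -/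

section PrincipalBundle

variable {EB HB B EP HP P EG HG G : Type*}
  [NormedAddCommGroup EB] [NormedSpace ℝ EB] [TopologicalSpace HB]
  [TopologicalSpace B] [ChartedSpace HB B]
  [NormedAddCommGroup EP] [NormedSpace ℝ EP] [TopologicalSpace HP]
  [TopologicalSpace P] [ChartedSpace HP P]
  [NormedAddCommGroup EG] [NormedSpace ℝ EG] [TopologicalSpace HG]
  [TopologicalSpace G] [ChartedSpace HG G] [CommGroup G] [MulAction G P]
  {IG : ModelWithCorners ℝ EG HG} {IB : ModelWithCorners ℝ EB HB} {IP : ModelWithCorners ℝ EP HP}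
  {π : P → B}

/-- A local slice of a principal bundle through `p`: a section `s` over an open set `V` passing
through `p`, and the map `h` measuring the position in the fibre relative to the section. -/
structure LocalSlice (IG : ModelWithCorners ℝ EG HG) (IB : ModelWithCorners ℝ EB HB)
    (IP : ModelWithCorners ℝ EP HP) (G : Type*) [TopologicalSpace G] [ChartedSpace HG G]
    [CommGroup G] [MulAction G P] (π : P → B) (p : P) where
  V : Set B
  s : B → P
  h : P → G
  isOpen : IsOpen V
  mem : π p ∈ V
  smooth_s : ContMDiffOn IB IP ∞ s V
  smooth_h : ContMDiffOn IP IG ∞ h (π ⁻¹' V)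
  s_proj : s (π p) = p
  proj_s : ∀ b ∈ V, π (s b) = b
  h_smul : ∀ x, π x ∈ V → ∀ g : G, h (g • x) = g * h x
  h_smul_s : ∀ x, π x ∈ V → h x • s (π x) = x
  h_self : h p = 1

namespace IsPrincipalBundle

variable (hP : IsPrincipalBundle IG IB IP G π)
include hP

/-- In a trivialization the section through p is the one with constant fibre coordinate (e p).2.
Dividing fibre coordinates by (e p).2 gives h, which is equivariant and equals 1 at p. -/
lemma nonempty_localSlice [LieGroup IG ∞ G] (p : P) : Nonempty (LocalSlice IG IB IP G π p) := by
  obtain ⟨e, he, hs, ht, hmul⟩ := hP.locally_trivial (π p)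
  have hp : p ∈ e.source := e.mem_source.2 he
  have hsrc : e.source = π ⁻¹' e.baseSet := e.source_eq
  have hmem : ∀ b ∈ e.baseSet, (b, (e p).2) ∈ e.target := fun b hb => e.mem_target.2 hb
  have hproj : ∀ b ∈ e.baseSet, π (e.toOpenPartialHomeomorph.symm (b, (e p).2)) = b :=
    fun b hb => e.proj_symm_apply (hmem b hb)
  refine ⟨⟨e.baseSet, fun b => e.toOpenPartialHomeomorph.symm (b, (e p).2),
    fun x => (e x).2 * (e p).2⁻¹, e.open_baseSet, he, ?_, ?_, ?_, hproj, ?_, ?_, mul_inv_cancel _⟩⟩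
  · exact ht.comp (contMDiffOn_id.prodMk contMDiffOn_const) hmem
  · rw [← hsrc]
    exact (contMDiff_mul_right (a := (e p).2⁻¹)).comp_contMDiffOn hs.snd
  · rw [e.mk_proj_snd hp]
    exact e.toOpenPartialHomeomorph.left_inv hp
  · intro x hx g
    rw [hmul g x (e.mem_source.2 hx), mul_assoc]
  · intro x hx
    have hy : e.toOpenPartialHomeomorph.symm (π x, (e p).2) ∈ e.source :=
      e.mem_source.2 (by rw [hproj _ hx]; exact hx)
    have hx' : x ∈ e.source := e.mem_source.2 hx
    have hy' : ((e x).2 * (e p).2⁻¹) • e.toOpenPartialHomeomorph.symm (π x, (e p).2) ∈ e.source :=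
      e.mem_source.2 (by rw [hP.proj_smul, hproj _ hx]; exact hx)
    refine e.toOpenPartialHomeomorph.injOn hy' hx' ?_
    refine Prod.ext ?_ ?_
    · rw [e.coe_coe, e.coe_fst hy', e.coe_fst hx', hP.proj_smul, hproj _ hx]
    · rw [e.coe_coe, hmul _ _ hy, e.apply_symm_apply (hmem _ hx)]
      simp

/-- A local slice through a point. -/
def slice [LieGroup IG ∞ G] (p : P) : LocalSlice IG IB IP G π p :=
  (hP.nonempty_localSlice p).some

lemma surjective [LieGroup IG ∞ G] : Function.Surjective π := by
  intro b
  obtain ⟨e, he, -⟩ := hP.locally_trivial b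
  exact ⟨_, e.proj_symm_apply' (x := 1) he⟩

lemma mdifferentiableAt_smul (x : G × P) :
    MDifferentiableAt (IG.prod IP) IP (fun x : G × P => x.1 • x.2) x :=
  (hP.smul_smooth x).mdifferentiableAt (by simp)

lemma mdifferentiableAt_proj (p : P) : MDifferentiableAt IP IB π p :=
  (hP.proj_smooth p).mdifferentiableAt (by simp)

lemma contMDiff_const_smul (g : G) : ContMDiff IP IP ∞ (fun x : P => g • x) :=
  hP.smul_smooth.comp (contMDiff_const.prodMk contMDiff_id)

lemma mdifferentiableAt_const_smul (g : G) (p : P) :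
    MDifferentiableAt IP IP (fun x : P => g • x) p :=
  (hP.contMDiff_const_smul g p).mdifferentiableAt (by simp)

lemma contMDiff_smul_const (p : P) : ContMDiff IG IP ∞ (fun g : G => g • p) :=
  hP.smul_smooth.comp (contMDiff_id.prodMk contMDiff_const)

lemma mdifferentiableAt_smul_const (p : P) (g : G) :
    MDifferentiableAt IG IP (fun g : G => g • p) g :=
  (hP.contMDiff_smul_const p g).mdifferentiableAt (by simp)

/-- The action on the total space is transitive on fibres. -/
lemma exists_smul_eq [LieGroup IG ∞ G] {p q : P} (h : π p = π q) : ∃ g : G, g • p = q := by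
  let S := hP.slice p
  refine ⟨S.h q, ?_⟩
  have h1 := S.h_smul_s q (by rw [← h]; exact S.mem)
  rwa [← h, S.s_proj] at h1

omit hP in
lemma _root_.LocalSlice.mdifferentiableAt_s {p : P} (S : LocalSlice IG IB IP G π p) {b : B}
    (hb : b ∈ S.V) : MDifferentiableAt IB IP S.s b :=
  (S.smooth_s.contMDiffAt (S.isOpen.mem_nhds hb)).mdifferentiableAt (by simp)

lemma isOpen_preimage_slice {p : P} (S : LocalSlice IG IB IP G π p) : IsOpen (π ⁻¹' S.V) :=
  S.isOpen.preimage hP.proj_smooth.continuous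

lemma mdifferentiableAt_slice_h {p : P} (S : LocalSlice IG IB IP G π p) {x : P}
    (hx : π x ∈ S.V) : MDifferentiableAt IP IG S.h x :=
  (S.smooth_h.contMDiffAt ((hP.isOpen_preimage_slice S).mem_nhds hx)).mdifferentiableAt (by simp)

lemma mfderiv_proj_mfderiv_slice {p : P} (S : LocalSlice IG IB IP G π p) (v : EB) :
    (modelDeriv IP IB π p) ((modelDeriv IB IP S.s (π p)) v) = v := by
  have h1 := modelDeriv_comp_apply (hP.mdifferentiableAt_proj p)
    (S.mdifferentiableAt_s S.mem) S.s_proj v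
  rw [← h1]
  have h2 : (π ∘ S.s) =ᶠ[𝓝 (π p)] id := by
    filter_upwards [S.isOpen.mem_nhds S.mem] with b hb using S.proj_s b hb
  rw [modelDeriv_congr h2, modelDeriv_id]

/-- The projection of a principal bundle is a submersion. -/
lemma mfderiv_proj_surjective [LieGroup IG ∞ G] (p : P) :
    Function.Surjective (modelDeriv IP IB π p) :=
  fun v => ⟨_, hP.mfderiv_proj_mfderiv_slice (hP.slice p) v⟩

/-- Decomposition of a tangent vector into a vertical vector and a vector tangent to the slice. -/
lemma vertical_add_slice {p : P} (S : LocalSlice IG IB IP G π p) (v : EP) :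
    v = (modelDeriv IG IP (fun g : G => g • p) 1)
        ((modelDeriv IP IG S.h p) v) +
      (modelDeriv IB IP S.s (π p)) ((modelDeriv IP IB π p) v) := by
  have hs := S.mdifferentiableAt_s S.mem
  have hh := hP.mdifferentiableAt_slice_h S S.mem
  have hπ := hP.mdifferentiableAt_proj p
  -- The identity h(x) • s(π x) = x is differentiated at p. Since h p = 1 and s(π p) = p, the two
  -- partial maps are g ↦ g • p and w ↦ 1 • w.
  have h1 := modelDeriv_comp₂_apply (f := fun x : G × P => x.1 • x.2) (a := S.h) (b := S.s ∘ π)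
    (hP.mdifferentiableAt_smul ((1 : G), p)) hh (hs.comp p hπ) S.h_self S.s_proj v
  have h2 : (fun w => S.h w • (S.s ∘ π) w) =ᶠ[𝓝 p] id := by
    filter_upwards [(hP.isOpen_preimage_slice S).mem_nhds S.mem] with x hx using S.h_smul_s x hx
  have h4 : (fun w : P => (1 : G) • w) = id := funext fun w => one_smul G w
  change modelDeriv IP IP (fun w => S.h w • (S.s ∘ π) w) p v = _ +
    modelDeriv IP IP (fun w : P => (1 : G) • w) p (modelDeriv IP IP (S.s ∘ π) p v) at h1
  rw [modelDeriv_congr h2, modelDeriv_id, h4, modelDeriv_id,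
    modelDeriv_comp_apply hs hπ rfl] at h1
  exact h1

/-- The kernel of the derivative of the projection consists of vertical vectors. -/
lemma exists_vertical [LieGroup IG ∞ G] {p : P} {v : EP}
    (hv : (modelDeriv IP IB π p) v = 0) :
    ∃ ξ : EG, (modelDeriv IG IP (fun g : G => g • p) 1) ξ = v := by
  have h := hP.vertical_add_slice (hP.slice p) v
  rw [hv, map_zero, add_zero] at h
  exact ⟨_, h.symm⟩

/-- The infinitesimal action is free. -/
lemma injective_vertical [LieGroup IG ∞ G] (p : P) :
    Function.Injective (modelDeriv IG IP (fun g : G => g • p) 1) := by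
  let S := hP.slice p
  -- Since h(g • p) = g, the derivative of h is a left inverse of the derivative of the orbit map.
  have h1 : ∀ ξ : EG, (modelDeriv IP IG S.h p)
      ((modelDeriv IG IP (fun g : G => g • p) 1) ξ) = ξ := by
    intro ξ
    rw [← modelDeriv_comp_apply (hP.mdifferentiableAt_slice_h S S.mem)
      (hP.mdifferentiableAt_smul_const p 1) (one_smul G p) ξ]
    have : S.h ∘ (fun g : G => g • p) = id := funext fun g => by
      change S.h (g • p) = g
      rw [S.h_smul p S.mem, S.h_self, mul_one]
    rw [this, modelDeriv_id]
  exact Function.LeftInverse.injective h1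

end IsPrincipalBundle

/-- The inverse of a smooth isomorphism of principal bundles over the same base is smooth. -/
lemma contMDiff_inverse_bundleMap {EP' HP' P' : Type*} [NormedAddCommGroup EP']
    [NormedSpace ℝ EP'] [TopologicalSpace HP'] [TopologicalSpace P'] [ChartedSpace HP' P']
    [MulAction G P'] {IP' : ModelWithCorners ℝ EP' HP'} {π' : P' → B} [LieGroup IG ∞ G]
    (hP : IsPrincipalBundle IG IB IP G π) (hP' : IsPrincipalBundle IG IB IP' G π')
    {f : P → P'} {k : P' → P} (hf : ContMDiff IP IP' ∞ f) (hfπ : ∀ p, π' (f p) = π p)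
    (hfg : ∀ (g : G) (p : P), f (g • p) = g • f p) (hfk : ∀ y, f (k y) = y) :
    ContMDiff IP' IP ∞ k := by
  intro y₀
  have hkπ : ∀ y, π (k y) = π' y := fun y => by rw [← hfπ, hfk]
  let S := hP.slice (k y₀)
  let S' := hP'.slice y₀
  have hO : IsOpen (π' ⁻¹' (S.V ∩ S'.V)) :=
    (S.isOpen.inter S'.isOpen).preimage hP'.proj_smooth.continuous
  have h1 : ContMDiffOn IP' IP ∞ (S.s ∘ π') (π' ⁻¹' (S.V ∩ S'.V)) :=
    S.smooth_s.comp hP'.proj_smooth.contMDiffOn fun y hy => hy.1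
  have h2 : ContMDiffOn IP' IG ∞ (fun y => S'.h (f (S.s (π' y)))) (π' ⁻¹' (S.V ∩ S'.V)) := by
    refine S'.smooth_h.comp (hf.comp_contMDiffOn h1) fun y hy => ?_
    change π' (f (S.s (π' y))) ∈ S'.V
    rw [hfπ, S.proj_s _ hy.1]
    exact hy.2
  -- Write k y = g • s(π' y). Applying f gives y = g • f(s(π' y)), so g is the quotient of the
  -- values of `S'.h` at y and at f(s(π' y)). This expresses k through maps already known to be
  -- smooth.
  have h3 : ContMDiffOn IP' IP ∞
      (fun y => (S'.h y * (S'.h (f (S.s (π' y))))⁻¹) • S.s (π' y)) (π' ⁻¹' (S.V ∩ S'.V)) :=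
    hP.smul_smooth.comp_contMDiffOn
      (((S'.smooth_h.mono fun y hy => hy.2).mul h2.inv).prodMk h1)
  have h4 : ContMDiffOn IP' IP ∞ k (π' ⁻¹' (S.V ∩ S'.V)) := by
    refine h3.congr fun y hy => ?_
    have hy1 : π (k y) ∈ S.V := by rw [hkπ]; exact hy.1
    have e1 := S.h_smul_s (k y) hy1
    rw [hkπ] at e1
    have e2 : S'.h y = S.h (k y) * S'.h (f (S.s (π' y))) := by
      rw [← S'.h_smul, ← hfg, e1, hfk]
      rw [hfπ, S.proj_s _ hy.1]
      exact hy.2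
    rw [e2, mul_inv_cancel_right, e1]
  exact h4.contMDiffAt (hO.mem_nhds ⟨by rw [← hkπ]; exact S.mem, S'.mem⟩)

end PrincipalBundle

/-! ### Descent of basic 2-forms to the base. -/

section BasicForms

variable {EB HB B EP HP P EG G : Type*}
  [NormedAddCommGroup EB] [NormedSpace ℝ EB] [TopologicalSpace HB]
  [TopologicalSpace B] [ChartedSpace HB B]
  [NormedAddCommGroup EP] [NormedSpace ℝ EP] [TopologicalSpace HP]
  [TopologicalSpace P] [ChartedSpace HP P]
  [NormedAddCommGroup EG] [NormedSpace ℝ EG]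
  [TopologicalSpace G] [ChartedSpace EG G] [CommGroup G] [MulAction G P]
  {IB : ModelWithCorners ℝ EB HB} {IP : ModelWithCorners ℝ EP HP} {π : P → B}

/-- An invariant horizontal 2-form on a principal bundle is the pullback of a form on the base. -/
lemma IsPrincipalBundle.exists_pullback_eq [LieGroup 𝓘(ℝ, EG) ∞ G]
    (hP : IsPrincipalBundle 𝓘(ℝ, EG) IB IP G π) {β : DiffForm IP P 2}
    (hinv : ∀ g : G, DiffForm.pullback IP IP (fun x : P => g • x) β = β)
    (hhor : ∀ (ξ : EG) (p : P) (v : TangentSpace IP p),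
      β p ![inducedVectorField IP G ξ p, v] = 0) :
    ∃ τ : DiffForm IB B 2, DiffForm.pullback IP IB π τ = β := by
  -- The form τ is defined point by point, along a slice through an arbitrary point of each fibre.
  -- Its smoothness is a separate matter, deduced later from that of its pullback.
  let r : B → P := Function.surjInv hP.surjective
  have hr : ∀ b, π (r b) = b := Function.surjInv_eq hP.surjective
  let τ : DiffForm IB B 2 := fun b => DiffForm.pullback IB IP (hP.slice (r b)).s β b
  refine ⟨τ, ?_⟩
  have hbase : ∀ b, DiffForm.pullback IP IB π τ (r b) = β (r b) := by
    intro b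
    have hτ : τ b = DiffForm.pullback IB IP (hP.slice (r b)).s β b := rfl
    -- The chosen point is generalized to p, so that b can be replaced by π p throughout.
    obtain ⟨p, hp⟩ : ∃ p, p = r b := ⟨_, rfl⟩
    have hb : b = π p := by rw [hp, hr]
    rw [← hp] at hτ ⊢
    subst hb
    set S := hP.slice p
    ext v
    obtain ⟨u, w, rfl⟩ : ∃ u w : EP, v = ![u, w] := ⟨v 0, v 1, by ext i; fin_cases i <;> rfl⟩
    change (DiffForm.pullback IP IB π τ).toModel p ![u, w] = β.toModel p ![u, w]
    have hτ' : τ.toModel (π p) = (DiffForm.pullback IB IP S.s β).toModel (π p) := hτ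
    rw [DiffForm.toModel_pullback_two, hτ', DiffForm.toModel_pullback_two]
    have hu := hP.vertical_add_slice S u
    have hw := hP.vertical_add_slice S w
    set u' := modelDeriv IB IP S.s (π p) (modelDeriv IP IB π p u)
    set w' := modelDeriv IB IP S.s (π p) (modelDeriv IP IB π p w)
    set a := modelDeriv IP 𝓘(ℝ, EG) S.h p u
    set c := modelDeriv IP 𝓘(ℝ, EG) S.h p w
    have hhor' : ∀ (ξ : EG) (v : EP), β.toModel p
      ![modelDeriv 𝓘(ℝ, EG) IP (fun g : G => g • p) 1 ξ, v] = 0 := fun ξ v => hhor ξ p v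
    -- Both vectors split into a vertical part and a part tangent to the slice, and β kills the
    -- vertical parts.
    have e1 : β.toModel p ![u, w] = β.toModel p ![u', w'] := by
      rw [hu, two_form_add_left, hhor', zero_add, hw, two_form_add_right, two_form_swap, hhor',
        neg_zero, zero_add]
    rw [e1]
    refine DiffForm.apply_congr β S.s_proj fun i => ?_
    fin_cases i <;> rfl
  funext p
  -- Some g moves p to the chosen point of its fibre. Both forms are invariant under g, so equality
  -- there gives equality at p.
  obtain ⟨g, hg⟩ := hP.exists_smul_eq (p := p) (q := r (π p)) (hr _).symm
  have h1 : DiffForm.pullback IP IP (fun x : P => g • x) (DiffForm.pullback IP IB π τ) p =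
      DiffForm.pullback IP IB π τ p := by
    rw [← DiffForm.pullback_comp_apply (hP.mdifferentiableAt_proj _)
      (hP.mdifferentiableAt_const_smul g p)]
    congr 1
    exact funext fun x => hP.proj_smul g x
  rw [← h1, ← congrFun (hinv g) p]
  refine DiffForm.pullback_congr_form _ ?_
  rw [hg]
  exact hbase (π p)

end BasicForms

/-! ### A chosen smooth trivialization around each point of the base. -/

section ChosenTrivialization

variable {EB HB B EP HP P EG HG G : Type*}
  [NormedAddCommGroup EB] [NormedSpace ℝ EB] [TopologicalSpace HB]
  [TopologicalSpace B] [ChartedSpace HB B]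
  [NormedAddCommGroup EP] [NormedSpace ℝ EP] [TopologicalSpace HP]
  [TopologicalSpace P] [ChartedSpace HP P]
  [NormedAddCommGroup EG] [NormedSpace ℝ EG] [TopologicalSpace HG]
  [TopologicalSpace G] [ChartedSpace HG G] [CommGroup G] [MulAction G P]
  {IG : ModelWithCorners ℝ EG HG} {IB : ModelWithCorners ℝ EB HB} {IP : ModelWithCorners ℝ EP HP}
  {π : P → B}

namespace IsPrincipalBundle

variable (hP : IsPrincipalBundle IG IB IP G π)

/-- A smooth equivariant local trivialization around a point. -/
def triv (b : B) : Bundle.Trivialization G π := (hP.locally_trivial b).choose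

lemma mem_baseSet_triv (b : B) : b ∈ (hP.triv b).baseSet :=
  (hP.locally_trivial b).choose_spec.1

lemma contMDiffOn_triv (b : B) :
    ContMDiffOn IP (IB.prod IG) ∞ (hP.triv b) (hP.triv b).source :=
  (hP.locally_trivial b).choose_spec.2.1

lemma contMDiffOn_triv_symm (b : B) :
    ContMDiffOn (IB.prod IG) IP ∞ (hP.triv b).toOpenPartialHomeomorph.symm (hP.triv b).target :=
  (hP.locally_trivial b).choose_spec.2.2.1

lemma triv_smul (b : B) (g : G) {p : P} (hp : p ∈ (hP.triv b).source) :
    (hP.triv b (g • p)).2 = g * (hP.triv b p).2 :=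
  (hP.locally_trivial b).choose_spec.2.2.2 g p hp

lemma contMDiffOn_triv_snd (b : B) :
    ContMDiffOn IP IG ∞ (fun p => (hP.triv b p).2) (π ⁻¹' (hP.triv b).baseSet) := by
  rw [← (hP.triv b).source_eq]
  exact (hP.contMDiffOn_triv b).snd

end IsPrincipalBundle

end ChosenTrivialization

/-! ### Topological trivializations of the fibre product. -/

section FiberTriv

variable {B P P' G : Type*} [TopologicalSpace B] [TopologicalSpace P] [TopologicalSpace P']
  [TopologicalSpace G] {ρ : P → B} {ρ' : P' → B}

namespace Bundle.Trivialization

variable (e : Trivialization G ρ) (e' : Trivialization G ρ')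

open Classical in
/-- The inverse of the trivialization `(p, p') ↦ (ρ p, e p, e' p')` of the fibre product, extended
by a constant. -/
def fiberInv (x₀ : FiberProduct ρ ρ') (y : B × G × G) : FiberProduct ρ ρ' :=
  if h : y.1 ∈ e.baseSet ∩ e'.baseSet then
    ⟨(e.toOpenPartialHomeomorph.symm (y.1, y.2.1), e'.toOpenPartialHomeomorph.symm (y.1, y.2.2)), by
      rw [e.proj_symm_apply' h.1, e'.proj_symm_apply' h.2]⟩
  else x₀

variable {e e'}

lemma fiberInv_val (x₀ : FiberProduct ρ ρ') {y : B × G × G} (h : y.1 ∈ e.baseSet ∩ e'.baseSet) :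
    (e.fiberInv e' x₀ y).1 = (e.toOpenPartialHomeomorph.symm (y.1, y.2.1),
      e'.toOpenPartialHomeomorph.symm (y.1, y.2.2)) := by
  rw [fiberInv, dif_pos h]

lemma proj_fiberInv (x₀ : FiberProduct ρ ρ') {y : B × G × G} (h : y.1 ∈ e.baseSet ∩ e'.baseSet) :
    ρ (e.fiberInv e' x₀ y).1.1 = y.1 := by
  rw [fiberInv_val x₀ h]
  exact e.proj_symm_apply' h.1

lemma fst_fiberInv (x₀ : FiberProduct ρ ρ') {y : B × G × G} (h : y.1 ∈ e.baseSet ∩ e'.baseSet) :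
    (e (e.fiberInv e' x₀ y).1.1).2 = y.2.1 := by
  rw [fiberInv_val x₀ h]
  change (e (e.toOpenPartialHomeomorph.symm (y.1, y.2.1))).2 = y.2.1
  rw [e.apply_symm_apply' h.1]

lemma snd_fiberInv (x₀ : FiberProduct ρ ρ') {y : B × G × G} (h : y.1 ∈ e.baseSet ∩ e'.baseSet) :
    (e' (e.fiberInv e' x₀ y).1.2).2 = y.2.2 := by
  rw [fiberInv_val x₀ h]
  change (e' (e'.toOpenPartialHomeomorph.symm (y.1, y.2.2))).2 = y.2.2
  rw [e'.apply_symm_apply' h.2]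

lemma fiberInv_apply (x₀ x : FiberProduct ρ ρ') (h : ρ x.1.1 ∈ e.baseSet ∩ e'.baseSet) :
    e.fiberInv e' x₀ (ρ x.1.1, (e x.1.1).2, (e' x.1.2).2) = x := by
  refine Subtype.ext ?_
  rw [fiberInv_val x₀ h]
  have h' : ρ' x.1.2 ∈ e'.baseSet := x.2 ▸ h.2
  refine Prod.ext ?_ ?_
  · exact e.symm_apply_mk_proj (e.mem_source.2 h.1)
  · change e'.toOpenPartialHomeomorph.symm (ρ x.1.1, (e' x.1.2).2) = x.1.2
    rw [x.2]
    exact e'.symm_apply_mk_proj (e'.mem_source.2 h')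

lemma continuousOn_fiberInv (x₀ : FiberProduct ρ ρ') :
    ContinuousOn (e.fiberInv e' x₀) ((e.baseSet ∩ e'.baseSet) ×ˢ univ) := by
  refine (IsInducing.subtypeVal (t := {x : P × P' | ρ x.1 = ρ' x.2})).continuousOn_iff.2 ?_
  have h1 : ContinuousOn (fun y : B × G × G => e.toOpenPartialHomeomorph.symm (y.1, y.2.1))
      ((e.baseSet ∩ e'.baseSet) ×ˢ univ) :=
    e.toOpenPartialHomeomorph.continuousOn_symm.comp (by fun_prop)
      fun y hy => e.mem_target.2 hy.1.1
  have h2 : ContinuousOn (fun y : B × G × G => e'.toOpenPartialHomeomorph.symm (y.1, y.2.2))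
      ((e.baseSet ∩ e'.baseSet) ×ˢ univ) :=
    e'.toOpenPartialHomeomorph.continuousOn_symm.comp (by fun_prop)
      fun y hy => e'.mem_target.2 hy.1.2
  exact (h1.prodMk h2).congr fun y hy => fiberInv_val x₀ hy.1

lemma continuousOn_snd_fst :
    ContinuousOn (fun x : FiberProduct ρ ρ' => (e x.1.1).2)
      {x | ρ x.1.1 ∈ e.baseSet ∩ e'.baseSet} :=
  continuous_snd.comp_continuousOn (e.continuousOn_toFun.comp
    (continuous_fst.comp continuous_subtype_val).continuousOn fun _ hx => e.mem_source.2 hx.1)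

lemma continuousOn_snd_snd :
    ContinuousOn (fun x : FiberProduct ρ ρ' => (e' x.1.2).2)
      {x | ρ x.1.1 ∈ e.baseSet ∩ e'.baseSet} :=
  continuous_snd.comp_continuousOn (e'.continuousOn_toFun.comp
    (continuous_snd.comp continuous_subtype_val).continuousOn
    fun x hx => e'.mem_source.2 (x.2 ▸ hx.2))

variable (e e')

/-- The trivialization `(p, p') ↦ (ρ p, e p, e' p')` of the fibre product. -/
def fiberProd (hρ : Continuous ρ) (x₀ : FiberProduct ρ ρ') :
    Trivialization (G × G) (fun x : FiberProduct ρ ρ' => ρ x.1.1) where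
  toFun x := (ρ x.1.1, (e x.1.1).2, (e' x.1.2).2)
  invFun := e.fiberInv e' x₀
  source := {x | ρ x.1.1 ∈ e.baseSet ∩ e'.baseSet}
  target := (e.baseSet ∩ e'.baseSet) ×ˢ univ
  map_source' x hx := ⟨hx, mem_univ _⟩
  map_target' y hy := by
    change ρ (e.fiberInv e' x₀ y).1.1 ∈ e.baseSet ∩ e'.baseSet
    rw [proj_fiberInv x₀ hy.1]
    exact hy.1
  left_inv' x hx := fiberInv_apply x₀ x hx
  right_inv' y hy := by
    rw [proj_fiberInv x₀ hy.1, fst_fiberInv x₀ hy.1, snd_fiberInv x₀ hy.1]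
  open_source := (e.open_baseSet.inter e'.open_baseSet).preimage
    (hρ.comp (continuous_fst.comp continuous_subtype_val))
  open_target := (e.open_baseSet.inter e'.open_baseSet).prod isOpen_univ
  continuousOn_toFun := ((hρ.comp (continuous_fst.comp continuous_subtype_val)).continuousOn).prodMk
    (continuousOn_snd_fst.prodMk continuousOn_snd_snd)
  continuousOn_invFun := continuousOn_fiberInv x₀
  baseSet := e.baseSet ∩ e'.baseSet
  open_baseSet := e.open_baseSet.inter e'.open_baseSet
  source_eq := rfl
  target_eq := rfl
  proj_toFun _ _ := rfl

end Bundle.Trivialization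

end FiberTriv

/-! ### The fibre product as a principal G × G-bundle immersed in P × P'. -/

section FiberProductManifold

variable {EB HB B EP HP P EP' HP' P' EG G : Type*}
  [NormedAddCommGroup EB] [NormedSpace ℝ EB] [TopologicalSpace HB]
  [TopologicalSpace B] [ChartedSpace HB B]
  [NormedAddCommGroup EP] [NormedSpace ℝ EP] [TopologicalSpace HP]
  [TopologicalSpace P] [ChartedSpace HP P]
  [NormedAddCommGroup EP'] [NormedSpace ℝ EP'] [TopologicalSpace HP']
  [TopologicalSpace P'] [ChartedSpace HP' P']
  [NormedAddCommGroup EG] [NormedSpace ℝ EG]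
  [TopologicalSpace G] [ChartedSpace EG G] [CommGroup G] [MulAction G P] [MulAction G P']
  {IB : ModelWithCorners ℝ EB HB} {IP : ModelWithCorners ℝ EP HP} {IP' : ModelWithCorners ℝ EP' HP'}
  {π : P → B} {π' : P' → B}
  (hP : IsPrincipalBundle 𝓘(ℝ, EG) IB IP G π) (hP' : IsPrincipalBundle 𝓘(ℝ, EG) IB IP' G π')

namespace FiberProduct

/-- A point in the fibre product over a given point. -/
def basePoint (b : B) : FiberProduct π π' :=
  ⟨((hP.triv b).toOpenPartialHomeomorph.symm (b, 1),
    (hP'.triv b).toOpenPartialHomeomorph.symm (b, 1)), by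
    rw [(hP.triv b).proj_symm_apply' (hP.mem_baseSet_triv b),
      (hP'.triv b).proj_symm_apply' (hP'.mem_baseSet_triv b)]⟩

/-- These are the transition functions of P, written on B × G × G. The fibre product uses them
directly, and the tensor product after (b, g) ↦ (b, g, 1). -/
lemma contMDiffOn_triv_fiberInv_fst (b b' : B) :
    ContMDiffOn (IB.prod (𝓘(ℝ, EG).prod 𝓘(ℝ, EG))) 𝓘(ℝ, EG) ∞
      (fun y : B × G × G => ((hP.triv b')
        ((hP.triv b).toOpenPartialHomeomorph.symm (y.1, y.2.1))).2)
      {y | y.1 ∈ (hP.triv b).baseSet ∧ y.1 ∈ (hP.triv b').baseSet} := by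
  have h1 : ContMDiffOn (IB.prod (𝓘(ℝ, EG).prod 𝓘(ℝ, EG))) IP ∞
      (fun y : B × G × G => (hP.triv b).toOpenPartialHomeomorph.symm (y.1, y.2.1))
      {y | y.1 ∈ (hP.triv b).baseSet ∧ y.1 ∈ (hP.triv b').baseSet} :=
    (hP.contMDiffOn_triv_symm b).comp (contMDiff_fst.prodMk (contMDiff_fst.comp contMDiff_snd)).contMDiffOn
      fun y hy => (hP.triv b).mem_target.2 hy.1
  refine (hP.contMDiffOn_triv_snd b').comp h1 fun y hy => ?_
  change π ((hP.triv b).toOpenPartialHomeomorph.symm (y.1, y.2.1)) ∈ (hP.triv b').baseSet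
  rw [(hP.triv b).proj_symm_apply' hy.1]
  exact hy.2

lemma contMDiffOn_triv_fiberInv_snd (b b' : B) :
    ContMDiffOn (IB.prod (𝓘(ℝ, EG).prod 𝓘(ℝ, EG))) 𝓘(ℝ, EG) ∞
      (fun y : B × G × G => ((hP'.triv b')
        ((hP'.triv b).toOpenPartialHomeomorph.symm (y.1, y.2.2))).2)
      {y | y.1 ∈ (hP'.triv b).baseSet ∧ y.1 ∈ (hP'.triv b').baseSet} := by
  have h1 : ContMDiffOn (IB.prod (𝓘(ℝ, EG).prod 𝓘(ℝ, EG))) IP' ∞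
      (fun y : B × G × G => (hP'.triv b).toOpenPartialHomeomorph.symm (y.1, y.2.2))
      {y | y.1 ∈ (hP'.triv b).baseSet ∧ y.1 ∈ (hP'.triv b').baseSet} :=
    (hP'.contMDiffOn_triv_symm b).comp (contMDiff_fst.prodMk (contMDiff_snd.comp contMDiff_snd)).contMDiffOn
      fun y hy => (hP'.triv b).mem_target.2 hy.1
  refine (hP'.contMDiffOn_triv_snd b').comp h1 fun y hy => ?_
  change π' ((hP'.triv b).toOpenPartialHomeomorph.symm (y.1, y.2.2)) ∈ (hP'.triv b').baseSet
  rw [(hP'.triv b).proj_symm_apply' hy.1]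
  exact hy.2

/-- The principal bundle atlas of the fibre product. -/
def atlas : letI := fiberProductAction hP.proj_smul hP'.proj_smul
    PrincipalAtlas IB (𝓘(ℝ, EG).prod 𝓘(ℝ, EG)) (G × G) (fun x : FiberProduct π π' => π x.1.1) :=
  letI := fiberProductAction hP.proj_smul hP'.proj_smul
  { triv := fun b => (hP.triv b).fiberProd (hP'.triv b) hP.proj_smooth.continuous
      (basePoint hP hP' b)
    mem_baseSet := fun b => ⟨hP.mem_baseSet_triv b, hP'.mem_baseSet_triv b⟩
    proj_smul := fun g q => hP.proj_smul g.1 q.1.1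
    smul_snd := fun b g q hq => Prod.ext
      (hP.triv_smul b g.1 ((hP.triv b).mem_source.2 hq.1))
      (hP'.triv_smul b g.2 ((hP'.triv b).mem_source.2 (by rw [← q.2]; exact hq.2)))
    transition := fun b b' => by
      have hsub : ∀ y ∈ (((hP.triv b).fiberProd (hP'.triv b) hP.proj_smooth.continuous
          (basePoint hP hP' b)).target ∩ ((hP.triv b).fiberProd (hP'.triv b)
          hP.proj_smooth.continuous (basePoint hP hP' b)).toOpenPartialHomeomorph.symm ⁻¹'
          ((hP.triv b').fiberProd (hP'.triv b') hP.proj_smooth.continuous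
          (basePoint hP hP' b')).source),
          y.1 ∈ (hP.triv b).baseSet ∩ (hP'.triv b).baseSet ∧
          y.1 ∈ (hP.triv b').baseSet ∩ (hP'.triv b').baseSet := by
        rintro y ⟨hy, hy'⟩
        refine ⟨hy.1, ?_⟩
        change π ((hP.triv b).fiberInv (hP'.triv b) (basePoint hP hP' b) y).1.1 ∈
          (hP.triv b').baseSet ∩ (hP'.triv b').baseSet at hy'
        rwa [Bundle.Trivialization.proj_fiberInv _ hy.1] at hy'
      refine ContMDiffOn.congr (contMDiffOn_fst.prodMk
        (((contMDiffOn_triv_fiberInv_fst hP b b').mono fun y hy => ?_).prodMk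
        ((contMDiffOn_triv_fiberInv_snd hP' b b').mono fun y hy => ?_))) fun y hy => ?_
      · exact ⟨(hsub y hy).1.1, (hsub y hy).2.1⟩
      · exact ⟨(hsub y hy).1.2, (hsub y hy).2.2⟩
      · have h := (hsub y hy).1
        change (π ((hP.triv b).fiberInv (hP'.triv b) (basePoint hP hP' b) y).1.1,
          (hP.triv b' ((hP.triv b).fiberInv (hP'.triv b) (basePoint hP hP' b) y).1.1).2,
          (hP'.triv b' ((hP.triv b).fiberInv (hP'.triv b) (basePoint hP hP' b) y).1.2).2) = _
        rw [Bundle.Trivialization.proj_fiberInv _ h, Bundle.Trivialization.fiberInv_val _ h] }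

/-- The smooth structure of the fibre product. -/
abbrev chartedSpace : ChartedSpace (ModelProd HB (ModelProd EG EG)) (FiberProduct π π') :=
  letI := fiberProductAction hP.proj_smul hP'.proj_smul
  (atlas hP hP').chartedSpace

lemma isOpen_source (b : B) :
    IsOpen {x : FiberProduct π π' | π x.1.1 ∈ (hP.triv b).baseSet ∩ (hP'.triv b).baseSet} :=
  ((hP.triv b).open_baseSet.inter (hP'.triv b).open_baseSet).preimage
    (hP.proj_smooth.continuous.comp (continuous_fst.comp continuous_subtype_val))

variable [IsManifold IB ∞ B] [LieGroup 𝓘(ℝ, EG) ∞ G]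

lemma isPrincipalBundle :
    letI := fiberProductAction hP.proj_smul hP'.proj_smul
    letI := chartedSpace hP hP'
    IsPrincipalBundle (𝓘(ℝ, EG).prod 𝓘(ℝ, EG)) IB (IB.prod (𝓘(ℝ, EG).prod 𝓘(ℝ, EG))) (G × G)
      (fun x : FiberProduct π π' => π x.1.1) :=
  letI := fiberProductAction hP.proj_smul hP'.proj_smul
  (atlas hP hP').isPrincipalBundle

lemma isSmoothManifold [T2Space P] [T2Space P'] [SecondCountableTopology P]
    [SecondCountableTopology P'] :
    letI := chartedSpace hP hP'
    IsSmoothManifold (IB.prod (𝓘(ℝ, EG).prod 𝓘(ℝ, EG))) (FiberProduct π π') :=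
  letI := fiberProductAction hP.proj_smul hP'.proj_smul
  letI := chartedSpace hP hP'
  ⟨(atlas hP hP').isManifold, inferInstance,
    TopologicalSpace.Subtype.secondCountableTopology {x : P × P' | π x.1 = π' x.2}⟩

/-- The local trivialization `(p, p') ↦ (π p, e p, e' p')` is smooth. -/
lemma contMDiffOn_fiberProd (b : B) :
    letI := chartedSpace hP hP'
    ContMDiffOn (IB.prod (𝓘(ℝ, EG).prod 𝓘(ℝ, EG))) (IB.prod (𝓘(ℝ, EG).prod 𝓘(ℝ, EG))) ∞
      (fun x : FiberProduct π π' => (π x.1.1, (hP.triv b x.1.1).2, (hP'.triv b x.1.2).2))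
      {x | π x.1.1 ∈ (hP.triv b).baseSet ∩ (hP'.triv b).baseSet} :=
  letI := fiberProductAction hP.proj_smul hP'.proj_smul
  (atlas hP hP').contMDiffOn_triv b

lemma contMDiffOn_fiberInv (b : B) :
    letI := chartedSpace hP hP'
    ContMDiffOn (IB.prod (𝓘(ℝ, EG).prod 𝓘(ℝ, EG))) (IB.prod (𝓘(ℝ, EG).prod 𝓘(ℝ, EG))) ∞
      ((hP.triv b).fiberInv (hP'.triv b) (basePoint hP hP' b))
      (((hP.triv b).baseSet ∩ (hP'.triv b).baseSet) ×ˢ univ) :=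
  letI := fiberProductAction hP.proj_smul hP'.proj_smul
  (atlas hP hP').contMDiffOn_triv_symm b

lemma contMDiff_val :
    letI := chartedSpace hP hP'
    ContMDiff (IB.prod (𝓘(ℝ, EG).prod 𝓘(ℝ, EG))) (IP.prod IP') ∞
      (Subtype.val : FiberProduct π π' → P × P') := by
  let := chartedSpace hP hP'
  intro x
  have hx : π x.1.1 ∈ (hP.triv (π x.1.1)).baseSet ∩ (hP'.triv (π x.1.1)).baseSet :=
    ⟨hP.mem_baseSet_triv _, hP'.mem_baseSet_triv _⟩
  set b := π x.1.1
  have ht := contMDiffOn_fiberProd hP hP' b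
  have h1 := (hP.contMDiffOn_triv_symm b).comp (ht.fst.prodMk ht.snd.fst)
    fun y hy => (hP.triv b).mem_target.2 hy.1
  have h2 := (hP'.contMDiffOn_triv_symm b).comp (ht.fst.prodMk ht.snd.snd)
    fun y hy => (hP'.triv b).mem_target.2 hy.2
  have h3 : ContMDiffOn (IB.prod (𝓘(ℝ, EG).prod 𝓘(ℝ, EG))) (IP.prod IP') ∞
      (Subtype.val : FiberProduct π π' → P × P')
      {x | π x.1.1 ∈ (hP.triv b).baseSet ∩ (hP'.triv b).baseSet} := by
    refine (h1.prodMk h2).congr fun y hy => ?_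
    have h4 := congrArg Subtype.val
      (Bundle.Trivialization.fiberInv_apply (basePoint hP hP' b) y hy)
    rw [Bundle.Trivialization.fiberInv_val (basePoint hP hP' b)
      (y := (π y.1.1, (hP.triv b y.1.1).2, (hP'.triv b y.1.2).2)) hy] at h4
    exact h4.symm
  exact h3.contMDiffAt ((isOpen_source hP hP' b).mem_nhds hx)

/-- The fibre product is locally a smooth retract of the product. -/
lemma exists_retraction (x : FiberProduct π π') :
    letI := chartedSpace hP hP'
    ∃ (O : Set (P × P')) (r : P × P' → FiberProduct π π'), IsOpen O ∧ x.1 ∈ O ∧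
      ContMDiffOn (IP.prod IP') (IB.prod (𝓘(ℝ, EG).prod 𝓘(ℝ, EG))) ∞ r O ∧
      ∀ y : FiberProduct π π', y.1 ∈ O → r y.1 = y := by
  let := chartedSpace hP hP'
  set b := π x.1.1 with hb
  have h1 : ContMDiffOn (IP.prod IP') (IB.prod (𝓘(ℝ, EG).prod 𝓘(ℝ, EG))) ∞
      (fun z : P × P' => (π z.1, (hP.triv b z.1).2, (hP'.triv b z.2).2))
      {z | π z.1 ∈ (hP.triv b).baseSet ∩ (hP'.triv b).baseSet ∧ π' z.2 ∈ (hP'.triv b).baseSet} :=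
    (hP.proj_smooth.comp contMDiff_fst).contMDiffOn.prodMk
      (((hP.contMDiffOn_triv_snd b).comp contMDiffOn_fst fun z hz => hz.1.1).prodMk
      ((hP'.contMDiffOn_triv_snd b).comp contMDiffOn_snd fun z hz => hz.2))
  -- The retraction keeps p and moves p' into the fibre over π p without changing its fibre
  -- coordinate.
  refine ⟨_, fun z => (hP.triv b).fiberInv (hP'.triv b) (basePoint hP hP' b)
    (π z.1, (hP.triv b z.1).2, (hP'.triv b z.2).2), ?_, ?_,
    (contMDiffOn_fiberInv hP hP' b).comp h1 fun z hz => ⟨hz.1, mem_univ _⟩, ?_⟩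
  · exact (((hP.triv b).open_baseSet.inter (hP'.triv b).open_baseSet).preimage
      (hP.proj_smooth.continuous.comp continuous_fst)).inter
      ((hP'.triv b).open_baseSet.preimage (hP'.proj_smooth.continuous.comp continuous_snd))
  · exact ⟨⟨hP.mem_baseSet_triv b, hP'.mem_baseSet_triv b⟩,
      by rw [← x.2, ← hb]; exact hP'.mem_baseSet_triv b⟩
  · exact fun y hy => Bundle.Trivialization.fiberInv_apply _ y hy.1

/-- The derivative of a local retraction is a left inverse of the derivative of the inclusion. -/
lemma injective_modelDeriv_val (x : FiberProduct π π') :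
    letI := chartedSpace hP hP'
    Function.Injective (modelDeriv (IB.prod (𝓘(ℝ, EG).prod 𝓘(ℝ, EG))) (IP.prod IP')
      (Subtype.val : FiberProduct π π' → P × P') x) := by
  let := chartedSpace hP hP'
  obtain ⟨O, r, hO, hx, hr, hrO⟩ := exists_retraction hP hP' x
  refine Function.LeftInverse.injective (g := modelDeriv (IP.prod IP')
    (IB.prod (𝓘(ℝ, EG).prod 𝓘(ℝ, EG))) r x.1) fun v => ?_
  rw [← modelDeriv_comp_apply ((hr.contMDiffAt (hO.mem_nhds hx)).mdifferentiableAt (by simp))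
    ((contMDiff_val hP hP' x).mdifferentiableAt (by simp)) rfl]
  have : r ∘ Subtype.val =ᶠ[𝓝 x] id := by
    filter_upwards [continuous_subtype_val.continuousAt.preimage_mem_nhds (hO.mem_nhds hx)]
      with y hy using hrO y hy
  rw [modelDeriv_congr this, modelDeriv_id]

/-- Maps to the fibre product are smooth if they are smooth as maps to the product. -/
lemma contMDiff_of_contMDiff_val {E H N : Type*} [NormedAddCommGroup E] [NormedSpace ℝ E]
    [TopologicalSpace H] [TopologicalSpace N] [ChartedSpace H N] {I : ModelWithCorners ℝ E H}
    {f : N → FiberProduct π π'} (hf : ContMDiff I (IP.prod IP') ∞ (fun z => (f z).1)) :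
    letI := chartedSpace hP hP'
    ContMDiff I (IB.prod (𝓘(ℝ, EG).prod 𝓘(ℝ, EG))) ∞ f := by
  let := chartedSpace hP hP'
  intro z
  obtain ⟨O, r, hO, hx, hr, hrO⟩ := exists_retraction hP hP' (f z)
  -- Near z the map f is its composite with the inclusion followed by the retraction r.
  have h1 : ContMDiffAt I (IB.prod (𝓘(ℝ, EG).prod 𝓘(ℝ, EG))) ∞ (r ∘ fun z => (f z).1) z :=
    (hr.contMDiffAt (hO.mem_nhds hx)).comp z (hf z)
  refine h1.congr_of_eventuallyEq ?_
  filter_upwards [hf.continuous.continuousAt.preimage_mem_nhds (hO.mem_nhds hx)] with y hy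
  exact (hrO (f y) hy).symm

end FiberProduct

end FiberProductManifold

/-- The total space of a locally trivial bundle with Hausdorff base and fibre is Hausdorff. -/
lemma t2Space_of_locallyTrivial {B F Z : Type*} [TopologicalSpace B] [TopologicalSpace F]
    [TopologicalSpace Z] [T2Space B] [T2Space F] {proj : Z → B}
    (h : ∀ b, ∃ e : Bundle.Trivialization F proj, b ∈ e.baseSet) : T2Space Z := by
  have hc : Continuous proj := continuous_iff_continuousAt.2 fun z => by
    obtain ⟨e, he⟩ := h (proj z)
    exact e.continuousAt_proj (e.mem_source.2 he)
  refine ⟨fun x y hxy => ?_⟩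
  by_cases hb : proj x = proj y
  · obtain ⟨e, he⟩ := h (proj x)
    have hx : x ∈ e.source := e.mem_source.2 he
    have hy : y ∈ e.source := e.mem_source.2 (hb ▸ he)
    have hne : e x ≠ e y := fun h => hxy (e.toOpenPartialHomeomorph.injOn hx hy h)
    obtain ⟨u, v, hu, hv, hxu, hyv, huv⟩ := t2_separation hne
    exact ⟨e.source ∩ e ⁻¹' u, e.source ∩ e ⁻¹' v,
      e.toOpenPartialHomeomorph.isOpen_inter_preimage hu,
      e.toOpenPartialHomeomorph.isOpen_inter_preimage hv, ⟨hx, hxu⟩, ⟨hy, hyv⟩,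
      (huv.preimage e).mono inter_subset_right inter_subset_right⟩
  · obtain ⟨u, v, hu, hv, hxu, hyv, huv⟩ := t2_separation hb
    exact ⟨proj ⁻¹' u, proj ⁻¹' v, hu.preimage hc, hv.preimage hc, hxu, hyv, huv.preimage proj⟩

/-! ### The tensor product as a principal bundle over the base and as a quotient of the fibre
product. -/

section TensorManifold

variable {EB HB B EP HP P EP' HP' P' EG G : Type*}
  [NormedAddCommGroup EB] [NormedSpace ℝ EB] [TopologicalSpace HB]
  [TopologicalSpace B] [ChartedSpace HB B]
  [NormedAddCommGroup EP] [NormedSpace ℝ EP] [TopologicalSpace HP]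
  [TopologicalSpace P] [ChartedSpace HP P]
  [NormedAddCommGroup EP'] [NormedSpace ℝ EP'] [TopologicalSpace HP']
  [TopologicalSpace P'] [ChartedSpace HP' P']
  [NormedAddCommGroup EG] [NormedSpace ℝ EG]
  [TopologicalSpace G] [ChartedSpace EG G] [CommGroup G] [MulAction G P] [MulAction G P']
  {IB : ModelWithCorners ℝ EB HB} {IP : ModelWithCorners ℝ EP HP} {IP' : ModelWithCorners ℝ EP' HP'}
  {π : P → B} {π' : P' → B}
  (hP : IsPrincipalBundle 𝓘(ℝ, EG) IB IP G π) (hP' : IsPrincipalBundle 𝓘(ℝ, EG) IB IP' G π')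

namespace BundleTensor

/-- G acts by homeomorphisms, so the orbit map is open. Continuity of maps out of the tensor product
and second countability are then inherited from the fibre product. -/
lemma isOpenQuotientMap_mk : IsOpenQuotientMap (mk hP.proj_smul hP'.proj_smul) := by
  let := fiberProductAntidiagonalAction hP.proj_smul hP'.proj_smul
  have : ContinuousConstSMul G (FiberProduct π π') := ⟨fun g =>
    (((hP.contMDiff_const_smul g).continuous.comp continuous_fst).prodMk
      ((hP'.contMDiff_const_smul g⁻¹).continuous.comp continuous_snd)).comp
      continuous_subtype_val |>.subtype_mk _⟩
  exact MulAction.isOpenQuotientMap_quotientMk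

lemma continuous_proj : Continuous (proj hP.proj_smul hP'.proj_smul) :=
  (isOpenQuotientMap_mk hP hP').isQuotientMap.continuous_iff.2
    (hP.proj_smooth.continuous.comp (continuous_fst.comp continuous_subtype_val))

lemma mk_eq_iff (x y : FiberProduct π π') :
    mk hP.proj_smul hP'.proj_smul x = mk hP.proj_smul hP'.proj_smul y ↔
      ∃ g : G, g • y.1.1 = x.1.1 ∧ g⁻¹ • y.1.2 = x.1.2 := by
  let := fiberProductAntidiagonalAction hP.proj_smul hP'.proj_smul
  constructor
  · intro h
    obtain ⟨g, hg⟩ : x ∈ MulAction.orbit G y := Quotient.exact h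
    exact ⟨g, congrArg (fun z => z.1.1) hg, congrArg (fun z => z.1.2) hg⟩
  · rintro ⟨g, h1, h2⟩
    exact Quotient.sound ⟨g, Subtype.ext (Prod.ext h1 h2)⟩

/-- The fibre coordinate `[p, p'] ↦ e p * e' p'` of the tensor product. -/
def coord (b : B) (t : BundleTensor hP.proj_smul hP'.proj_smul) : G :=
  (hP.triv b (Quotient.out t).1.1).2 * (hP'.triv b (Quotient.out t).1.2).2

/-- Another representative multiplies one fibre coordinate by g and the other by g⁻¹. These cancel
because G is commutative, so the choice made by `Quotient.out` does not matter. -/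
lemma coord_mk {b : B} {x : FiberProduct π π'}
    (hx : π x.1.1 ∈ (hP.triv b).baseSet ∩ (hP'.triv b).baseSet) :
    coord hP hP' b (mk hP.proj_smul hP'.proj_smul x) =
      (hP.triv b x.1.1).2 * (hP'.triv b x.1.2).2 := by
  obtain ⟨g, h1, h2⟩ := (mk_eq_iff hP hP' _ x).1 (Quotient.out_eq (mk hP.proj_smul hP'.proj_smul x))
  rw [coord, ← h1, ← h2, hP.triv_smul b g ((hP.triv b).mem_source.2 hx.1),
    hP'.triv_smul b g⁻¹ ((hP'.triv b).mem_source.2 (by rw [← x.2]; exact hx.2)),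
    mul_mul_mul_comm, mul_inv_cancel, one_mul]

/-- The inverse of the trivialization `[p, p'] ↦ (π p, e p * e' p')`. -/
def trivInv (b : B) (y : B × G) : BundleTensor hP.proj_smul hP'.proj_smul :=
  mk hP.proj_smul hP'.proj_smul ((hP.triv b).fiberInv (hP'.triv b)
    (FiberProduct.basePoint hP hP' b) (y.1, y.2, 1))

/-- Acting antidiagonally by g' turns the fibre coordinates (g, g') into (g g', 1), the
representative used by `trivInv`. -/
lemma mk_fiberInv {b : B} {β : B} (hβ : β ∈ (hP.triv b).baseSet ∩ (hP'.triv b).baseSet) (g g' : G) :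
    mk hP.proj_smul hP'.proj_smul ((hP.triv b).fiberInv (hP'.triv b)
      (FiberProduct.basePoint hP hP' b) (β, g, g')) = trivInv hP hP' b (β, g * g') := by
  set x := (hP.triv b).fiberInv (hP'.triv b) (FiberProduct.basePoint hP hP' b) (β, g, g') with hx
  have hb : π x.1.1 = β := Bundle.Trivialization.proj_fiberInv _ (y := (β, g, g')) hβ
  have h1 : (hP.triv b x.1.1).2 = g :=
    Bundle.Trivialization.fst_fiberInv _ (y := (β, g, g')) hβ
  have h2 : (hP'.triv b x.1.2).2 = g' :=
    Bundle.Trivialization.snd_fiberInv _ (y := (β, g, g')) hβ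
  let := fiberProductAntidiagonalAction hP.proj_smul hP'.proj_smul
  have hbg : π (g' • x).1.1 = β := (hP.proj_smul g' x.1.1).trans hb
  have h3 := Bundle.Trivialization.fiberInv_apply (FiberProduct.basePoint hP hP' b) (g' • x)
    (by rw [hbg]; exact hβ)
  have h4 : (hP.triv b (g' • x).1.1).2 = g * g' := by
    change (hP.triv b (g' • x.1.1)).2 = g * g'
    rw [hP.triv_smul b g' ((hP.triv b).mem_source.2 (by rw [hb]; exact hβ.1)), h1, mul_comm]
  have h5 : (hP'.triv b (g' • x).1.2).2 = 1 := by
    change (hP'.triv b (g'⁻¹ • x.1.2)).2 = 1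
    rw [hP'.triv_smul b g'⁻¹ ((hP'.triv b).mem_source.2 (by rw [← x.2, hb]; exact hβ.2)), h2,
      inv_mul_cancel]
  rw [hbg, h4, h5] at h3
  rw [trivInv, h3]
  exact ((mk_eq_iff hP hP' (g' • x) x).2 ⟨g', rfl, rfl⟩).symm

lemma trivInv_coord {b : B} {x : FiberProduct π π'}
    (hx : π x.1.1 ∈ (hP.triv b).baseSet ∩ (hP'.triv b).baseSet) :
    trivInv hP hP' b (π x.1.1, (hP.triv b x.1.1).2 * (hP'.triv b x.1.2).2) =
      mk hP.proj_smul hP'.proj_smul x := by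
  rw [← mk_fiberInv hP hP' hx, Bundle.Trivialization.fiberInv_apply _ x hx]

lemma proj_trivInv {b : B} {y : B × G} (hy : y.1 ∈ (hP.triv b).baseSet ∩ (hP'.triv b).baseSet) :
    proj hP.proj_smul hP'.proj_smul (trivInv hP hP' b y) = y.1 :=
  Bundle.Trivialization.proj_fiberInv _ (y := (y.1, y.2, 1)) hy

/-- This is the transition function of the tensor product: the one of P times the one of P'
evaluated at 1. Smoothness of the atlas follows from it. -/
lemma coord_trivInv {b b' : B} {y : B × G}
    (hy : y.1 ∈ (hP.triv b).baseSet ∩ (hP'.triv b).baseSet)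
    (hy' : y.1 ∈ (hP.triv b').baseSet ∩ (hP'.triv b').baseSet) :
    coord hP hP' b' (trivInv hP hP' b y) =
      (hP.triv b' ((hP.triv b).toOpenPartialHomeomorph.symm (y.1, y.2))).2 *
      (hP'.triv b' ((hP'.triv b).toOpenPartialHomeomorph.symm (y.1, 1))).2 := by
  rw [trivInv, coord_mk, Bundle.Trivialization.fiberInv_val _ (y := (y.1, y.2, 1)) hy]
  rw [Bundle.Trivialization.proj_fiberInv _ (y := (y.1, y.2, 1)) hy]
  exact hy'

lemma coord_trivInv_self {b : B} {y : B × G}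
    (hy : y.1 ∈ (hP.triv b).baseSet ∩ (hP'.triv b).baseSet) :
    coord hP hP' b (trivInv hP hP' b y) = y.2 := by
  rw [coord_trivInv hP hP' hy hy, (hP.triv b).apply_symm_apply' hy.1,
    (hP'.triv b).apply_symm_apply' hy.2, mul_one]

section

variable [LieGroup 𝓘(ℝ, EG) ∞ G]

/-- The trivialization `[p, p'] ↦ (π p, e p * e' p')` of the tensor product. -/
def triv (b : B) : Bundle.Trivialization G (proj hP.proj_smul hP'.proj_smul) where
  toFun t := (proj hP.proj_smul hP'.proj_smul t, coord hP hP' b t)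
  invFun := trivInv hP hP' b
  source := proj hP.proj_smul hP'.proj_smul ⁻¹' ((hP.triv b).baseSet ∩ (hP'.triv b).baseSet)
  target := ((hP.triv b).baseSet ∩ (hP'.triv b).baseSet) ×ˢ univ
  map_source' x hx := ⟨hx, mem_univ _⟩
  map_target' y hy := by
    change proj hP.proj_smul hP'.proj_smul (trivInv hP hP' b y) ∈
      (hP.triv b).baseSet ∩ (hP'.triv b).baseSet
    rw [proj_trivInv hP hP' hy.1]
    exact hy.1
  left_inv' t ht := by
    obtain ⟨x, rfl⟩ := (isOpenQuotientMap_mk hP hP').surjective t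
    rw [coord_mk hP hP' ht]
    exact trivInv_coord hP hP' ht
  right_inv' y hy := by
    rw [proj_trivInv hP hP' hy.1, coord_trivInv_self hP hP' hy.1]
  open_source := ((hP.triv b).open_baseSet.inter (hP'.triv b).open_baseSet).preimage
    (continuous_proj hP hP')
  open_target := ((hP.triv b).open_baseSet.inter (hP'.triv b).open_baseSet).prod isOpen_univ
  continuousOn_toFun := by
    have hopen := ((hP.triv b).open_baseSet.inter (hP'.triv b).open_baseSet).preimage
      (continuous_proj hP hP')
    refine (continuous_proj hP hP').continuousOn.prodMk ?_
    -- Continuity is checked on the fibre product, where the coordinate is a product of continuous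
    -- functions independent of the chosen representatives.
    refine ((isOpenQuotientMap_mk hP hP').isQuotientMap.continuousOn_isOpen_iff hopen).2 ?_
    have := topologicalGroup_of_lieGroup 𝓘(ℝ, EG) ∞ (G := G)
    exact (Bundle.Trivialization.continuousOn_snd_fst.mul
      Bundle.Trivialization.continuousOn_snd_snd).congr fun x hx => coord_mk hP hP' hx
  continuousOn_invFun :=
    (isOpenQuotientMap_mk hP hP').continuous.comp_continuousOn
      ((Bundle.Trivialization.continuousOn_fiberInv (FiberProduct.basePoint hP hP' b)).comp
        (by fun_prop) fun y hy => ⟨hy.1, mem_univ _⟩)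
  baseSet := (hP.triv b).baseSet ∩ (hP'.triv b).baseSet
  open_baseSet := (hP.triv b).open_baseSet.inter (hP'.triv b).open_baseSet
  source_eq := rfl
  target_eq := rfl
  proj_toFun _ _ := rfl

/-- The principal bundle atlas of the tensor product. -/
def atlas : letI := action hP.proj_smul hP'.proj_smul
    PrincipalAtlas IB 𝓘(ℝ, EG) G (proj hP.proj_smul hP'.proj_smul) :=
  letI := action hP.proj_smul hP'.proj_smul
  { triv := fun b => triv hP hP' b
    mem_baseSet := fun b => ⟨hP.mem_baseSet_triv b, hP'.mem_baseSet_triv b⟩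
    proj_smul := fun g t => by
      obtain ⟨x, rfl⟩ := (isOpenQuotientMap_mk hP hP').surjective t
      exact hP.proj_smul g x.1.1
    smul_snd := fun b g t ht => by
      obtain ⟨x, rfl⟩ := (isOpenQuotientMap_mk hP hP').surjective t
      have hx : π x.1.1 ∈ (hP.triv b).baseSet ∩ (hP'.triv b).baseSet := ht
      have hgx : π (g • x.1.1) = π' x.1.2 := by rw [hP.proj_smul, x.2]
      change coord hP hP' b (mk hP.proj_smul hP'.proj_smul ⟨(g • x.1.1, x.1.2), hgx⟩) =
        g * coord hP hP' b (mk hP.proj_smul hP'.proj_smul x)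
      rw [coord_mk hP hP' hx, coord_mk hP hP' (by
        change π (g • x.1.1) ∈ (hP.triv b).baseSet ∩ (hP'.triv b).baseSet
        rw [hP.proj_smul]
        exact hx)]
      change (hP.triv b (g • x.1.1)).2 * _ = _
      rw [hP.triv_smul b g ((hP.triv b).mem_source.2 hx.1), mul_assoc]
    transition := fun b b' => by
      have hsub : ∀ y ∈ ((triv hP hP' b).target ∩
          (triv hP hP' b).toOpenPartialHomeomorph.symm ⁻¹' (triv hP hP' b').source),
          y.1 ∈ (hP.triv b).baseSet ∩ (hP'.triv b).baseSet ∧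
          y.1 ∈ (hP.triv b').baseSet ∩ (hP'.triv b').baseSet := by
        rintro y ⟨hy, hy'⟩
        refine ⟨hy.1, ?_⟩
        change proj hP.proj_smul hP'.proj_smul (trivInv hP hP' b y) ∈
          (hP.triv b').baseSet ∩ (hP'.triv b').baseSet at hy'
        rwa [proj_trivInv hP hP' hy.1] at hy'
      have hj : ContMDiffOn (IB.prod 𝓘(ℝ, EG)) (IB.prod (𝓘(ℝ, EG).prod 𝓘(ℝ, EG))) ∞
          (fun y : B × G => (y.1, y.2, (1 : G))) ((triv hP hP' b).target ∩
          (triv hP hP' b).toOpenPartialHomeomorph.symm ⁻¹' (triv hP hP' b').source) :=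
        contMDiffOn_fst.prodMk (contMDiffOn_snd.prodMk contMDiffOn_const)
      refine ContMDiffOn.congr (contMDiffOn_fst.prodMk
        (((FiberProduct.contMDiffOn_triv_fiberInv_fst hP b b').comp hj fun y hy => ?_).mul
        ((FiberProduct.contMDiffOn_triv_fiberInv_snd hP' b b').comp hj fun y hy => ?_)))
        fun y hy => ?_
      · exact ⟨(hsub y hy).1.1, (hsub y hy).2.1⟩
      · exact ⟨(hsub y hy).1.2, (hsub y hy).2.2⟩
      · change (proj hP.proj_smul hP'.proj_smul (trivInv hP hP' b y),
          coord hP hP' b' (trivInv hP hP' b y)) = _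
        rw [proj_trivInv hP hP' (hsub y hy).1, coord_trivInv hP hP' (hsub y hy).1 (hsub y hy).2]
        rfl }

/-- The smooth structure of the tensor product. -/
abbrev chartedSpace :
    ChartedSpace (ModelProd HB EG) (BundleTensor hP.proj_smul hP'.proj_smul) :=
  letI := action hP.proj_smul hP'.proj_smul
  (atlas hP hP').chartedSpace

variable [IsManifold IB ∞ B]

lemma isPrincipalBundle :
    letI := action hP.proj_smul hP'.proj_smul
    letI := chartedSpace hP hP'
    IsPrincipalBundle 𝓘(ℝ, EG) IB (IB.prod 𝓘(ℝ, EG)) G (proj hP.proj_smul hP'.proj_smul) :=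
  letI := action hP.proj_smul hP'.proj_smul
  (atlas hP hP').isPrincipalBundle

lemma isSmoothManifold [T2Space B] [T2Space G] [SecondCountableTopology P]
    [SecondCountableTopology P'] :
    letI := chartedSpace hP hP'
    IsSmoothManifold (IB.prod 𝓘(ℝ, EG)) (BundleTensor hP.proj_smul hP'.proj_smul) := by
  let := action hP.proj_smul hP'.proj_smul
  let := chartedSpace hP hP'
  have : SecondCountableTopology (FiberProduct π π') :=
    TopologicalSpace.Subtype.secondCountableTopology {x : P × P' | π x.1 = π' x.2}
  exact ⟨(atlas hP hP').isManifold,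
    t2Space_of_locallyTrivial fun b => ⟨triv hP hP' b, hP.mem_baseSet_triv b,
      hP'.mem_baseSet_triv b⟩,
    (isOpenQuotientMap_mk hP hP').isQuotientMap.secondCountableTopology
      (isOpenQuotientMap_mk hP hP').isOpenMap⟩

lemma contMDiffOn_coord (b : B) :
    letI := chartedSpace hP hP'
    ContMDiffOn (IB.prod 𝓘(ℝ, EG)) 𝓘(ℝ, EG) ∞ (coord hP hP' b)
      (proj hP.proj_smul hP'.proj_smul ⁻¹' ((hP.triv b).baseSet ∩ (hP'.triv b).baseSet)) :=
  letI := action hP.proj_smul hP'.proj_smul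
  letI := chartedSpace hP hP'
  ContMDiffOn.snd (I₁ := IB) ((atlas hP hP').contMDiffOn_triv b)

lemma contMDiffOn_trivInv (b : B) :
    letI := chartedSpace hP hP'
    ContMDiffOn (IB.prod 𝓘(ℝ, EG)) (IB.prod 𝓘(ℝ, EG)) ∞ (trivInv hP hP' b)
      (((hP.triv b).baseSet ∩ (hP'.triv b).baseSet) ×ˢ univ) :=
  letI := action hP.proj_smul hP'.proj_smul
  letI := chartedSpace hP hP'
  (atlas hP hP').contMDiffOn_triv_symm b

/-- In trivializations the orbit map is (b, g, g') ↦ (b, g g'). -/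
lemma contMDiff_mk :
    letI := FiberProduct.chartedSpace hP hP'
    letI := chartedSpace hP hP'
    ContMDiff (IB.prod (𝓘(ℝ, EG).prod 𝓘(ℝ, EG))) (IB.prod 𝓘(ℝ, EG)) ∞
      (mk hP.proj_smul hP'.proj_smul) := by
  let := FiberProduct.chartedSpace hP hP'
  let := chartedSpace hP hP'
  intro x
  set b := π x.1.1 with hb
  have ht := FiberProduct.contMDiffOn_fiberProd hP hP' b
  have h1 := ((contMDiffOn_trivInv hP hP' b).comp (ht.fst.prodMk (ht.snd.fst.mul ht.snd.snd))
    fun y hy => ⟨hy, mem_univ _⟩).congr fun y hy => (trivInv_coord hP hP' hy).symm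
  exact h1.contMDiffAt ((FiberProduct.isOpen_source hP hP' b).mem_nhds
    ⟨hP.mem_baseSet_triv _, hP'.mem_baseSet_triv _⟩)

/-- The local trivialization `(p, p') ↦ ([p, p'], e p)` of the orbit map. -/
def orbitTriv (b : B) : Bundle.Trivialization G (mk hP.proj_smul hP'.proj_smul) where
  toFun x := (mk hP.proj_smul hP'.proj_smul x, (hP.triv b x.1.1).2)
  -- Given the class and the first fibre coordinate, the second is forced: the two multiply to the
  -- coordinate of the class.
  invFun y := (hP.triv b).fiberInv (hP'.triv b) (FiberProduct.basePoint hP hP' b)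
    (proj hP.proj_smul hP'.proj_smul y.1, y.2, y.2⁻¹ * coord hP hP' b y.1)
  source := {x | π x.1.1 ∈ (hP.triv b).baseSet ∩ (hP'.triv b).baseSet}
  target := (proj hP.proj_smul hP'.proj_smul ⁻¹'
    ((hP.triv b).baseSet ∩ (hP'.triv b).baseSet)) ×ˢ univ
  map_source' x hx := ⟨hx, mem_univ _⟩
  map_target' y hy := by
    change π (((hP.triv b).fiberInv (hP'.triv b) (FiberProduct.basePoint hP hP' b)
      (proj hP.proj_smul hP'.proj_smul y.1, y.2, y.2⁻¹ * coord hP hP' b y.1)).1.1) ∈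
      (hP.triv b).baseSet ∩ (hP'.triv b).baseSet
    rw [Bundle.Trivialization.proj_fiberInv _
      (y := (proj hP.proj_smul hP'.proj_smul y.1, y.2, y.2⁻¹ * coord hP hP' b y.1)) hy.1]
    exact hy.1
  left_inv' x hx := by
    rw [coord_mk hP hP' hx, inv_mul_cancel_left]
    exact Bundle.Trivialization.fiberInv_apply _ x hx
  right_inv' y hy := by
    refine Prod.ext ?_ (Bundle.Trivialization.fst_fiberInv _
      (y := (proj hP.proj_smul hP'.proj_smul y.1, y.2, y.2⁻¹ * coord hP hP' b y.1)) hy.1)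
    change mk hP.proj_smul hP'.proj_smul _ = y.1
    rw [mk_fiberInv hP hP' hy.1, mul_inv_cancel_left]
    exact (triv hP hP' b).left_inv' hy.1
  open_source := FiberProduct.isOpen_source hP hP' b
  open_target := (((hP.triv b).open_baseSet.inter (hP'.triv b).open_baseSet).preimage
    (continuous_proj hP hP')).prod isOpen_univ
  continuousOn_toFun := (isOpenQuotientMap_mk hP hP').continuous.continuousOn.prodMk
    Bundle.Trivialization.continuousOn_snd_fst
  continuousOn_invFun := by
    have := topologicalGroup_of_lieGroup 𝓘(ℝ, EG) ∞ (G := G)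
    have hc : ContinuousOn (coord hP hP' b) (proj hP.proj_smul hP'.proj_smul ⁻¹'
        ((hP.triv b).baseSet ∩ (hP'.triv b).baseSet)) :=
      continuous_snd.comp_continuousOn (triv hP hP' b).continuousOn_toFun
    refine (Bundle.Trivialization.continuousOn_fiberInv _).comp ?_ fun y hy => ⟨hy.1, mem_univ _⟩
    refine ((continuous_proj hP hP').comp continuous_fst).continuousOn.prodMk
      (continuousOn_snd.prodMk (continuousOn_snd.inv.mul (hc.comp continuousOn_fst ?_)))
    exact fun y hy => hy.1
  baseSet := proj hP.proj_smul hP'.proj_smul ⁻¹' ((hP.triv b).baseSet ∩ (hP'.triv b).baseSet)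
  open_baseSet := ((hP.triv b).open_baseSet.inter (hP'.triv b).open_baseSet).preimage
    (continuous_proj hP hP')
  source_eq := rfl
  target_eq := rfl
  proj_toFun _ _ := rfl

/-- The orbit map from the fibre product to the tensor product is a principal bundle for the
anti-diagonal action. -/
lemma orbit_isPrincipalBundle :
    letI := FiberProduct.chartedSpace hP hP'
    letI := chartedSpace hP hP'
    letI := fiberProductAntidiagonalAction hP.proj_smul hP'.proj_smul
    IsPrincipalBundle 𝓘(ℝ, EG) (IB.prod 𝓘(ℝ, EG)) (IB.prod (𝓘(ℝ, EG).prod 𝓘(ℝ, EG))) G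
      (mk hP.proj_smul hP'.proj_smul) := by
  let := FiberProduct.chartedSpace hP hP'
  let := chartedSpace hP hP'
  let := fiberProductAction hP.proj_smul hP'.proj_smul
  let := action hP.proj_smul hP'.proj_smul
  let := fiberProductAntidiagonalAction hP.proj_smul hP'.proj_smul
  refine ⟨?_, fun g x => (mk_eq_iff hP hP' _ _).2 ⟨g, rfl, rfl⟩, contMDiff_mk hP hP', fun t =>
    ⟨orbitTriv hP hP' (proj hP.proj_smul hP'.proj_smul t),
      ⟨hP.mem_baseSet_triv _, hP'.mem_baseSet_triv _⟩, ?_, ?_, ?_⟩⟩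
  -- The antidiagonal action is the G × G action composed with the smooth map g ↦ (g, g⁻¹).
  · have h1 := (FiberProduct.isPrincipalBundle hP hP').smul_smooth
    have h2 : ContMDiff (𝓘(ℝ, EG).prod (IB.prod (𝓘(ℝ, EG).prod 𝓘(ℝ, EG))))
        ((𝓘(ℝ, EG).prod 𝓘(ℝ, EG)).prod (IB.prod (𝓘(ℝ, EG).prod 𝓘(ℝ, EG)))) ∞
        (fun x : G × FiberProduct π π' => ((x.1, x.1⁻¹), x.2)) :=
      (contMDiff_fst.prodMk contMDiff_fst.inv).prodMk contMDiff_snd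
    exact h1.comp h2
  · exact (contMDiff_mk hP hP').contMDiffOn.prodMk
      (FiberProduct.contMDiffOn_fiberProd hP hP' _).snd.fst
  · refine (FiberProduct.contMDiffOn_fiberInv hP hP' _).comp ?_ fun y hy => ⟨hy.1, mem_univ _⟩
    refine ((isPrincipalBundle hP hP').proj_smooth.comp contMDiff_fst).contMDiffOn.prodMk
      (contMDiffOn_snd.prodMk (contMDiffOn_snd.inv.mul
        ((contMDiffOn_coord hP hP' _).comp contMDiffOn_fst ?_)))
    exact fun y hy => hy.1
  · exact fun g x hx => hP.triv_smul _ g ((hP.triv _).mem_source.2 hx.1)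

end

end BundleTensor

end TensorManifold

/-! ### The form pr₁^*α + pr₂^*α' and its pullbacks. -/

section BoxSum

variable {E H M E₁ H₁ M₁ E₂ H₂ M₂ : Type*}
  [NormedAddCommGroup E] [NormedSpace ℝ E] [TopologicalSpace H]
  [TopologicalSpace M] [ChartedSpace H M]
  [NormedAddCommGroup E₁] [NormedSpace ℝ E₁] [TopologicalSpace H₁]
  [TopologicalSpace M₁] [ChartedSpace H₁ M₁]
  [NormedAddCommGroup E₂] [NormedSpace ℝ E₂] [TopologicalSpace H₂]
  [TopologicalSpace M₂] [ChartedSpace H₂ M₂]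
  {I : ModelWithCorners ℝ E H} {I₁ : ModelWithCorners ℝ E₁ H₁} {I₂ : ModelWithCorners ℝ E₂ H₂}
  {k : ℕ} (α : DiffForm I₁ M₁ k) (α' : DiffForm I₂ M₂ k)

lemma modelDeriv_fst (x : M₁ × M₂) (v : E₁ × E₂) :
    modelDeriv (I₁.prod I₂) I₁ Prod.fst x v = v.1 := by
  change mfderiv (I₁.prod I₂) I₁ Prod.fst x v = v.1
  rw [mfderiv_fst]
  rfl

lemma modelDeriv_snd (x : M₁ × M₂) (v : E₁ × E₂) :
    modelDeriv (I₁.prod I₂) I₂ Prod.snd x v = v.2 := by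
  change mfderiv (I₁.prod I₂) I₂ Prod.snd x v = v.2
  rw [mfderiv_snd]
  rfl

namespace DiffForm

lemma toModel_boxSum (x : M₁ × M₂) (v : Fin k → E₁ × E₂) :
    (α.boxSum α').toModel x v =
      α.toModel x.1 (fun i => (v i).1) + α'.toModel x.2 (fun i => (v i).2) := by
  change (pullback (I₁.prod I₂) I₁ Prod.fst α).toModel x v +
    (pullback (I₁.prod I₂) I₂ Prod.snd α').toModel x v = _
  rw [toModel_pullback, toModel_pullback]
  simp only [modelDeriv_fst, modelDeriv_snd]

lemma toModel_boxSum_two (α : DiffForm I₁ M₁ 2) (α' : DiffForm I₂ M₂ 2) (x : M₁ × M₂)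
    (v w : E₁ × E₂) :
    (α.boxSum α').toModel x ![v, w] =
      α.toModel x.1 ![v.1, w.1] + α'.toModel x.2 ![v.2, w.2] := by
  rw [toModel_boxSum]
  congr 2
  all_goals
    ext i
    fin_cases i <;> rfl

lemma pullback_boxSum {f : M → M₁ × M₂} {x : M} (hf : MDifferentiableAt I (I₁.prod I₂) f x) :
    pullback I (I₁.prod I₂) f (α.boxSum α') x =
      pullback I I₁ (fun y => (f y).1) α x + pullback I I₂ (fun y => (f y).2) α' x := by
  have h : ∀ v : Fin k → E, (pullback I (I₁.prod I₂) f (α.boxSum α')).toModel x v =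
      (pullback I I₁ (fun y => (f y).1) α).toModel x v +
      (pullback I I₂ (fun y => (f y).2) α').toModel x v := by
    intro v
    rw [toModel_pullback, toModel_pullback, toModel_pullback, toModel_boxSum]
    have h1 : ∀ w, modelDeriv I (I₁.prod I₂) f x w =
      (modelDeriv I I₁ (fun y => (f y).1) x w, modelDeriv I I₂ (fun y => (f y).2) x w) :=
      fun w => modelDeriv_prodMk hf.fst hf.snd w
    simp only [h1]
  ext v
  exact h v

end DiffForm

end BoxSum

/-! ### The moment map of the antidiagonal action. -/

section MomentMap

variable {EG G E H M E' H' M' : Type*} [NormedAddCommGroup EG] [NormedSpace ℝ EG]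
  [TopologicalSpace G] [ChartedSpace EG G] [CommGroup G]
  [NormedAddCommGroup E] [NormedSpace ℝ E] [TopologicalSpace H]
  [TopologicalSpace M] [ChartedSpace H M] [MulAction G M]
  [NormedAddCommGroup E'] [NormedSpace ℝ E'] [TopologicalSpace H']
  [TopologicalSpace M'] [ChartedSpace H' M'] [MulAction G M']
  {I : ModelWithCorners ℝ E H} {I' : ModelWithCorners ℝ E' H'}
  {α : DiffForm I M 2} {α' : DiffForm I' M' 2} {μ : M → (EG →L[ℝ] ℝ)} {μ' : M' → (EG →L[ℝ] ℝ)}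

lemma IsMomentMap.modelDeriv_eq (h : IsMomentMap G α μ) (ξ : EG) (x : M) (v : E) :
    modelDeriv I 𝓘(ℝ, ℝ) (fun y => μ y ξ) x v =
      -α.toModel x ![modelDeriv 𝓘(ℝ, EG) I (fun g : G => g • x) 1 ξ, v] :=
  h.deriv_eq ξ x v

lemma contMDiff_eval {μ : M → (EG →L[ℝ] ℝ)} (h : ContMDiff I 𝓘(ℝ, EG →L[ℝ] ℝ) ∞ μ) (ξ : EG) :
    ContMDiff I 𝓘(ℝ, ℝ) ∞ (fun y => μ y ξ) :=
  (ContinuousLinearMap.apply ℝ ℝ ξ).contMDiff.comp h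

lemma IsMomentMap.mdifferentiableAt_eval (h : IsMomentMap G α μ) (ξ : EG) (x : M) :
    MDifferentiableAt I 𝓘(ℝ, ℝ) (fun y => μ y ξ) x :=
  (contMDiff_eval h.smooth ξ x).mdifferentiableAt (by simp)

/-- The derivative of inversion at the identity is minus the identity. -/
lemma modelDeriv_inv [LieGroup 𝓘(ℝ, EG) ∞ G] (ξ : EG) :
    modelDeriv 𝓘(ℝ, EG) 𝓘(ℝ, EG) (fun g : G => g⁻¹) 1 ξ = -ξ := by
  have hinv : MDifferentiableAt 𝓘(ℝ, EG) 𝓘(ℝ, EG) (fun g : G => g⁻¹) 1 :=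
    (contMDiff_inv 𝓘(ℝ, EG) ∞ (1 : G)).mdifferentiableAt (by simp)
  have hmul : MDifferentiableAt (𝓘(ℝ, EG).prod 𝓘(ℝ, EG)) 𝓘(ℝ, EG) (fun x : G × G => x.1 * x.2)
      (1, 1) := (contMDiff_mul 𝓘(ℝ, EG) ∞ ((1 : G), (1 : G))).mdifferentiableAt (by simp)
  -- The identity g * g⁻¹ = 1 is differentiated at 1, where both partial maps of multiplication are
  -- the identity.
  have h := modelDeriv_comp₂_apply hmul mdifferentiableAt_id hinv rfl inv_one ξ
  simp only [id, mul_inv_cancel, mul_one, one_mul] at h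
  change modelDeriv _ _ (fun _ : G => (1 : G)) 1 ξ = modelDeriv _ _ id (1 : G)
    (modelDeriv _ _ id (1 : G) ξ) + modelDeriv _ _ id (1 : G) _ at h
  rw [modelDeriv_const, modelDeriv_id, modelDeriv_id, modelDeriv_id] at h
  exact (neg_eq_of_add_eq_zero_right h.symm).symm

-- The two group elements are independent because both special cases matter: (g, g⁻¹) for the
-- descent of the form, and (a, 1) for the invariance of the reduced form.
omit [TopologicalSpace G] in
lemma pullback_smul_boxSum
    (hα : ∀ g : G, DiffForm.pullback I I (fun x : M => g • x) α = α)
    (hα' : ∀ g : G, DiffForm.pullback I' I' (fun x : M' => g • x) α' = α')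
    (hs : ∀ (g : G) (x : M), MDifferentiableAt I I (fun x : M => g • x) x)
    (hs' : ∀ (g : G) (x : M'), MDifferentiableAt I' I' (fun x : M' => g • x) x) (g g' : G) :
    DiffForm.pullback (I.prod I') (I.prod I') (fun x : M × M' => (g • x.1, g' • x.2))
      (α.boxSum α') = α.boxSum α' := by
  funext x
  have h1 : MDifferentiableAt (I.prod I') I (fun x : M × M' => g • x.1) x :=
    (hs g x.1).comp x mdifferentiableAt_fst
  have h2 : MDifferentiableAt (I.prod I') I' (fun x : M × M' => g' • x.2) x :=
    (hs' g' x.2).comp x mdifferentiableAt_snd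
  rw [DiffForm.pullback_boxSum α α' (h1.prodMk h2)]
  have e1 : DiffForm.pullback (I.prod I') I (fun y : M × M' => g • y.1) α x =
      DiffForm.pullback (I.prod I') I Prod.fst α x := by
    have := DiffForm.pullback_comp_apply (x := x) (f := Prod.fst) (hs g x.1)
      (mdifferentiableAt_fst (I := I) (I' := I')) α
    rw [hα] at this
    exact this
  have e2 : DiffForm.pullback (I.prod I') I' (fun y : M × M' => g' • y.2) α' x =
      DiffForm.pullback (I.prod I') I' Prod.snd α' x := by
    have := DiffForm.pullback_comp_apply (x := x) (f := Prod.snd) (hs' g' x.2)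
      (mdifferentiableAt_snd (I := I) (I' := I')) α'
    rw [hα'] at this
    exact this
  rw [e1, e2]
  rfl

/-- The difference of two moment maps is a moment map for the anti-diagonal action on the
product. -/
lemma IsMomentMap.antidiagonal [LieGroup 𝓘(ℝ, EG) ∞ G] (h : IsMomentMap G α μ)
    (h' : IsMomentMap G α' μ')
    (hs : ContMDiff (𝓘(ℝ, EG).prod I) I ∞ (fun x : G × M => x.1 • x.2))
    (hs' : ContMDiff (𝓘(ℝ, EG).prod I') I' ∞ (fun x : G × M' => x.1 • x.2)) :
    letI := antidiagonalAction G M M'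
    IsMomentMap G (α.boxSum α') (fun x : M × M' => μ x.1 - μ' x.2) := by
  let := antidiagonalAction G M M'
  have hg : ∀ (g : G) (x : M), MDifferentiableAt I I (fun x : M => g • x) x := fun g x =>
    ((hs.comp (contMDiff_const.prodMk contMDiff_id)) x).mdifferentiableAt (by simp)
  have hg' : ∀ (g : G) (x : M'), MDifferentiableAt I' I' (fun x : M' => g • x) x := fun g x =>
    ((hs'.comp (contMDiff_const.prodMk contMDiff_id)) x).mdifferentiableAt (by simp)
  have ho : ∀ x : M, MDifferentiableAt 𝓘(ℝ, EG) I (fun g : G => g • x) 1 := fun x =>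
    ((hs.comp (contMDiff_id.prodMk contMDiff_const)) 1).mdifferentiableAt (by simp)
  have ho' : ∀ x : M', MDifferentiableAt 𝓘(ℝ, EG) I' (fun g : G => g • x) 1 := fun x =>
    ((hs'.comp (contMDiff_id.prodMk contMDiff_const)) 1).mdifferentiableAt (by simp)
  have hinv : MDifferentiableAt 𝓘(ℝ, EG) 𝓘(ℝ, EG) (fun g : G => g⁻¹) 1 :=
    (contMDiff_inv 𝓘(ℝ, EG) ∞ (1 : G)).mdifferentiableAt (by simp)
  refine ⟨fun g => pullback_smul_boxSum h.form_invariant h'.form_invariant hg hg' g g⁻¹,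
    (h.smooth.comp contMDiff_fst).sub (h'.smooth.comp contMDiff_snd), fun g x => ?_,
    fun ξ x v => ?_⟩
  · change μ (g • x.1) - μ' (g⁻¹ • x.2) = μ x.1 - μ' x.2
    rw [h.invariant, h'.invariant]
  · obtain ⟨v₁, v₂⟩ := v
    -- The induced field on the product is (ξ_M, -ξ_M'). Its sign accounts for the minus sign in the
    -- difference of moment maps.
    have hvec : modelDeriv 𝓘(ℝ, EG) (I.prod I') (fun g : G => (g • x.1, g⁻¹ • x.2)) 1 ξ =
        (modelDeriv 𝓘(ℝ, EG) I (fun g : G => g • x.1) 1 ξ,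
          -modelDeriv 𝓘(ℝ, EG) I' (fun g : G => g • x.2) 1 ξ) := by
      have h1 : MDifferentiableAt 𝓘(ℝ, EG) I' (fun g : G => g⁻¹ • x.2) 1 :=
        (show MDifferentiableAt 𝓘(ℝ, EG) I' (fun g : G => g • x.2) (1 : G)⁻¹ by
          rw [inv_one]; exact ho' x.2).comp 1 hinv
      have h2 := modelDeriv_prodMk (ho x.1) h1 ξ
      have h3 : modelDeriv 𝓘(ℝ, EG) I' (fun g : G => g⁻¹ • x.2) 1 ξ = _ :=
        modelDeriv_comp_apply (ho' x.2) hinv inv_one ξ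
      rw [h3, modelDeriv_inv, map_neg] at h2
      exact h2
    have hfun : modelDeriv (I.prod I') 𝓘(ℝ, ℝ) (fun y : M × M' => (μ y.1 - μ' y.2) ξ) x (v₁, v₂) =
        modelDeriv I 𝓘(ℝ, ℝ) (fun y => μ y ξ) x.1 v₁ -
          modelDeriv I' 𝓘(ℝ, ℝ) (fun y => μ' y ξ) x.2 v₂ := by
      have h1 := modelDeriv_comp_apply (x := x) (f := Prod.fst) (h.mdifferentiableAt_eval ξ x.1)
        (mdifferentiableAt_fst (I := I) (I' := I')) rfl (v₁, v₂)
      have h2 := modelDeriv_comp_apply (x := x) (f := Prod.snd) (h'.mdifferentiableAt_eval ξ x.2)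
        (mdifferentiableAt_snd (I := I) (I' := I')) rfl (v₁, v₂)
      rw [modelDeriv_fst] at h1
      rw [modelDeriv_snd] at h2
      rw [← h1, ← h2]
      have h3 := mfderiv_sub (((h.mdifferentiableAt_eval ξ x.1).comp x
        (mdifferentiableAt_fst (I := I) (I' := I'))))
        (((h'.mdifferentiableAt_eval ξ x.2).comp x (mdifferentiableAt_snd (I := I) (I' := I'))))
      exact DFunLike.congr_fun h3 (v₁, v₂)
    change modelDeriv (I.prod I') 𝓘(ℝ, ℝ) (fun y : M × M' => (μ y.1 - μ' y.2) ξ) x (v₁, v₂) =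
      -(α.boxSum α').toModel x
        ![modelDeriv 𝓘(ℝ, EG) (I.prod I') (fun g : G => (g • x.1, g⁻¹ • x.2)) 1 ξ, (v₁, v₂)]
    rw [hfun, hvec, DiffForm.toModel_boxSum_two, h.modelDeriv_eq, h'.modelDeriv_eq,
      two_form_neg_left]
    ring

end MomentMap

/-! ### The restriction of σ + σ' to the fibre product is basic. -/

section ReducedForm

variable {EB HB B EP HP P EP' HP' P' EG G : Type*}
  [NormedAddCommGroup EB] [NormedSpace ℝ EB] [TopologicalSpace HB]
  [TopologicalSpace B] [ChartedSpace HB B]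
  [NormedAddCommGroup EP] [NormedSpace ℝ EP] [TopologicalSpace HP]
  [TopologicalSpace P] [ChartedSpace HP P]
  [NormedAddCommGroup EP'] [NormedSpace ℝ EP'] [TopologicalSpace HP']
  [TopologicalSpace P'] [ChartedSpace HP' P']
  [NormedAddCommGroup EG] [NormedSpace ℝ EG]
  [TopologicalSpace G] [ChartedSpace EG G] [CommGroup G] [MulAction G P] [MulAction G P']
  {IB : ModelWithCorners ℝ EB HB} {IP : ModelWithCorners ℝ EP HP} {IP' : ModelWithCorners ℝ EP' HP'}
  {π : P → B} {π' : P' → B} {ψ : B → (EG →L[ℝ] ℝ)} {σ : DiffForm IP P 2} {σ' : DiffForm IP' P' 2}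
  (hP : IsSymplecticToricBundle IB G ψ π σ) (hP' : IsSymplecticToricBundle IB G ψ π' σ')
  [IsManifold IB ∞ B] [LieGroup 𝓘(ℝ, EG) ∞ G]

namespace FiberProduct

/-- The restriction of `σ + σ'` to the fibre product. -/
abbrev restrictedForm (hP : IsSymplecticToricBundle IB G ψ π σ)
    (hP' : IsSymplecticToricBundle IB G ψ π' σ') :
    letI := chartedSpace hP.principal hP'.principal
    DiffForm (IB.prod (𝓘(ℝ, EG).prod 𝓘(ℝ, EG))) (FiberProduct π π') 2 :=
  letI := chartedSpace hP.principal hP'.principal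
  DiffForm.pullback (IB.prod (𝓘(ℝ, EG).prod 𝓘(ℝ, EG))) (IP.prod IP')
    (Subtype.val : FiberProduct π π' → P × P') (σ.boxSum σ')

lemma mdifferentiableAt_val (hP : IsPrincipalBundle 𝓘(ℝ, EG) IB IP G π)
    (hP' : IsPrincipalBundle 𝓘(ℝ, EG) IB IP' G π') (x : FiberProduct π π') :
    letI := chartedSpace hP hP'
    MDifferentiableAt (IB.prod (𝓘(ℝ, EG).prod 𝓘(ℝ, EG))) (IP.prod IP')
      (Subtype.val : FiberProduct π π' → P × P') x :=
  letI := chartedSpace hP hP'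
  (contMDiff_val hP hP' x).mdifferentiableAt (by simp)

lemma pullback_smul_restrictedForm (a : G × G) :
    letI := chartedSpace hP.principal hP'.principal
    letI := fiberProductAction hP.principal.proj_smul hP'.principal.proj_smul
    DiffForm.pullback (IB.prod (𝓘(ℝ, EG).prod 𝓘(ℝ, EG))) (IB.prod (𝓘(ℝ, EG).prod 𝓘(ℝ, EG)))
      (fun x : FiberProduct π π' => a • x) (restrictedForm hP hP') = restrictedForm hP hP' := by
  let := chartedSpace hP.principal hP'.principal
  let := fiberProductAction hP.principal.proj_smul hP'.principal.proj_smul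
  funext x
  have hF := isPrincipalBundle hP.principal hP'.principal
  have hv := mdifferentiableAt_val hP.principal hP'.principal
  rw [restrictedForm, ← DiffForm.pullback_comp_apply (hv _) (hF.mdifferentiableAt_const_smul a x)]
  have h1 : Subtype.val ∘ (fun x : FiberProduct π π' => a • x) =
      (fun z : P × P' => (a.1 • z.1, a.2 • z.2)) ∘ Subtype.val := rfl
  have h2 : MDifferentiableAt (IP.prod IP') (IP.prod IP')
      (fun z : P × P' => (a.1 • z.1, a.2 • z.2)) x.1 :=
    ((hP.principal.mdifferentiableAt_const_smul a.1 x.1.1).comp x.1 mdifferentiableAt_fst).prodMk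
    ((hP'.principal.mdifferentiableAt_const_smul a.2 x.1.2).comp x.1 mdifferentiableAt_snd)
  rw [h1, DiffForm.pullback_comp_apply h2 (hv x),
    pullback_smul_boxSum hP.moment.form_invariant hP'.moment.form_invariant
      hP.principal.mdifferentiableAt_const_smul hP'.principal.mdifferentiableAt_const_smul]

/-- Contracting σ + σ' with an antidiagonal field gives -d⟨μ, ξ⟩, and μ vanishes identically on the
fibre product. -/
lemma restrictedForm_horizontal (ξ : EG) (x : FiberProduct π π') :
    letI := chartedSpace hP.principal hP'.principal
    letI := fiberProductAntidiagonalAction hP.principal.proj_smul hP'.principal.proj_smul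
    ∀ v : EB × EG × EG, (restrictedForm hP hP').toModel x
      ![modelDeriv 𝓘(ℝ, EG) (IB.prod (𝓘(ℝ, EG).prod 𝓘(ℝ, EG))) (fun g : G => g • x) 1 ξ, v] = 0 := by
  let := chartedSpace hP.principal hP'.principal
  let := BundleTensor.chartedSpace hP.principal hP'.principal
  let := fiberProductAntidiagonalAction hP.principal.proj_smul hP'.principal.proj_smul
  let := antidiagonalAction G P P'
  intro v
  have hQ := BundleTensor.orbit_isPrincipalBundle hP.principal hP'.principal
  have hv := mdifferentiableAt_val hP.principal hP'.principal x
  have hm := hP.moment.antidiagonal hP'.moment hP.principal.smul_smooth hP'.principal.smul_smooth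
  have h1 := DiffForm.toModel_pullback_two (I := IB.prod (𝓘(ℝ, EG).prod 𝓘(ℝ, EG)))
    (Subtype.val : FiberProduct π π' → P × P') (σ.boxSum σ') x
    (modelDeriv 𝓘(ℝ, EG) (IB.prod (𝓘(ℝ, EG).prod 𝓘(ℝ, EG))) (fun g : G => g • x) 1 ξ) v
  refine h1.trans ?_
  rw [← modelDeriv_comp_apply hv (hQ.mdifferentiableAt_smul_const x 1) (one_smul G x)]
  have h2 := hm.modelDeriv_eq ξ x.1 (modelDeriv (IB.prod (𝓘(ℝ, EG).prod 𝓘(ℝ, EG))) (IP.prod IP')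
    (Subtype.val : FiberProduct π π' → P × P') x v)
  have h4 := modelDeriv_comp_apply (hm.mdifferentiableAt_eval ξ x.1) hv rfl v
  have h3 : (fun y : P × P' => ((ψ ∘ π) y.1 - (ψ ∘ π') y.2) ξ) ∘
      (Subtype.val : FiberProduct π π' → P × P') = fun _ => 0 := by
    funext y
    change (ψ (π y.1.1) - ψ (π' y.1.2)) ξ = 0
    rw [y.2, sub_self]
    rfl
  rw [h3, modelDeriv_const] at h4
  exact neg_eq_zero.1 (h4.trans h2).symm

end FiberProduct

namespace BundleTensor

/-- The restriction of `σ + σ'` to the fibre product descends to the tensor product. -/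
lemma exists_reducedForm :
    letI := FiberProduct.chartedSpace hP.principal hP'.principal
    letI := chartedSpace hP.principal hP'.principal
    ∃ τ : DiffForm (IB.prod 𝓘(ℝ, EG))
      (BundleTensor hP.principal.proj_smul hP'.principal.proj_smul) 2,
      DiffForm.pullback (IB.prod (𝓘(ℝ, EG).prod 𝓘(ℝ, EG))) (IB.prod 𝓘(ℝ, EG))
        (mk hP.principal.proj_smul hP'.principal.proj_smul) τ =
      FiberProduct.restrictedForm hP hP' := by
  let := FiberProduct.chartedSpace hP.principal hP'.principal
  let := chartedSpace hP.principal hP'.principal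
  let := fiberProductAntidiagonalAction hP.principal.proj_smul hP'.principal.proj_smul
  exact (orbit_isPrincipalBundle hP.principal hP'.principal).exists_pullback_eq
    (fun g => FiberProduct.pullback_smul_restrictedForm hP hP' (g, g⁻¹))
    (FiberProduct.restrictedForm_horizontal hP hP')

end BundleTensor

end ReducedForm

/-! ### Nondegeneracy deduced from the moment map. -/

section MomentMapNondegenerate

variable {EB HB B EP HP P EG G : Type*}
  [NormedAddCommGroup EB] [NormedSpace ℝ EB] [TopologicalSpace HB]
  [TopologicalSpace B] [ChartedSpace HB B]
  [NormedAddCommGroup EP] [NormedSpace ℝ EP] [TopologicalSpace HP]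
  [TopologicalSpace P] [ChartedSpace HP P]
  [NormedAddCommGroup EG] [NormedSpace ℝ EG]
  [TopologicalSpace G] [ChartedSpace EG G] [CommGroup G] [MulAction G P]
  {IB : ModelWithCorners ℝ EB HB} {IP : ModelWithCorners ℝ EP HP}
  {π : P → B} {ψ : B → (EG →L[ℝ] ℝ)} {σ : DiffForm IP P 2}

/-- The derivative of a component of a map to the dual of the Lie algebra. -/
lemma modelDeriv_eval {b : B} (hψ : MDifferentiableAt IB 𝓘(ℝ, EG →L[ℝ] ℝ) ψ b) (ξ : EG) (v : EB) :
    modelDeriv IB 𝓘(ℝ, ℝ) (fun y => ψ y ξ) b v =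
      (modelDeriv IB 𝓘(ℝ, EG →L[ℝ] ℝ) ψ b v) ξ := by
  have h1 : MDifferentiableAt 𝓘(ℝ, EG →L[ℝ] ℝ) 𝓘(ℝ, ℝ)
      (ContinuousLinearMap.apply ℝ ℝ ξ) (ψ b) :=
    (ContinuousLinearMap.apply ℝ ℝ ξ).mdifferentiableAt
  refine (modelDeriv_comp_apply h1 hψ rfl v).trans ?_
  change mfderiv 𝓘(ℝ, EG →L[ℝ] ℝ) 𝓘(ℝ, ℝ) (ContinuousLinearMap.apply ℝ ℝ ξ) (ψ b) _ = _
  rw [ContinuousLinearMap.mfderiv_eq]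
  rfl

/-- On the total space of a symplectic toric principal bundle the components of `ψ` have linearly
independent differentials. -/
lemma IsSymplecticToricBundle.eq_zero_of_modelDeriv_eval_eq_zero [LieGroup 𝓘(ℝ, EG) ∞ G]
    (hP : IsSymplecticToricBundle IB G ψ π σ) (hψ : ContMDiff IB 𝓘(ℝ, EG →L[ℝ] ℝ) ∞ ψ) {b : B}
    {ξ : EG} (h : ∀ v, modelDeriv IB 𝓘(ℝ, ℝ) (fun y => ψ y ξ) b v = 0) : ξ = 0 := by
  obtain ⟨p, rfl⟩ := hP.principal.surjective b
  -- The contraction of σ with ξ_P is minus the pullback of d⟨ψ, ξ⟩, which is zero at p. So ξ_P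
  -- vanishes at p, and freeness of the infinitesimal action gives ξ = 0.
  refine hP.principal.injective_vertical p ?_
  rw [map_zero]
  refine hP.symplectic.nondegenerate p _ fun w => ?_
  have h1 := hP.moment.modelDeriv_eq ξ p w
  have h2 := modelDeriv_comp_apply (x := p)
    ((contMDiff_eval hψ ξ (π p)).mdifferentiableAt (by simp)) (hP.principal.mdifferentiableAt_proj p)
    rfl w
  rw [h] at h2
  exact neg_eq_zero.1 (h1.symm.trans h2)

/-- An invariant form with a moment map pulled back from the base of a principal bundle is
nondegenerate if the map on the base is an immersion whose components have independent
differentials. -/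
lemma IsMomentMap.nondegenerate [LieGroup 𝓘(ℝ, EG) ∞ G] (hm : IsMomentMap G σ (ψ ∘ π))
    (hP : IsPrincipalBundle 𝓘(ℝ, EG) IB IP G π) (hψ : ContMDiff IB 𝓘(ℝ, EG →L[ℝ] ℝ) ∞ ψ)
    (hinj : ∀ b, Function.Injective (modelDeriv IB 𝓘(ℝ, EG →L[ℝ] ℝ) ψ b))
    (hind : ∀ (b : B) (ξ : EG), (∀ v, modelDeriv IB 𝓘(ℝ, ℝ) (fun y => ψ y ξ) b v = 0) → ξ = 0)
    (p : P) (v : EP) (hv : ∀ w : EP, σ.toModel p ![v, w] = 0) : v = 0 := by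
  have hd : ∀ (ξ : EG) (w : EP), modelDeriv IB 𝓘(ℝ, ℝ) (fun y => ψ y ξ) (π p)
      (modelDeriv IP IB π p w) =
      -σ.toModel p ![modelDeriv 𝓘(ℝ, EG) IP (fun g : G => g • p) 1 ξ, w] := by
    intro ξ w
    rw [← hm.modelDeriv_eq ξ p w]
    exact (modelDeriv_comp_apply (x := p)
      ((contMDiff_eval hψ ξ (π p)).mdifferentiableAt (by simp)) (hP.mdifferentiableAt_proj p)
      rfl w).symm
  -- Pairing v with every vertical vector gives d⟨ψ, ξ⟩(dπ v) = 0 for all ξ, that is dψ(dπ v) = 0,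
  -- and ψ is an immersion.
  have h0 : modelDeriv IP IB π p v = 0 := by
    refine hinj (π p) ?_
    rw [map_zero]
    ext ξ
    rw [← modelDeriv_eval ((hψ (π p)).mdifferentiableAt (by simp)), hd, two_form_swap, hv]
    simp
  obtain ⟨ξ, rfl⟩ := hP.exists_vertical h0
  -- Now v is generated by ξ and lies in the radical, so d⟨ψ, ξ⟩ vanishes on every dπ w, hence on
  -- the whole tangent space of the base.
  have hξ : ξ = 0 := by
    refine hind (π p) ξ fun u => ?_
    obtain ⟨w, rfl⟩ := hP.mfderiv_proj_surjective p u
    rw [hd, hv, neg_zero]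
  rw [hξ, map_zero]

end MomentMapNondegenerate

/-! ### Descent of smoothness and closedness. -/

section Descent

variable {EB HB B EP HP P EG G : Type*}
  [NormedAddCommGroup EB] [NormedSpace ℝ EB] [TopologicalSpace HB]
  [TopologicalSpace B] [ChartedSpace HB B]
  [NormedAddCommGroup EP] [NormedSpace ℝ EP] [TopologicalSpace HP]
  [TopologicalSpace P] [ChartedSpace HP P]
  [NormedAddCommGroup EG] [NormedSpace ℝ EG]
  [TopologicalSpace G] [ChartedSpace EG G] [CommGroup G] [MulAction G P]
  {IB : ModelWithCorners ℝ EB HB} {IP : ModelWithCorners ℝ EP HP}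
  {π : P → B} [IsManifold IB ∞ B] [IsManifold IP ∞ P] {k : ℕ}

/-- A form on the base of a principal bundle is smooth and closed if its pullback is. -/
lemma IsPrincipalBundle.isSmooth_and_isClosed_of_pullback [LieGroup 𝓘(ℝ, EG) ∞ G]
    (hP : IsPrincipalBundle 𝓘(ℝ, EG) IB IP G π) {τ : DiffForm IB B k}
    (h : ∀ p, (DiffForm.pullback IP IB π τ).IsSmoothClosedAt p) : τ.IsSmooth ∧ τ.IsClosed := by
  obtain ⟨hs, hc⟩ := DiffForm.isSmooth_and_isClosed_iff.2 h
  refine DiffForm.isSmooth_and_isClosed_iff.2 fun b => ?_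
  obtain ⟨p, rfl⟩ := hP.surjective b
  let S := hP.slice p
  -- Near π p, the form τ is the pullback of π^*τ along the slice s, because π ∘ s = id.
  refine (DiffForm.isSmoothClosedAt_pullback hs hc S.isOpen S.smooth_s S.mem).congr ?_
  filter_upwards [S.isOpen.mem_nhds S.mem] with c hc
  rw [← DiffForm.pullback_comp_apply (hP.mdifferentiableAt_proj _) (S.mdifferentiableAt_s hc)]
  have h1 : π ∘ S.s =ᶠ[𝓝 c] id := by
    filter_upwards [S.isOpen.mem_nhds hc] with d hd using S.proj_s d hd
  rw [DiffForm.pullback_congr_map h1, DiffForm.pullback_id]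

end Descent

/-! ### The reduced form makes the tensor product a symplectic toric bundle. -/

section Tensor

variable {EB HB B EP HP P EP' HP' P' EG G : Type*}
  [NormedAddCommGroup EB] [NormedSpace ℝ EB] [TopologicalSpace HB]
  [TopologicalSpace B] [ChartedSpace HB B]
  [NormedAddCommGroup EP] [NormedSpace ℝ EP] [TopologicalSpace HP]
  [TopologicalSpace P] [ChartedSpace HP P]
  [NormedAddCommGroup EP'] [NormedSpace ℝ EP'] [TopologicalSpace HP']
  [TopologicalSpace P'] [ChartedSpace HP' P']
  [NormedAddCommGroup EG] [NormedSpace ℝ EG]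
  [TopologicalSpace G] [ChartedSpace EG G] [CommGroup G] [MulAction G P] [MulAction G P']
  {IB : ModelWithCorners ℝ EB HB} {IP : ModelWithCorners ℝ EP HP} {IP' : ModelWithCorners ℝ EP' HP'}
  {π : P → B} {π' : P' → B} {ψ : B → (EG →L[ℝ] ℝ)} {σ : DiffForm IP P 2} {σ' : DiffForm IP' P' 2}
  (hP : IsSymplecticToricBundle IB G ψ π σ) (hP' : IsSymplecticToricBundle IB G ψ π' σ')
  [IsManifold IB ∞ B] [LieGroup 𝓘(ℝ, EG) ∞ G]

namespace FiberProduct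

/-- The restricted form is the sum of the pullbacks of σ and σ' along the projections of the fibre
product to P and P'. -/
lemma isSmoothClosedAt_restrictedForm (x : FiberProduct π π') :
    letI := chartedSpace hP.principal hP'.principal
    (restrictedForm hP hP').IsSmoothClosedAt x := by
  let := chartedSpace hP.principal hP'.principal
  let := fiberProductAction hP.principal.proj_smul hP'.principal.proj_smul
  have := hP.manifold.isManifold
  have := hP'.manifold.isManifold
  have : IsManifold (IB.prod (𝓘(ℝ, EG).prod 𝓘(ℝ, EG))) ∞ (FiberProduct π π') :=
    (atlas hP.principal hP'.principal).isManifold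
  have hv := contMDiff_val hP.principal hP'.principal
  have h1 := DiffForm.isSmoothClosedAt_pullback hP.symplectic.smooth hP.symplectic.closed
    isOpen_univ (contMDiff_fst.comp hv).contMDiffOn (mem_univ x)
  have h2 := DiffForm.isSmoothClosedAt_pullback hP'.symplectic.smooth hP'.symplectic.closed
    isOpen_univ (contMDiff_snd.comp hv).contMDiffOn (mem_univ x)
  refine (h1.add h2).congr (Filter.Eventually.of_forall fun y => ?_)
  exact DiffForm.pullback_boxSum σ σ' (mdifferentiableAt_val hP.principal hP'.principal y)

end FiberProduct

namespace BundleTensor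

variable (hψ : ContMDiff IB 𝓘(ℝ, EG →L[ℝ] ℝ) ∞ ψ)
include hψ

/-- The orbit map is a submersion, so all identities may be checked on the fibre product. There the
action of a lifts to that of (a, 1), whose induced field (ξ_P, 0) sees only σ; the equation becomes
the moment map equation of P. -/
lemma isMomentMap_of_pullback_eq :
    letI := FiberProduct.chartedSpace hP.principal hP'.principal
    letI := chartedSpace hP.principal hP'.principal
    letI := action hP.principal.proj_smul hP'.principal.proj_smul
    ∀ τ : DiffForm (IB.prod 𝓘(ℝ, EG))
      (BundleTensor hP.principal.proj_smul hP'.principal.proj_smul) 2,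
      DiffForm.pullback (IB.prod (𝓘(ℝ, EG).prod 𝓘(ℝ, EG))) (IB.prod 𝓘(ℝ, EG))
        (mk hP.principal.proj_smul hP'.principal.proj_smul) τ =
      FiberProduct.restrictedForm hP hP' →
      IsMomentMap G τ (ψ ∘ proj hP.principal.proj_smul hP'.principal.proj_smul) := by
  let := FiberProduct.chartedSpace hP.principal hP'.principal
  let := chartedSpace hP.principal hP'.principal
  let := action hP.principal.proj_smul hP'.principal.proj_smul
  let := fiberProductAction hP.principal.proj_smul hP'.principal.proj_smul
  let := fiberProductAntidiagonalAction hP.principal.proj_smul hP'.principal.proj_smul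
  intro τ hτ
  have hF := FiberProduct.isPrincipalBundle hP.principal hP'.principal
  have hT := isPrincipalBundle hP.principal hP'.principal
  have hQ := orbit_isPrincipalBundle hP.principal hP'.principal
  have hv := FiberProduct.mdifferentiableAt_val hP.principal hP'.principal
  refine ⟨fun a => ?_, hψ.comp hT.proj_smooth, fun a t => congrArg ψ (hT.proj_smul a t), ?_⟩
  · funext t
    obtain ⟨x, rfl⟩ := hQ.surjective t
    refine DiffForm.eq_of_pullback_eq (hQ.mfderiv_proj_surjective x) ?_
    rw [← DiffForm.pullback_comp_apply (hT.mdifferentiableAt_const_smul a _)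
      (hQ.mdifferentiableAt_proj x), hτ,
      ← FiberProduct.pullback_smul_restrictedForm hP hP' (a, 1), ← hτ,
      ← DiffForm.pullback_comp_apply (hQ.mdifferentiableAt_proj _)
      (hF.mdifferentiableAt_const_smul (a, 1) x)]
    congr 1
    funext y
    refine congrArg (mk _ _) (Subtype.ext (Prod.ext rfl ?_))
    exact (one_smul G _).symm
  · suffices h : ∀ (ξ : EG) (t : BundleTensor hP.principal.proj_smul hP'.principal.proj_smul)
        (v : EB × EG), modelDeriv (IB.prod 𝓘(ℝ, EG)) 𝓘(ℝ, ℝ)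
        (fun y => ψ (proj hP.principal.proj_smul hP'.principal.proj_smul y) ξ) t v =
        -τ.toModel t ![modelDeriv 𝓘(ℝ, EG) (IB.prod 𝓘(ℝ, EG)) (fun g : G => g • t) 1 ξ, v] from h
    intro ξ t v
    obtain ⟨x, rfl⟩ := hQ.surjective t
    obtain ⟨w, rfl⟩ := hQ.mfderiv_proj_surjective x v
    have horb : ContMDiff 𝓘(ℝ, EG) (IB.prod (𝓘(ℝ, EG).prod 𝓘(ℝ, EG))) ∞
        (fun g : G => ((g, 1) : G × G) • x) :=
      (hF.contMDiff_smul_const x).comp (contMDiff_id.prodMk contMDiff_const)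
    have horb' : MDifferentiableAt 𝓘(ℝ, EG) (IB.prod (𝓘(ℝ, EG).prod 𝓘(ℝ, EG)))
        (fun g : G => ((g, 1) : G × G) • x) 1 := (horb 1).mdifferentiableAt (by simp)
    set u := modelDeriv 𝓘(ℝ, EG) (IB.prod (𝓘(ℝ, EG).prod 𝓘(ℝ, EG)))
      (fun g : G => ((g, 1) : G × G) • x) 1 ξ with hu
    have hx1 : ((1, 1) : G × G) • x = x := one_smul (G × G) x
    have h1 : modelDeriv 𝓘(ℝ, EG) (IB.prod 𝓘(ℝ, EG))
        (fun g : G => g • mk hP.principal.proj_smul hP'.principal.proj_smul x) 1 ξ =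
        modelDeriv (IB.prod (𝓘(ℝ, EG).prod 𝓘(ℝ, EG))) (IB.prod 𝓘(ℝ, EG))
          (mk hP.principal.proj_smul hP'.principal.proj_smul) x u := by
      rw [hu, ← modelDeriv_comp_apply (hQ.mdifferentiableAt_proj x) horb' hx1]
      congr 2
      funext g
      refine congrArg (mk _ _) (Subtype.ext (Prod.ext rfl ?_))
      exact (one_smul G _).symm
    have h2 : modelDeriv (IB.prod (𝓘(ℝ, EG).prod 𝓘(ℝ, EG))) (IP.prod IP')
        (Subtype.val : FiberProduct π π' → P × P') x u =
        (modelDeriv 𝓘(ℝ, EG) IP (fun g : G => g • x.1.1) 1 ξ, 0) := by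
      rw [hu, ← modelDeriv_comp_apply (hv x) horb' hx1]
      have h3 : Subtype.val ∘ (fun g : G => ((g, 1) : G × G) • x) =
          fun g : G => (g • x.1.1, x.1.2) :=
        funext fun g => Prod.ext rfl (one_smul G _)
      have h4 : MDifferentiableAt 𝓘(ℝ, EG) IP' (fun _ : G => x.1.2) 1 := mdifferentiableAt_const
      rw [h3, modelDeriv_prodMk (hP.principal.mdifferentiableAt_smul_const x.1.1 1) h4,
        modelDeriv_const]
    rw [h1, ← DiffForm.toModel_pullback_two, hτ, FiberProduct.restrictedForm,
      DiffForm.toModel_pullback_two, h2, DiffForm.toModel_boxSum_two]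
    have h5 : ∀ z : EP', σ'.toModel x.1.2 ![0, z] = 0 := fun z => by
      simpa using two_form_smul_left (σ'.toModel x.1.2) 0 0 z
    rw [h5, add_zero, ← hP.moment.modelDeriv_eq]
    have h6 : ∀ z : EP × EP', z.1 = modelDeriv (IP.prod IP') IP Prod.fst x.1 z := fun z =>
      (modelDeriv_fst x.1 z).symm
    have hfst : MDifferentiableAt (IP.prod IP') IP Prod.fst x.1 := mdifferentiableAt_fst
    rw [h6, ← modelDeriv_comp_apply hfst (hv x) rfl,
      ← modelDeriv_comp_apply (hP.moment.mdifferentiableAt_eval ξ x.1.1)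
        (hfst.comp x (hv x)) rfl]
    exact (modelDeriv_comp_apply ((contMDiff_eval (hψ.comp hT.proj_smooth) ξ _).mdifferentiableAt
      (by simp)) (hQ.mdifferentiableAt_proj x) rfl w).symm

/-- The tensor product of symplectic toric principal bundles is a symplectic toric principal
bundle. -/
lemma isSymplecticToricBundle_of_pullback_eq [T2Space B] [T2Space G]
    (hinj : ∀ b, Function.Injective (modelDeriv IB 𝓘(ℝ, EG →L[ℝ] ℝ) ψ b)) :
    letI := FiberProduct.chartedSpace hP.principal hP'.principal
    letI := chartedSpace hP.principal hP'.principal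
    letI := action hP.principal.proj_smul hP'.principal.proj_smul
    ∀ τ : DiffForm (IB.prod 𝓘(ℝ, EG))
      (BundleTensor hP.principal.proj_smul hP'.principal.proj_smul) 2,
      DiffForm.pullback (IB.prod (𝓘(ℝ, EG).prod 𝓘(ℝ, EG))) (IB.prod 𝓘(ℝ, EG))
        (mk hP.principal.proj_smul hP'.principal.proj_smul) τ =
      FiberProduct.restrictedForm hP hP' →
      IsSymplecticToricBundle IB G ψ (proj hP.principal.proj_smul hP'.principal.proj_smul) τ := by
  let := FiberProduct.chartedSpace hP.principal hP'.principal
  let := chartedSpace hP.principal hP'.principal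
  let := action hP.principal.proj_smul hP'.principal.proj_smul
  let := fiberProductAction hP.principal.proj_smul hP'.principal.proj_smul
  let := fiberProductAntidiagonalAction hP.principal.proj_smul hP'.principal.proj_smul
  intro τ hτ
  have := hP.manifold.secondCountable
  have := hP'.manifold.secondCountable
  have : IsManifold (IB.prod (𝓘(ℝ, EG).prod 𝓘(ℝ, EG))) ∞ (FiberProduct π π') :=
    (FiberProduct.atlas hP.principal hP'.principal).isManifold
  have hM := isSmoothManifold hP.principal hP'.principal
  have := hM.isManifold
  have hT := isPrincipalBundle hP.principal hP'.principal
  have hm := isMomentMap_of_pullback_eq hP hP' hψ τ hτ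
  have hsc := (orbit_isPrincipalBundle hP.principal hP'.principal).isSmooth_and_isClosed_of_pullback
    (τ := τ) fun x => by
      rw [hτ]
      exact FiberProduct.isSmoothClosedAt_restrictedForm hP hP' x
  -- Independence of the differentials of the components of ψ concerns the base alone, and is
  -- supplied by the symplectic form on P.
  exact ⟨hM, hT, ⟨hsc.1, hsc.2, fun t v hv => hm.nondegenerate hT hψ hinj
    (fun b ξ h => hP.eq_zero_of_modelDeriv_eval_eq_zero hψ h) t v hv⟩, hm⟩

omit hψ in
lemma isReduction_of_pullback_eq [T2Space B] [T2Space G] :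
    letI := FiberProduct.chartedSpace hP.principal hP'.principal
    letI := chartedSpace hP.principal hP'.principal
    ∀ τ : DiffForm (IB.prod 𝓘(ℝ, EG))
      (BundleTensor hP.principal.proj_smul hP'.principal.proj_smul) 2,
      DiffForm.pullback (IB.prod (𝓘(ℝ, EG).prod 𝓘(ℝ, EG))) (IB.prod 𝓘(ℝ, EG))
        (mk hP.principal.proj_smul hP'.principal.proj_smul) τ =
      FiberProduct.restrictedForm hP hP' →
      IsReduction IB σ σ' hP.principal.proj_smul hP'.principal.proj_smul
        (FiberProduct.chartedSpace hP.principal hP'.principal)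
        (chartedSpace hP.principal hP'.principal) τ := by
  intro τ hτ
  have := hP.manifold.t2
  have := hP'.manifold.t2
  have := hP.manifold.secondCountable
  have := hP'.manifold.secondCountable
  exact ⟨FiberProduct.isSmoothManifold hP.principal hP'.principal,
    FiberProduct.contMDiff_val hP.principal hP'.principal,
    FiberProduct.injective_modelDeriv_val hP.principal hP'.principal,
    FiberProduct.isPrincipalBundle hP.principal hP'.principal,
    isSmoothManifold hP.principal hP'.principal,
    orbit_isPrincipalBundle hP.principal hP'.principal, hτ⟩

end BundleTensor

end Tensor

/-! ### Maps and forms on the base are determined on the total space. -/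

section Uniqueness

variable {EB HB B EP HP P EG HG G EN HN N EB' HB' B' EP' HP' P' : Type*}
  [NormedAddCommGroup EB] [NormedSpace ℝ EB] [TopologicalSpace HB] [TopologicalSpace B]
  [NormedAddCommGroup EP] [NormedSpace ℝ EP] [TopologicalSpace HP] [TopologicalSpace P]
  [NormedAddCommGroup EB'] [NormedSpace ℝ EB'] [TopologicalSpace HB'] [TopologicalSpace B']
  [NormedAddCommGroup EP'] [NormedSpace ℝ EP'] [TopologicalSpace HP'] [TopologicalSpace P']
  [NormedAddCommGroup EN] [NormedSpace ℝ EN] [TopologicalSpace HN] [TopologicalSpace N]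
  [NormedAddCommGroup EG] [NormedSpace ℝ EG] [TopologicalSpace HG]
  [TopologicalSpace G] [ChartedSpace HG G] [CommGroup G] [MulAction G P]
  {IG : ModelWithCorners ℝ EG HG} {IB : ModelWithCorners ℝ EB HB} {IP : ModelWithCorners ℝ EP HP}
  {IB' : ModelWithCorners ℝ EB' HB'} {IP' : ModelWithCorners ℝ EP' HP'}
  {IN : ModelWithCorners ℝ EN HN} {π : P → B} {π' : P' → B'} {k : ℕ}
  {cB : ChartedSpace HB B} {cP : ChartedSpace HP P} {cN : ChartedSpace HN N}
  {cB' : ChartedSpace HB' B'} {cP' : ChartedSpace HP' P'}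

/-- A map on the base of a principal bundle is smooth if its composition with the projection is. -/
lemma IsPrincipalBundle.contMDiff_of_comp_proj [LieGroup IG ∞ G]
    (hP : IsPrincipalBundle IG IB IP G π) {f : B → N} (hf : ContMDiff IP IN ∞ (f ∘ π)) :
    ContMDiff IB IN ∞ f := by
  intro b
  obtain ⟨p, rfl⟩ := hP.surjective b
  let S := hP.slice p
  refine ((hf.comp_contMDiffOn S.smooth_s).congr fun b hb => ?_).contMDiffAt
    (S.isOpen.mem_nhds S.mem)
  exact congrArg f (S.proj_s b hb).symm

/-- A map of the bases of two bundles, covered by a map of the total spaces compatible with maps to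
a manifold `N`, intertwines forms on the bases whose pullbacks come from the same form on `N`. -/
lemma IsPrincipalBundle.pullback_eq_of_lift [LieGroup IG ∞ G]
    (hP : IsPrincipalBundle IG IB IP G π) (hπ' : MDifferentiable IP' IB' π')
    {f : P → P'} {h : B → B'} {j : P → N} {j' : P' → N} (hf : MDifferentiable IP IP' f)
    (hh : MDifferentiable IB IB' h) (hj' : MDifferentiable IP' IN j') (hfh : h ∘ π = π' ∘ f)
    (hjf : j = j' ∘ f) {τ : DiffForm IB B k} {τ' : DiffForm IB' B' k} {β : DiffForm IN N k}
    (hτ : DiffForm.pullback IP IB π τ = DiffForm.pullback IP IN j β)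
    (hτ' : DiffForm.pullback IP' IB' π' τ' = DiffForm.pullback IP' IN j' β) :
    DiffForm.pullback IB IB' h τ' = τ := by
  funext b
  obtain ⟨p, rfl⟩ := hP.surjective b
  refine DiffForm.eq_of_pullback_eq (hP.mfderiv_proj_surjective p) ?_
  -- On the total space: π^*h^*τ' = f^*π'^*τ' = f^*j'^*β = j^*β = π^*τ.
  rw [← DiffForm.pullback_comp_apply (hh _) (hP.mdifferentiableAt_proj p), hfh,
    DiffForm.pullback_comp_apply (hπ' _) (hf p), hτ', ← DiffForm.pullback_comp_apply (hj' _) (hf p),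
    ← hjf, hτ]

end Uniqueness

/-! ### Comparison of two reductions. -/

section TwoQuotients

variable {EB HB B EF HF F F' ET HT T T' EN HN N EG G EK HK K : Type*}
  [NormedAddCommGroup EB] [NormedSpace ℝ EB] [TopologicalSpace HB] [TopologicalSpace B]
  [ChartedSpace HB B]
  [NormedAddCommGroup EF] [NormedSpace ℝ EF] [TopologicalSpace HF] [TopologicalSpace F]
  [TopologicalSpace F']
  [NormedAddCommGroup ET] [NormedSpace ℝ ET] [TopologicalSpace HT] [TopologicalSpace T]
  [TopologicalSpace T']
  [NormedAddCommGroup EN] [NormedSpace ℝ EN] [TopologicalSpace HN] [TopologicalSpace N]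
  [ChartedSpace HN N]
  [NormedAddCommGroup EG] [NormedSpace ℝ EG] [TopologicalSpace G] [ChartedSpace EG G] [CommGroup G]
  [NormedAddCommGroup EK] [NormedSpace ℝ EK] [TopologicalSpace HK] [TopologicalSpace K]
  [ChartedSpace HK K] [CommGroup K] [MulAction G F] [MulAction G F'] [MulAction K F]
  [MulAction K F'] {IB : ModelWithCorners ℝ EB HB} {IF : ModelWithCorners ℝ EF HF}
  {IT : ModelWithCorners ℝ ET HT} {IN : ModelWithCorners ℝ EN HN} {IK : ModelWithCorners ℝ EK HK}
  {cF : ChartedSpace HF F} {cF' : ChartedSpace HF F'} {cT : ChartedSpace HT T}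
  {cT' : ChartedSpace HT T'} [LieGroup 𝓘(ℝ, EG) ∞ G] [LieGroup IK ∞ K]

/-- A smooth isomorphism of principal bundles over `B` which covers a bijection of quotient
manifolds has a smooth inverse, and induces a diffeomorphism of the quotients compatible with
reduced forms. -/
lemma contMDiff_and_pullback_eq_of_bundleMap {k : ℕ} {ρ : F → B} {ρ' : F' → B} {q : F → T}
    {q' : F' → T'} {j : F → N} {j' : F' → N} {f : F → F'} {f' : F' → F} {h : T → T'} {h' : T' → T}
    (hρ : IsPrincipalBundle IK IB IF K ρ) (hρ' : IsPrincipalBundle IK IB IF K ρ')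
    (hq : IsPrincipalBundle 𝓘(ℝ, EG) IT IF G q) (hq' : IsPrincipalBundle 𝓘(ℝ, EG) IT IF G q')
    (hj' : ContMDiff IF IN ∞ j') (hf' : ContMDiff IF IF ∞ f') (hρf : ∀ x, ρ (f' x) = ρ' x)
    (hf'g : ∀ (g : K) (x : F'), f' (g • x) = g • f' x) (hff : ∀ x, f' (f x) = x)
    (hqf : h ∘ q = q' ∘ f) (hqf' : h' ∘ q' = q ∘ f') (hjf : j = j' ∘ f)
    {τ : DiffForm IT T k} {τ' : DiffForm IT T' k} {β : DiffForm IN N k}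
    (hτ : DiffForm.pullback IF IT q τ = DiffForm.pullback IF IN j β)
    (hτ' : DiffForm.pullback IF IT q' τ' = DiffForm.pullback IF IN j' β) :
    ContMDiff IF IF ∞ f ∧ ContMDiff IT IT ∞ h ∧ ContMDiff IT IT ∞ h' ∧
      DiffForm.pullback IT IT h τ' = τ := by
  have hf : ContMDiff IF IF ∞ f := contMDiff_inverse_bundleMap hρ' hρ hf' hρf hf'g hff
  have hh : ContMDiff IT IT ∞ h := hq.contMDiff_of_comp_proj (by
    rw [hqf]; exact hq'.proj_smooth.comp hf)
  have hh' : ContMDiff IT IT ∞ h' := hq'.contMDiff_of_comp_proj (by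
    rw [hqf']; exact hq.proj_smooth.comp hf')
  exact ⟨hf, hh, hh', hq.pullback_eq_of_lift (hq'.proj_smooth.mdifferentiable (by simp))
    (hf.mdifferentiable (by simp)) (hh.mdifferentiable (by simp)) (hj'.mdifferentiable (by simp))
    hqf hjf hτ hτ'⟩

end TwoQuotients

section TensorUniqueness

variable {EB HB B EP HP P EP' HP' P' EG G : Type*}
  [NormedAddCommGroup EB] [NormedSpace ℝ EB] [TopologicalSpace HB]
  [TopologicalSpace B] [ChartedSpace HB B]
  [NormedAddCommGroup EP] [NormedSpace ℝ EP] [TopologicalSpace HP]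
  [TopologicalSpace P] [ChartedSpace HP P]
  [NormedAddCommGroup EP'] [NormedSpace ℝ EP'] [TopologicalSpace HP']
  [TopologicalSpace P'] [ChartedSpace HP' P']
  [NormedAddCommGroup EG] [NormedSpace ℝ EG]
  [TopologicalSpace G] [ChartedSpace EG G] [CommGroup G] [MulAction G P] [MulAction G P']
  {IB : ModelWithCorners ℝ EB HB} {IP : ModelWithCorners ℝ EP HP} {IP' : ModelWithCorners ℝ EP' HP'}
  {π : P → B} {π' : P' → B} {σ : DiffForm IP P 2} {σ' : DiffForm IP' P' 2}
  [LieGroup 𝓘(ℝ, EG) ∞ G]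

/-- Two reductions agree if the identity map of the fibre products is smooth in one direction. -/
lemma IsReduction.unique {hπ : ∀ (g : G) (p : P), π (g • p) = π p}
    {hπ' : ∀ (g : G) (p : P'), π' (g • p) = π' p}
    {cF cF' : ChartedSpace (ModelProd HB (ModelProd EG EG)) (FiberProduct π π')}
    {cT cT' : ChartedSpace (ModelProd HB EG) (BundleTensor hπ hπ')}
    {τ : @DiffForm _ _ _ _ _ (IB.prod 𝓘(ℝ, EG)) (BundleTensor hπ hπ') _ cT 2}
    {τ' : @DiffForm _ _ _ _ _ (IB.prod 𝓘(ℝ, EG)) (BundleTensor hπ hπ') _ cT' 2}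
    (h : IsReduction IB σ σ' hπ hπ' cF cT τ) (h' : IsReduction IB σ σ' hπ hπ' cF' cT' τ')
    (hid : @ContMDiff ℝ _ _ _ _ _ _ (IB.prod (𝓘(ℝ, EG).prod 𝓘(ℝ, EG))) (FiberProduct π π') _ cF'
      _ _ _ _ _ (IB.prod (𝓘(ℝ, EG).prod 𝓘(ℝ, EG))) (FiberProduct π π') _ cF ∞ id) :
    SameSmoothStructure (IB.prod (𝓘(ℝ, EG).prod 𝓘(ℝ, EG))) cF cF' ∧
    SameSmoothStructure (IB.prod 𝓘(ℝ, EG)) cT cT' ∧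
    @DiffForm.pullback _ _ _ _ _ _ _ _ _ _ cT _ _ _ _ cT' (IB.prod 𝓘(ℝ, EG)) (IB.prod 𝓘(ℝ, EG)) 2
      id τ' = τ := by
  let aF := fiberProductAction hπ hπ'
  let aA := fiberProductAntidiagonalAction hπ hπ'
  -- All maps are identities between two structures on the same sets, and both inclusions go to N =
  -- P × P'.
  obtain ⟨h1, h2, h3, h4⟩ := contMDiff_and_pullback_eq_of_bundleMap (f := id) (h := id) (h' := id)
    h.fiber_principal h'.fiber_principal h.orbit_principal h'.orbit_principal h'.incl_smooth hid
    (fun _ => rfl) (fun _ _ => rfl) (fun _ => rfl) rfl rfl rfl h.form_reduced h'.form_reduced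
  exact ⟨⟨h1, hid⟩, ⟨h2, h3⟩, h4⟩

end TensorUniqueness

/-! ### Immersivity and local injectivity of ψ. -/

section LocalEmbedding

variable {E H M E' H' M' : Type*}
  [NormedAddCommGroup E] [NormedSpace ℝ E] [TopologicalSpace H]
  [TopologicalSpace M] [ChartedSpace H M]
  [NormedAddCommGroup E'] [NormedSpace ℝ E'] [TopologicalSpace H']
  [TopologicalSpace M'] [ChartedSpace H' M']
  {I : ModelWithCorners ℝ E H} {I' : ModelWithCorners ℝ E' H'}

/-- A map with a differentiable local left inverse, defined on a set containing its local image, is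
an immersion. -/
lemma injective_modelDeriv_of_leftInverse {f : M → M'} {g : M' → M} {s : Set M} {t : Set M'}
    {x : M} (hf : MDifferentiableAt I I' f x) (hg : MDifferentiableWithinAt I' I g t (f x))
    (hs : s ∈ 𝓝 x) (hst : MapsTo f s t) (hgf : ∀ y ∈ s, g (f y) = y) :
    Function.Injective (modelDeriv I I' f x) := by
  -- Any derivative of g within t will do: g ∘ f is the identity on a full neighbourhood of x, so
  -- derivatives on t need not be unique.
  have h1 := (hg.hasMFDerivWithinAt.comp x hf.hasMFDerivAt.hasMFDerivWithinAt hst).hasMFDerivAt hs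
  have h2 : g ∘ f =ᶠ[𝓝 x] id := by filter_upwards [hs] with y hy using hgf y hy
  have h3 := hasMFDerivAt_unique (h1.congr_of_eventuallyEq h2.symm) (hasMFDerivAt_id x)
  intro v w hvw
  have key : ∀ v, (mfderivWithin I' I g t (f x) : E' →L[ℝ] E) (modelDeriv I I' f x v) = v :=
    fun v => DFunLike.congr_fun h3 v
  rw [← key v, hvw, key]

/-- A unimodular local embedding restricts to an immersion on open subsets. -/
lemma IsUnimodularLocalEmbedding.injective_modelDeriv {EG G : Type*} [NormedAddCommGroup EG]
    [NormedSpace ℝ EG] [TopologicalSpace G] [ChartedSpace EG G] [CommGroup G]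
    {ψ : M → (EG →L[ℝ] ℝ)} (hψ : IsUnimodularLocalEmbedding I G ψ) (U : TopologicalSpace.Opens M)
    (u : U) : Function.Injective (modelDeriv I 𝓘(ℝ, EG →L[ℝ] ℝ) (fun x : U => ψ x) u) := by
  classical
  obtain ⟨C, T, O, φ, -, hT, hu, -, himage, hφψ, hφ⟩ := hψ.locally_cone u
  have hmem : ∀ y ∈ T, ψ y ∈ C ∩ O := fun y hy => himage ▸ mem_image_of_mem ψ hy
  -- The local inverse φ has values in M. Composing it with j, which is the identity on U and
  -- constant outside, gives a U-valued left inverse that is differentiable where needed.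
  let j : M → U := fun y => if h : y ∈ U then ⟨y, h⟩ else u
  have hj : ∀ y : U, j y = y := fun y => dif_pos y.2
  have hjs : ContMDiffAt I I ∞ j (u : M) := by
    refine contMDiffAt_subtype_iff.1 ?_
    simp only [hj]
    exact contMDiffAt_id
  have hψU : ContMDiff I 𝓘(ℝ, EG →L[ℝ] ℝ) ∞ (fun x : U => ψ x) :=
    hψ.smooth.comp contMDiff_subtype_val
  have hg : MDifferentiableWithinAt 𝓘(ℝ, EG →L[ℝ] ℝ) I (j ∘ φ) (C ∩ O) (ψ u) := by
    have h1 : MDifferentiableAt I I j (φ (ψ u)) := by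
      rw [hφψ u hu]
      exact hjs.mdifferentiableAt (by simp)
    exact h1.comp_mdifferentiableWithinAt _
      ((hφ _ (hmem u hu)).mdifferentiableWithinAt (by simp))
  refine injective_modelDeriv_of_leftInverse (s := Subtype.val ⁻¹' T)
    ((hψU u).mdifferentiableAt (by simp)) hg
    ((hT.preimage continuous_subtype_val).mem_nhds hu) (fun y hy => hmem y hy) fun y hy => ?_
  change j (φ (ψ y)) = y
  rw [hφψ y hy, hj]

lemma IsUnimodularLocalEmbedding.exists_injOn {EG G : Type*} [NormedAddCommGroup EG]
    [NormedSpace ℝ EG] [TopologicalSpace G] [ChartedSpace EG G] [CommGroup G]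
    {ψ : M → (EG →L[ℝ] ℝ)} (hψ : IsUnimodularLocalEmbedding I G ψ) (x : M) :
    ∃ T : Set M, IsOpen T ∧ x ∈ T ∧ InjOn ψ T := by
  obtain ⟨C, T, O, φ, -, hT, hx, -, -, hφψ, -⟩ := hψ.locally_cone x
  exact ⟨T, hT, hx, LeftInvOn.injOn hφψ⟩

/-- For a locally injective map `ψ`, the fibre product of two maps is open in the fibre product of
their compositions with `ψ`. -/
lemma exists_isOpen_fiberProduct_eq {X Y Y' Z : Type*} [TopologicalSpace X] [TopologicalSpace Y]
    [TopologicalSpace Y'] {ψ : X → Z} (hψ : ∀ x, ∃ T : Set X, IsOpen T ∧ x ∈ T ∧ InjOn ψ T)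
    {f : Y → X} {f' : Y' → X} (hf : Continuous f) (hf' : Continuous f') :
    ∃ O : Set (Y × Y'), IsOpen O ∧
      {x : Y × Y' | f x.1 = f' x.2} = O ∩ {x | ψ (f x.1) = ψ (f' x.2)} := by
  choose T hT hmem hinj using hψ
  -- The open set consists of the pairs whose images lie in a common set on which ψ is injective.
  refine ⟨⋃ x, {z | f z.1 ∈ T x ∧ f' z.2 ∈ T x}, isOpen_iUnion fun x =>
    ((hT x).preimage (hf.comp continuous_fst)).inter ((hT x).preimage (hf'.comp continuous_snd)),
    Subset.antisymm (fun z hz => ?_) fun z hz => ?_⟩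
  · have hz' : f z.1 = f' z.2 := hz
    refine ⟨mem_iUnion.2 ⟨f z.1, hmem _, ?_⟩, congrArg ψ hz'⟩
    rw [← hz']
    exact hmem _
  · obtain ⟨x, h1, h2⟩ := mem_iUnion.1 hz.1
    exact hinj x h1 h2 hz.2

end LocalEmbedding

end

/-! ### The proposition. -/

theorem proposition3p1
    -- the torus `G`
    {EG G : Type*} [NormedAddCommGroup EG] [NormedSpace ℝ EG] [FiniteDimensional ℝ EG]
    [TopologicalSpace G] [ChartedSpace EG G] [CommGroup G] [LieGroup 𝓘(ℝ, EG) ∞ G]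
    [T2Space G] [CompactSpace G] [ConnectedSpace G]
    -- the manifold with corners `W`, the unimodular local embedding `ψ`, the open set `U`
    {n : ℕ} {W : Type*} [TopologicalSpace W] [ChartedSpace (EuclideanQuadrant n) W]
    (hW : IsSmoothManifold (modelWithCornersEuclideanQuadrant n) W)
    (ψ : W → (EG →L[ℝ] ℝ))
    (hψ : IsUnimodularLocalEmbedding (modelWithCornersEuclideanQuadrant n) G ψ)
    (U : TopologicalSpace.Opens W)
    -- the symplectic toric principal bundles `(P, σ)` and `(P', σ')` over `U`
    {EP HP P : Type*} [NormedAddCommGroup EP] [NormedSpace ℝ EP] [FiniteDimensional ℝ EP]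
    [TopologicalSpace HP] {IP : ModelWithCorners ℝ EP HP}
    [TopologicalSpace P] [ChartedSpace HP P] [MulAction G P]
    (π : P → U) (σ : DiffForm IP P 2)
    (hP : IsSymplecticToricBundle (modelWithCornersEuclideanQuadrant n) G
      (fun u : U => ψ u) π σ)
    {EP' HP' P' : Type*} [NormedAddCommGroup EP'] [NormedSpace ℝ EP'] [FiniteDimensional ℝ EP']
    [TopologicalSpace HP'] {IP' : ModelWithCorners ℝ EP' HP'}
    [TopologicalSpace P'] [ChartedSpace HP' P'] [MulAction G P']
    (π' : P' → U) (σ' : DiffForm IP' P' 2)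
    (hP' : IsSymplecticToricBundle (modelWithCornersEuclideanQuadrant n) G
      (fun u : U => ψ u) π' σ') :
    -- `μ (p, p') = ψ (π p) - ψ (π' p')` is a moment map for the anti-diagonal action
    (letI := antidiagonalAction G P P';
      IsMomentMap G (σ.boxSum σ') (fun x : P × P' => ψ (π x.1) - ψ (π' x.2))) ∧
    -- `P ×_U P'` is open and closed in the zero level of `μ`; it is the zero level if `ψ|_U` is
    -- injective
    (∃ O : Set (P × P'), IsOpen O ∧
      {x : P × P' | π x.1 = π' x.2} = O ∩ {x | ψ (π x.1) - ψ (π' x.2) = 0}) ∧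
    IsClosed {x : P × P' | π x.1 = π' x.2} ∧
    (InjOn ψ U → {x : P × P' | π x.1 = π' x.2} = {x | ψ (π x.1) - ψ (π' x.2) = 0}) ∧
    -- the reduced space `P ⊗ P'` is a symplectic toric principal bundle over `U`
    ∃ (cF : ChartedSpace (ModelProd (EuclideanQuadrant n) (ModelProd EG EG)) (FiberProduct π π'))
      (cT : ChartedSpace (ModelProd (EuclideanQuadrant n) EG)
        (BundleTensor hP.principal.proj_smul hP'.principal.proj_smul))
      (τ : DiffForm ((modelWithCornersEuclideanQuadrant n).prod 𝓘(ℝ, EG))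
        (BundleTensor hP.principal.proj_smul hP'.principal.proj_smul) 2),
      IsReduction (modelWithCornersEuclideanQuadrant n) σ σ'
        hP.principal.proj_smul hP'.principal.proj_smul cF cT τ ∧
      (letI := BundleTensor.action hP.principal.proj_smul hP'.principal.proj_smul;
        IsSymplecticToricBundle (modelWithCornersEuclideanQuadrant n) G (fun u : U => ψ u)
          (BundleTensor.proj hP.principal.proj_smul hP'.principal.proj_smul) τ) ∧
      -- these smooth structures and the reduced form are unique
      ∀ (cF₂ : ChartedSpace (ModelProd (EuclideanQuadrant n) (ModelProd EG EG))
          (FiberProduct π π'))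
        (cT₂ : ChartedSpace (ModelProd (EuclideanQuadrant n) EG)
          (BundleTensor hP.principal.proj_smul hP'.principal.proj_smul))
        (τ₂ : @DiffForm _ _ _ _ _ ((modelWithCornersEuclideanQuadrant n).prod 𝓘(ℝ, EG))
          (BundleTensor hP.principal.proj_smul hP'.principal.proj_smul) _ cT₂ 2),
        IsReduction (modelWithCornersEuclideanQuadrant n) σ σ'
          hP.principal.proj_smul hP'.principal.proj_smul cF₂ cT₂ τ₂ →
        SameSmoothStructure ((modelWithCornersEuclideanQuadrant n).prod
          (𝓘(ℝ, EG).prod 𝓘(ℝ, EG))) cF cF₂ ∧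
        SameSmoothStructure ((modelWithCornersEuclideanQuadrant n).prod 𝓘(ℝ, EG)) cT cT₂ ∧
        @DiffForm.pullback _ _ _ _ _ _ _ _ _ _ cT _ _ _ _ cT₂
          ((modelWithCornersEuclideanQuadrant n).prod 𝓘(ℝ, EG))
          ((modelWithCornersEuclideanQuadrant n).prod 𝓘(ℝ, EG)) 2 id τ₂ = τ := by
  have := hW.isManifold
  have := hW.t2
  have hψU : ContMDiff (modelWithCornersEuclideanQuadrant n) 𝓘(ℝ, EG →L[ℝ] ℝ) ∞
      (fun u : U => ψ u) := hψ.smooth.comp contMDiff_subtype_val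
  have hinj := hψ.injective_modelDeriv U
  have hπ := hP.principal.proj_smooth.continuous
  have hπ' := hP'.principal.proj_smooth.continuous
  refine ⟨hP.moment.antidiagonal hP'.moment hP.principal.smul_smooth hP'.principal.smul_smooth,
    ?_, isClosed_eq (hπ.comp continuous_fst) (hπ'.comp continuous_snd), fun hinj => ?_, ?_⟩
  · obtain ⟨O, hO, h⟩ := exists_isOpen_fiberProduct_eq hψ.exists_injOn
      (continuous_subtype_val.comp hπ) (continuous_subtype_val.comp hπ')
    refine ⟨O, hO, ?_⟩
    simpa only [sub_eq_zero, Function.comp_apply, Subtype.ext_iff] using h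
  · ext x
    simp only [mem_ofPred_eq, sub_eq_zero]
    exact ⟨fun h => by rw [h], fun h => Subtype.ext (hinj (π x.1).2 (π' x.2).2 h)⟩
  · obtain ⟨τ, hτ⟩ := BundleTensor.exists_reducedForm hP hP'
    have hred := BundleTensor.isReduction_of_pullback_eq hP hP' τ hτ
    refine ⟨_, _, τ, hred,
      BundleTensor.isSymplecticToricBundle_of_pullback_eq hP hP' hψU hinj τ hτ,
      fun cF₂ cT₂ τ₂ h₂ => hred.unique h₂ ?_⟩
    -- The identity from the other structure to the constructed one is smooth because its composite
    -- into P × P' is that structure's inclusion, smooth by assumption.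
    exact FiberProduct.contMDiff_of_contMDiff_val hP.principal hP'.principal h₂.incl_smooth
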